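/- Conventions. Manifolds are smooth manifolds without boundary modelled on Banach spaces and vector bundles are smooth Banach bundles (finite dimension included). A Lie algebroid $\mathcal A\to B$ has an anchor $\#:\mathcal A\to TB$ (a smooth bundle map) and a Lie bracket on (local) smooth sections with $[\zeta,f\eta]=f[\zeta,\eta]+(\#\zeta\cdot f)\eta$; the algebroid differential $d_{\mathcal A}\xi(\zeta,\eta)=-\xi([\zeta,\eta])+\#\zeta\cdot\xi(\eta)-\#\eta\cdot\xi(\zeta)$ of a smooth $1$-form is required to be a smooth $2$-form on $\mathcal A$ (automatic in finite dimension). It is transitive if $\#$ is surjective on fibres. $\mathcal A^*$ is the dual bundle; in infinite dimension it may be a smooth dual, i.e. any Banach bundle with a smooth nondegenerate fibrewise pairing with $\mathcal A$. Smooth functions on $\mathcal A^*$ are those whose fibrewise differentials $d^Ff$ are smooth maps to $\mathcal A$ (automatic in finite dimension), with the Poisson bracket $$\{f,g\}(\xi)=-d_{\mathcal A}\hat\xi(d^F_\xi f,d^F_\xi g)+\#d^F_\xi f\cdot(g\circ\hat\xi)-\#d^F_\xi g\cdot(f\circ\hat\xi),$$ $\hat\xi$ a section extending $\xi$ (so that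 $\{\zeta,\eta\}=[\zeta,\eta]$ and $\{\zeta,f\}=\#\zeta\cdot f$ for sections $\zeta,\eta$ of $\mathcal A$ and functions $f$ on $B$). Trajectories of a Hamiltonian $h$ are the differentiable curves with $\frac{d}{dt}f(\xi(t))=\{h,f\}(\xi(t))$ for all smooth (local) functions $f$, and the symplectic leaf through a point is the set of points joined to it by finitely many pieces of trajectories of local Hamiltonians. An inertia operator is a smooth invertible symmetric bundle map $\mathcal I:\mathcal A\to\mathcal A^*$; it defines the metric $\langle u,v\rangle_{\mathcal A}=\langle\mathcal I u,v\rangle$, and the Euler–Arnold flow is the Hamiltonian flow on $\mathcal A^*$ of $\mathcal H(\xi)=\frac12\langle\mathcal I^{-1}\xi,\mathcal I^{-1}\xi\rangle_{\mathcal A}$. Let $\#^*(T^*B)$ be the set of those elements of $\mathcal A^*$ that have the form $\#^*p=p\circ\#$ with $p\in T^*B$. A trajectory of the geodesic flow of a (possibly weak) Riemannian metric $g$ on $B$ is a curve $p(t)=g(\dot x(t),\cdot)$ in $T^*B$ with $x(t)$ a geodesic of $g$. Proposition. Let $\mathcal A\to B$ be a transitive Lie algebroid, and let $\langle\,,\rangle_{\mathcal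 A}$ be the positive-definite metric on $\mathcal A$ given by an invertible inertia operator $\mathcal I:\mathcal A\to\mathcal A^*$. Assume that there is an orthogonal decomposition of vector bundles $\mathcal A=\mathrm{Ker}\,\#\oplus(\mathrm{Ker}\,\#)^\perp$ with smooth projections (automatic in finite dimension), and let $\#^{-1}:TB\to(\mathrm{Ker}\,\#)^\perp$ be the inverse of the restriction of $\#$ to $(\mathrm{Ker}\,\#)^\perp$. Then $\langle\zeta,\eta\rangle_B:=\langle\#^{-1}\zeta,\#^{-1}\eta\rangle_{\mathcal A}$ is a smooth (possibly weak) Riemannian metric on $B$, and the following holds. 1. If $B$ is connected, $\#^*(T^*B)$ is a symplectic leaf of $\mathcal A^*$. For every $B$, an Euler–Arnold trajectory (on an open interval) that meets $\#^*(T^*B)$ stays in it; and the pullback to $T^*B$ of the Euler–Arnold flow on $\#^*(T^*B)$ is the geodesic flow of $\langle\,,\rangle_B$: for a curve $p(t)$ in $T^*B$ with $\#^*p(t)\in\mathcal A^*$, defined on an open set of times, $\#^*p(t)$ is an Euler–Arnold trajectory if and only if $p(t)$ is a trajectory of the geodesic flow of $\langle\,,\rangle_B$. 2. The anchor is a Riemannian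 submersion of vector bundles $(\mathcal A,\langle\,,\rangle_{\mathcal A})\to(TB,\langle\,,\rangle_B)$: on each fibre it restricts to a bijective isometry $(\mathrm{Ker}\,\#)^\perp\to TB$. 3. Suppose moreover that $\mathcal A$ is the Lie algebroid of a transitive Lie groupoid $\mathcal G\rightrightarrows B$ (with fibre over $x$ the tangent space at $\mathrm{id}_x$ of the source fibre $\mathcal G_x=\mathrm{src}^{-1}(x)$, anchor the differential of the target map $\mathrm{trg}$, and bracket that of right-invariant vector fields tangent to source fibres), and let $\langle\,,\rangle_{\mathcal G}$ be the right-invariant metric on the source fibres that coincides with $\langle\,,\rangle_{\mathcal A}$ at the identities. Then for every $x\in B$ the map $\mathrm{trg}:(\mathcal G_x,\langle\,,\rangle_{\mathcal G})\to(B,\langle\,,\rangle_B)$ is a Riemannian submersion: it is smooth, its differential at each point is surjective, and it maps the orthogonal complement of the kernel of the differential isometrically onto the tangent space of $B$. -/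

import Mathlib

open Bundle Set
open scoped Manifold ContDiff Topology

noncomputable section EulerArnold

/-! Manifolds are boundaryless smooth manifolds modelled on Banach spaces, and vector bundles are
smooth Banach bundles; finite dimension is a special case. -/

section Base

variable {EB : Type*} [NormedAddCommGroup EB] [NormedSpace ℝ EB]
  {B : Type*} [TopologicalSpace B] [ChartedSpace EB B]

/-- The derivative `v · f` of a function `f` on `B` along a tangent vector `v`. -/
def dirDeriv {x : B} (v : TangentSpace 𝓘(ℝ, EB) x) (f : B → ℝ) : ℝ :=
  mfderiv 𝓘(ℝ, EB) 𝓘(ℝ, ℝ) f x v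

/-- The section `s` of the vector bundle `E` with typical fibre `F` is smooth on `U`. -/
def SmoothSectionOn (EB : Type*) [NormedAddCommGroup EB] [NormedSpace ℝ EB]
    {B : Type*} [TopologicalSpace B] [ChartedSpace EB B]
    (F : Type*) [NormedAddCommGroup F] [NormedSpace ℝ F] {E : B → Type*}
    [TopologicalSpace (TotalSpace F E)] [∀ x, TopologicalSpace (E x)] [FiberBundle F E]
    (s : ∀ x, E x) (U : Set B) : Prop :=
  ContMDiffOn 𝓘(ℝ, EB) (𝓘(ℝ, EB).prod 𝓘(ℝ, F)) ∞ (fun x => TotalSpace.mk' F x (s x)) U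

/-- A smooth Riemannian metric on `B`: a smooth field of symmetric positive definite
bilinear forms on the tangent spaces. In infinite dimension the metric may be weak, that is,
it need not induce the topology of the tangent spaces. -/
structure RiemannMetric (EB : Type*) [NormedAddCommGroup EB] [NormedSpace ℝ EB]
    (B : Type*) [TopologicalSpace B] [ChartedSpace EB B] [IsManifold 𝓘(ℝ, EB) ∞ B] where
  form : ∀ x : B, TangentSpace 𝓘(ℝ, EB) x →L[ℝ] TangentSpace 𝓘(ℝ, EB) x →L[ℝ] ℝ
  symm : ∀ x v w, form x v w = form x w v
  pos : ∀ x v, v ≠ 0 → 0 < form x v v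
  contMDiff : ContMDiff 𝓘(ℝ, EB) (𝓘(ℝ, EB).prod 𝓘(ℝ, EB →L[ℝ] EB →L[ℝ] ℝ)) ∞
    (fun x => TotalSpace.mk' (EB →L[ℝ] EB →L[ℝ] ℝ) x (form x))

/-- The velocity `x'(t)` of a curve in `B`. -/
def curveVelocity (EB : Type*) [NormedAddCommGroup EB] [NormedSpace ℝ EB]
    {B : Type*} [TopologicalSpace B] [ChartedSpace EB B] (x : ℝ → B) (t : ℝ) :
    TangentSpace 𝓘(ℝ, EB) (x t) :=
  mfderiv 𝓘(ℝ, ℝ) 𝓘(ℝ, EB) x t (1 : ℝ)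

/-- The metric `g` read in the chart at `x₀`: a field of bilinear forms on the model space. -/
def RiemannMetric.inChart [IsManifold 𝓘(ℝ, EB) ∞ B] (g : RiemannMetric EB B) (x₀ : B)
    (y v w : EB) : ℝ :=
  g.form ((extChartAt 𝓘(ℝ, EB) x₀).symm y)
    (mfderiv 𝓘(ℝ, EB) 𝓘(ℝ, EB) (extChartAt 𝓘(ℝ, EB) x₀).symm y v)
    (mfderiv 𝓘(ℝ, EB) 𝓘(ℝ, EB) (extChartAt 𝓘(ℝ, EB) x₀).symm y w)

/-- `x` is a geodesic of `g` on `J`: it is twice differentiable, and in charts it satisfies the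
geodesic equation, that is, the Euler-Lagrange equation of the energy
`½ ∫ g(x', x') dt`: `d/dt (g(c', v)) = ½ (∂_v g)(c', c')` for every vector `v` of the
model space, where `c` is `x` read in the chart. -/
structure RiemannMetric.IsGeodesicOn [IsManifold 𝓘(ℝ, EB) ∞ B] (g : RiemannMetric EB B)
    (x : ℝ → B) (J : Set ℝ) : Prop where
  differentiable : ∀ t ∈ J, MDifferentiableAt 𝓘(ℝ, ℝ) 𝓘(ℝ, EB) x t
  differentiable_velocity : ∀ t ∈ J, MDifferentiableAt 𝓘(ℝ, ℝ) 𝓘(ℝ, EB).tangent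
    (fun s => (⟨x s, curveVelocity EB x s⟩ : TangentBundle 𝓘(ℝ, EB) B)) t
  euler_lagrange : ∀ t ∈ J, ∀ v : EB,
    let c : ℝ → EB := fun s => extChartAt 𝓘(ℝ, EB) (x t) (x s)
    HasDerivAt (fun s => g.inChart (x t) (c s) (deriv c s) v)
      (1 / 2 * fderiv ℝ (fun y => g.inChart (x t) y (deriv c t) (deriv c t)) (c t) v) t

/-- The curve `t ↦ (x t, p t)` in `T*B` is a trajectory of the geodesic flow of `g`: `x` is a
geodesic, and `p` is the covector `g(x', ·)` that corresponds to its velocity. -/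
def RiemannMetric.IsGeodesicFlowTrajectory [IsManifold 𝓘(ℝ, EB) ∞ B] (g : RiemannMetric EB B)
    (x : ℝ → B) (p : ∀ t, TangentSpace 𝓘(ℝ, EB) (x t) →L[ℝ] ℝ) (J : Set ℝ) : Prop :=
  g.IsGeodesicOn x J ∧ ∀ t ∈ J, p t = g.form (x t) (curveVelocity EB x t)

end Base

section Algebroid

variable {EB : Type*} [NormedAddCommGroup EB] [NormedSpace ℝ EB]
  {B : Type*} [TopologicalSpace B] [ChartedSpace EB B]
  {F : Type*} [NormedAddCommGroup F] [NormedSpace ℝ F]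
  {A : B → Type*} [∀ x, AddCommGroup (A x)] [∀ x, Module ℝ (A x)] [∀ x, TopologicalSpace (A x)]

/-- The expression `#ζ · ξ(η) - #η · ξ(ζ) - ξ([ζ, η])` at `x` that defines the algebroid
differential of the section `ξ` of the dual bundle, for a given anchor and bracket. -/
def algebroidDifferential (anchor : ∀ x, A x →L[ℝ] TangentSpace 𝓘(ℝ, EB) x)
    (bracket : (∀ x, A x) → (∀ x, A x) → ∀ x, A x)
    (ξ : ∀ x, A x →L[ℝ] ℝ) (ζ η : ∀ x, A x) (x : B) : ℝ :=
  - ξ x (bracket ζ η x) + dirDeriv (anchor x (ζ x)) (fun y => ξ y (η y))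
    - dirDeriv (anchor x (η x)) (fun y => ξ y (ζ y))

variable [∀ x, IsTopologicalAddGroup (A x)] [∀ x, ContinuousSMul ℝ (A x)]
  [TopologicalSpace (TotalSpace F A)] [FiberBundle F A] [VectorBundle ℝ F A]

/-- A Lie algebroid over `B`. The bracket acts on local smooth sections: `bracket` is a total
function, but only its values on sections that are smooth on open sets are meaningful.

The last field says that the algebroid differential of a smooth 1-form is a smooth 2-form, in
particular does not depend on how elements of a fibre are extended to sections. If the bundle and
the base have finite dimension, this follows from the Leibniz rule; in infinite dimension this
is part of the definition, which then says that the bracket is a first-order differential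
operator. -/
structure LieAlgebroid (EB : Type*) [NormedAddCommGroup EB] [NormedSpace ℝ EB]
    {B : Type*} [TopologicalSpace B] [ChartedSpace EB B] [IsManifold 𝓘(ℝ, EB) ∞ B]
    (F : Type*) [NormedAddCommGroup F] [NormedSpace ℝ F]
    (A : B → Type*) [∀ x, AddCommGroup (A x)] [∀ x, Module ℝ (A x)]
    [∀ x, TopologicalSpace (A x)] [∀ x, IsTopologicalAddGroup (A x)]
    [∀ x, ContinuousSMul ℝ (A x)]
    [TopologicalSpace (TotalSpace F A)] [FiberBundle F A] [VectorBundle ℝ F A] where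
  anchor : ∀ x, A x →L[ℝ] TangentSpace 𝓘(ℝ, EB) x
  contMDiff_anchor : ContMDiff 𝓘(ℝ, EB) (𝓘(ℝ, EB).prod 𝓘(ℝ, F →L[ℝ] EB)) ∞
    (fun x => TotalSpace.mk' (F →L[ℝ] EB)
      (E := fun x => A x →L[ℝ] TangentSpace 𝓘(ℝ, EB) x) x (anchor x))
  bracket : (∀ x, A x) → (∀ x, A x) → ∀ x, A x
  smooth_bracket : ∀ (U : Set B), IsOpen U → ∀ ζ η, SmoothSectionOn EB F ζ U →
    SmoothSectionOn EB F η U → SmoothSectionOn EB F (bracket ζ η) U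
  bracket_local : ∀ (U : Set B), IsOpen U → ∀ ζ η ζ' η', SmoothSectionOn EB F ζ U →
    SmoothSectionOn EB F η U → (∀ x ∈ U, ζ x = ζ' x) → (∀ x ∈ U, η x = η' x) →
    ∀ x ∈ U, bracket ζ η x = bracket ζ' η' x
  bracket_skew : ∀ (U : Set B), IsOpen U → ∀ ζ η, SmoothSectionOn EB F ζ U →
    SmoothSectionOn EB F η U → ∀ x ∈ U, bracket ζ η x = - bracket η ζ x
  bracket_add : ∀ (U : Set B), IsOpen U → ∀ ζ η θ, SmoothSectionOn EB F ζ U →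
    SmoothSectionOn EB F η U → SmoothSectionOn EB F θ U →
    ∀ x ∈ U, bracket ζ (fun y => η y + θ y) x = bracket ζ η x + bracket ζ θ x
  jacobi : ∀ (U : Set B), IsOpen U → ∀ ζ η θ, SmoothSectionOn EB F ζ U →
    SmoothSectionOn EB F η U → SmoothSectionOn EB F θ U → ∀ x ∈ U,
    bracket ζ (bracket η θ) x + bracket η (bracket θ ζ) x + bracket θ (bracket ζ η) x = 0
  leibniz : ∀ (U : Set B), IsOpen U → ∀ ζ η, ∀ f : B → ℝ, SmoothSectionOn EB F ζ U →
    SmoothSectionOn EB F η U → ContMDiffOn 𝓘(ℝ, EB) 𝓘(ℝ, ℝ) ∞ f U → ∀ x ∈ U,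
    bracket ζ (fun y => f y • η y) x =
      f x • bracket ζ η x + dirDeriv (anchor x (ζ x)) f • η x
  differential_smooth : ∀ (U : Set B), IsOpen U → ∀ ξ : ∀ x, A x →L[ℝ] ℝ,
    ContMDiffOn 𝓘(ℝ, EB) (𝓘(ℝ, EB).prod 𝓘(ℝ, F →L[ℝ] ℝ)) ∞
      (fun x => TotalSpace.mk' (F →L[ℝ] ℝ) x (ξ x)) U →
    ∃ Ω : ∀ x, A x →L[ℝ] A x →L[ℝ] ℝ,
      ContMDiffOn 𝓘(ℝ, EB) (𝓘(ℝ, EB).prod 𝓘(ℝ, F →L[ℝ] F →L[ℝ] ℝ)) ∞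
        (fun x => TotalSpace.mk' (F →L[ℝ] F →L[ℝ] ℝ) x (Ω x)) U ∧
      ∀ (V : Set B), IsOpen V → V ⊆ U → ∀ ζ η, SmoothSectionOn EB F ζ V →
        SmoothSectionOn EB F η V → ∀ x ∈ V,
        algebroidDifferential anchor bracket ξ ζ η x = Ω x (ζ x) (η x)

/-- A Lie algebroid is transitive if its anchor is surjective. -/
def LieAlgebroid.IsTransitive [IsManifold 𝓘(ℝ, EB) ∞ B] (L : LieAlgebroid EB F A) : Prop :=
  ∀ x, Function.Surjective (L.anchor x)

/-- A realization of the (smooth) dual bundle of `A`: a vector bundle `D` with a smooth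
nondegenerate fibrewise pairing with `A`. In finite dimension, `D` is necessarily the usual dual
bundle; in infinite dimension it may consist of only some of the functionals. -/
structure SmoothDual (EB : Type*) [NormedAddCommGroup EB] [NormedSpace ℝ EB]
    {B : Type*} [TopologicalSpace B] [ChartedSpace EB B]
    (F : Type*) [NormedAddCommGroup F] [NormedSpace ℝ F]
    (A : B → Type*) [∀ x, AddCommGroup (A x)] [∀ x, Module ℝ (A x)]
    [∀ x, TopologicalSpace (A x)] [∀ x, IsTopologicalAddGroup (A x)]
    [∀ x, ContinuousSMul ℝ (A x)]
    [TopologicalSpace (TotalSpace F A)] [FiberBundle F A] [VectorBundle ℝ F A]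
    (FD : Type*) [NormedAddCommGroup FD] [NormedSpace ℝ FD]
    (D : B → Type*) [∀ x, AddCommGroup (D x)] [∀ x, Module ℝ (D x)]
    [∀ x, TopologicalSpace (D x)]
    [TopologicalSpace (TotalSpace FD D)] [FiberBundle FD D] [VectorBundle ℝ FD D] where
  pairing : ∀ x, D x →L[ℝ] A x →L[ℝ] ℝ
  contMDiff_pairing : ContMDiff 𝓘(ℝ, EB) (𝓘(ℝ, EB).prod 𝓘(ℝ, FD →L[ℝ] F →L[ℝ] ℝ)) ∞
    (fun x => TotalSpace.mk' (FD →L[ℝ] F →L[ℝ] ℝ)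
      (E := fun x => D x →L[ℝ] A x →L[ℝ] ℝ) x (pairing x))
  eq_zero_of_left : ∀ x (ξ : D x), (∀ a : A x, pairing x ξ a = 0) → ξ = 0
  eq_zero_of_right : ∀ x (a : A x), (∀ ξ : D x, pairing x ξ a = 0) → a = 0

/-- The usual dual bundle `A*`, with fibres the continuous functionals on the fibres of `A` and
with the evaluation pairing. -/
def SmoothDual.standard (EB : Type*) [NormedAddCommGroup EB] [NormedSpace ℝ EB]
    {B : Type*} [TopologicalSpace B] [ChartedSpace EB B]
    (F : Type*) [NormedAddCommGroup F] [NormedSpace ℝ F]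
    (A : B → Type*) [∀ x, AddCommGroup (A x)] [∀ x, Module ℝ (A x)]
    [∀ x, TopologicalSpace (A x)] [∀ x, IsTopologicalAddGroup (A x)]
    [∀ x, ContinuousSMul ℝ (A x)]
    [TopologicalSpace (TotalSpace F A)] [FiberBundle F A] [VectorBundle ℝ F A] :
    SmoothDual EB F A (F →L[ℝ] ℝ) (fun x => A x →L[ℝ] ℝ) where
  pairing x := ContinuousLinearMap.id ℝ _
  contMDiff_pairing := by
    intro x₀
    rw [contMDiffAt_hom_bundle]
    refine ⟨contMDiffAt_id, ?_⟩
    refine (contMDiffAt_const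
      (c := ContinuousLinearMap.id ℝ (F →L[ℝ] ℝ))).congr_of_eventuallyEq ?_
    filter_upwards [(trivializationAt (F →L[ℝ] ℝ) (fun x => A x →L[ℝ] ℝ)
      x₀).open_baseSet.mem_nhds (FiberBundle.mem_baseSet_trivializationAt' x₀)] with x hx
    ext1 φ
    simp only [ContinuousLinearMap.inCoordinates, ContinuousLinearMap.comp_apply,
      ContinuousLinearMap.id_apply]
    rw [Bundle.Trivialization.continuousLinearMapAt_symmL _ hx]
  eq_zero_of_left x ξ h := by ext a; exact h a
  eq_zero_of_right x a h := by
    by_contra ha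
    let e := (trivializationAt F A x).continuousLinearEquivAt ℝ x
      (FiberBundle.mem_baseSet_trivializationAt' x)
    have hea : ‖e a‖ ≠ 0 := by simpa using ha
    obtain ⟨f, -, hf⟩ := exists_dual_vector ℝ (e a) hea
    have h1 : f (e a) = 0 := h (f.comp (e : A x →L[ℝ] F))
    rw [h1] at hf
    exact hea (by simpa using hf.symm)

variable
  {FD : Type*} [NormedAddCommGroup FD] [NormedSpace ℝ FD]
  {D : B → Type*} [∀ x, AddCommGroup (D x)] [∀ x, Module ℝ (D x)]
  [∀ x, TopologicalSpace (D x)]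
  [TopologicalSpace (TotalSpace FD D)] [FiberBundle FD D] [VectorBundle ℝ FD D]

/-- An element of `A x` that represents the differential at `ξ` of the restriction of `f` to the
fibre through `ξ`; it is unique if it exists. -/
def SmoothDual.fiberDifferential (S : SmoothDual EB F A FD D) (f : TotalSpace FD D → ℝ)
    (ξ : TotalSpace FD D) : A ξ.proj :=
  Classical.epsilon fun a : A ξ.proj => ∀ η : D ξ.proj,
    HasDerivAt (fun t : ℝ => f ⟨ξ.proj, ξ.2 + t • η⟩) (S.pairing ξ.proj η a) 0

/-- `f` is smooth on `W`, and its fibrewise differentials are represented by elements of `A`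
that depend smoothly on the point. In finite dimension the second condition follows from the
first. -/
def SmoothDual.IsSmoothFunctionOn (S : SmoothDual EB F A FD D) (f : TotalSpace FD D → ℝ)
    (W : Set (TotalSpace FD D)) : Prop :=
  ContMDiffOn (𝓘(ℝ, EB).prod 𝓘(ℝ, FD)) 𝓘(ℝ, ℝ) ∞ f W ∧
  ∃ a : ∀ ξ : TotalSpace FD D, A ξ.proj,
    ContMDiffOn (𝓘(ℝ, EB).prod 𝓘(ℝ, FD)) (𝓘(ℝ, EB).prod 𝓘(ℝ, F)) ∞
      (fun ξ => TotalSpace.mk' F ξ.proj (a ξ)) W ∧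
    ∀ ξ ∈ W, ∀ η : D ξ.proj,
      HasDerivAt (fun t : ℝ => f ⟨ξ.proj, ξ.2 + t • η⟩) (S.pairing ξ.proj η (a ξ)) 0

variable [IsManifold 𝓘(ℝ, EB) ∞ B]

/-- The Poisson bracket of functions on the dual of the Lie algebroid `L`,
`{f, g}(ξ) = - d_A ξ̂ (a, b) + #a · (g ∘ ξ̂) - #b · (f ∘ ξ̂)`, where `a` and `b` are the fibrewise
differentials of `f` and `g` at `ξ`, and `ξ̂` is a section that extends `ξ`. The value does not
depend on the extensions of `ξ`, `a` and `b` to sections, and those that are constant in a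
trivialization are used. -/
def LieAlgebroid.poissonBracket (L : LieAlgebroid EB F A) (S : SmoothDual EB F A FD D)
    (f g : TotalSpace FD D → ℝ) (ξ : TotalSpace FD D) : ℝ :=
  let a : A ξ.proj := S.fiberDifferential f ξ
  let b : A ξ.proj := S.fiberDifferential g ξ
  let ξ' : ∀ x, D x := FiberBundle.extend FD ξ.2
  dirDeriv (L.anchor ξ.proj a) (fun x => g ⟨x, ξ' x⟩)
    - dirDeriv (L.anchor ξ.proj b) (fun x => f ⟨x, ξ' x⟩)
    - algebroidDifferential L.anchor L.bracket (fun x => S.pairing x (ξ' x))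
      (FiberBundle.extend F a) (FiberBundle.extend F b) ξ.proj

/-- `γ` is a trajectory on `J` of the Hamiltonian equation with Hamiltonian `h`: it is
differentiable, and `d/dt f(γ(t)) = {h, f}(γ(t))` for all smooth functions `f`. (The sign is the
one for which `{ζ, f} = #ζ · f` for a linear function `ζ` and a function `f` on the base.) -/
def LieAlgebroid.IsHamiltonianTrajectory (L : LieAlgebroid EB F A) (S : SmoothDual EB F A FD D)
    (h : TotalSpace FD D → ℝ) (γ : ℝ → TotalSpace FD D) (J : Set ℝ) : Prop :=
  ∀ t ∈ J, MDifferentiableAt 𝓘(ℝ, ℝ) (𝓘(ℝ, EB).prod 𝓘(ℝ, FD)) γ t ∧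
    ∀ (W : Set (TotalSpace FD D)) (f : TotalSpace FD D → ℝ), IsOpen W → γ t ∈ W →
      S.IsSmoothFunctionOn f W →
      HasDerivAt (fun s => f (γ s)) (L.poissonBracket S h f (γ t)) t

/-- `η` is reached from `ξ` in unit time along a trajectory of a (local) Hamiltonian. -/
def LieAlgebroid.HamiltonianStep (L : LieAlgebroid EB F A) (S : SmoothDual EB F A FD D)
    (ξ η : TotalSpace FD D) : Prop :=
  ∃ (W : Set (TotalSpace FD D)) (h : TotalSpace FD D → ℝ) (J : Set ℝ) (γ : ℝ → TotalSpace FD D),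
    IsOpen W ∧ S.IsSmoothFunctionOn h W ∧ IsOpen J ∧ Icc 0 1 ⊆ J ∧ (∀ t ∈ J, γ t ∈ W) ∧
    L.IsHamiltonianTrajectory S h γ J ∧ γ 0 = ξ ∧ γ 1 = η

/-- The symplectic leaf through `ξ`: the set of points that can be joined to `ξ` by finitely
many pieces of Hamiltonian trajectories. -/
def LieAlgebroid.symplecticLeaf (L : LieAlgebroid EB F A) (S : SmoothDual EB F A FD D)
    (ξ : TotalSpace FD D) : Set (TotalSpace FD D) :=
  {η | Relation.ReflTransGen (L.HamiltonianStep S) ξ η}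

/-- The image `#*(T*B)`: the elements of the dual bundle of the form `#* p = p ∘ #`, where `p` is
a covector on `B`. -/
def LieAlgebroid.dualAnchorImage (L : LieAlgebroid EB F A) (S : SmoothDual EB F A FD D) :
    Set (TotalSpace FD D) :=
  {ξ | ∃ p : TangentSpace 𝓘(ℝ, EB) ξ.proj →L[ℝ] ℝ,
    ∀ a, S.pairing ξ.proj ξ.2 a = p (L.anchor ξ.proj a)}

/-- An inertia operator: a smooth invertible bundle map from `A` to the (smooth) dual bundle that
is symmetric, so that it defines a metric on `A`. -/
structure InertiaOperator (S : SmoothDual EB F A FD D) where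
  toEquiv : ∀ x, A x ≃L[ℝ] D x
  contMDiff : ContMDiff (𝓘(ℝ, EB).prod 𝓘(ℝ, F)) (𝓘(ℝ, EB).prod 𝓘(ℝ, FD)) ∞
    (fun v : TotalSpace F A => TotalSpace.mk' FD v.proj (toEquiv v.proj v.2))
  contMDiff_symm : ContMDiff (𝓘(ℝ, EB).prod 𝓘(ℝ, FD)) (𝓘(ℝ, EB).prod 𝓘(ℝ, F)) ∞
    (fun ξ : TotalSpace FD D => TotalSpace.mk' F ξ.proj ((toEquiv ξ.proj).symm ξ.2))
  symm : ∀ x (u v : A x), S.pairing x (toEquiv x u) v = S.pairing x (toEquiv x v) u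

namespace InertiaOperator

variable {S : SmoothDual EB F A FD D} (I : InertiaOperator S)

/-- The metric `⟨u, v⟩_A = ⟨I u, v⟩`. -/
def metric {x : B} (u v : A x) : ℝ := S.pairing x (I.toEquiv x u) v

/-- The metric is positive definite. -/
def IsPositive : Prop := ∀ x (u : A x), u ≠ 0 → 0 < I.metric u u

/-- The Hamiltonian `½ ⟨ξ, ξ⟩_{A*} = ½ ⟨I⁻¹ ξ, I⁻¹ ξ⟩_A`. -/
def hamiltonian (ξ : TotalSpace FD D) : ℝ :=
  1 / 2 * I.metric ((I.toEquiv ξ.proj).symm ξ.2) ((I.toEquiv ξ.proj).symm ξ.2)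

/-- `γ` is a trajectory on `J` of the groupoid Euler-Arnold flow. -/
def IsEulerArnoldTrajectory (L : LieAlgebroid EB F A) (γ : ℝ → TotalSpace FD D)
    (J : Set ℝ) : Prop :=
  L.IsHamiltonianTrajectory S I.hamiltonian γ J

/-- The orthogonal complement `(Ker #)^⊥` in the fibre over `x`. -/
def horizontal (L : LieAlgebroid EB F A) (x : B) : Set (A x) :=
  {a | ∀ k : A x, L.anchor x k = 0 → I.metric a k = 0}

/-- There is an orthogonal decomposition of vector bundles `A = Ker # ⊕ (Ker #)^⊥`: every element
of a fibre is the sum of an element of `Ker #` and of an element of `(Ker #)^⊥`, and the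
projection to `Ker #` is smooth. -/
def HasOrthogonalDecomposition (L : LieAlgebroid EB F A) : Prop :=
  ∃ P : ∀ x, A x →L[ℝ] A x,
    ContMDiff 𝓘(ℝ, EB) (𝓘(ℝ, EB).prod 𝓘(ℝ, F →L[ℝ] F)) ∞
      (fun x => TotalSpace.mk' (F →L[ℝ] F) (E := fun x => A x →L[ℝ] A x) x (P x)) ∧
    ∀ x (a : A x), L.anchor x (P x a) = 0 ∧ a - P x a ∈ I.horizontal L x

/-- `#⁻¹ : TB → (Ker #)^⊥`, the inverse of the restriction of the anchor to `(Ker #)^⊥`. -/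
def anchorInv (L : LieAlgebroid EB F A) (x : B) : TangentSpace 𝓘(ℝ, EB) x → A x :=
  Function.invFunOn (L.anchor x) (I.horizontal L x)

end InertiaOperator

end Algebroid

section Groupoid

variable {EB : Type*} [NormedAddCommGroup EB] [NormedSpace ℝ EB]
  {B : Type*} [TopologicalSpace B] [ChartedSpace EB B] [IsManifold 𝓘(ℝ, EB) ∞ B]
  {EG : Type*} [NormedAddCommGroup EG] [NormedSpace ℝ EG]
  {G : Type*} [TopologicalSpace G] [ChartedSpace EG G] [IsManifold 𝓘(ℝ, EG) ∞ G]

/-- A Lie groupoid `G` over `B`. The product is a total function of which only the values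
`mul g h` with `src g = trg h` are meaningful. -/
structure LieGroupoid (EB : Type*) [NormedAddCommGroup EB] [NormedSpace ℝ EB]
    (B : Type*) [TopologicalSpace B] [ChartedSpace EB B] [IsManifold 𝓘(ℝ, EB) ∞ B]
    (EG : Type*) [NormedAddCommGroup EG] [NormedSpace ℝ EG]
    (G : Type*) [TopologicalSpace G] [ChartedSpace EG G] [IsManifold 𝓘(ℝ, EG) ∞ G] where
  src : G → B
  trg : G → B
  mul : G → G → G
  one : B → G
  inv : G → G
  src_mul : ∀ g h, src g = trg h → src (mul g h) = src h
  trg_mul : ∀ g h, src g = trg h → trg (mul g h) = trg g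
  mul_assoc : ∀ g h k, src g = trg h → src h = trg k → mul g (mul h k) = mul (mul g h) k
  src_one : ∀ x, src (one x) = x
  trg_one : ∀ x, trg (one x) = x
  one_mul : ∀ g, mul (one (trg g)) g = g
  mul_one : ∀ g, mul g (one (src g)) = g
  src_inv : ∀ g, src (inv g) = trg g
  trg_inv : ∀ g, trg (inv g) = src g
  inv_mul : ∀ g, mul (inv g) g = one (src g)
  mul_inv : ∀ g, mul g (inv g) = one (trg g)
  submersion_src : ∀ g, Manifold.IsSubmersionAt 𝓘(ℝ, EG) 𝓘(ℝ, EB) ∞ src g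
  submersion_trg : ∀ g, Manifold.IsSubmersionAt 𝓘(ℝ, EG) 𝓘(ℝ, EB) ∞ trg g
  contMDiff_mul : ContMDiffOn (𝓘(ℝ, EG).prod 𝓘(ℝ, EG)) 𝓘(ℝ, EG) ∞
    (fun q : G × G => mul q.1 q.2) {q | src q.1 = trg q.2}
  contMDiff_one : ContMDiff 𝓘(ℝ, EB) 𝓘(ℝ, EG) ∞ one
  contMDiff_inv : ContMDiff 𝓘(ℝ, EG) 𝓘(ℝ, EG) ∞ inv

namespace LieGroupoid

variable (𝒢 : LieGroupoid EB B EG G)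

/-- A groupoid is transitive if any two objects are joined by an arrow. -/
def IsTransitive : Prop := ∀ x y, ∃ g, 𝒢.src g = x ∧ 𝒢.trg g = y

/-- The source fibre `G_x`, a submanifold of `G`. -/
def sourceFiber (x : B) : Set G := {g | 𝒢.src g = x}

/-- The tangent space at `g` to the source fibre through `g`. -/
def sourceTangent (g : G) : Submodule ℝ (TangentSpace 𝓘(ℝ, EG) g) :=
  LinearMap.ker (mfderiv 𝓘(ℝ, EG) 𝓘(ℝ, EB) 𝒢.src g).toLinearMap

/-- The differential at `h` of the right translation `G_(trg k) → G_(src k)`, `h ↦ h k`. It is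
meaningful on vectors tangent to the source fibre through `h`. -/
def rightTranslate (k h : G) :
    TangentSpace 𝓘(ℝ, EG) h →L[ℝ] TangentSpace 𝓘(ℝ, EG) (𝒢.mul h k) :=
  mfderivWithin 𝓘(ℝ, EG) 𝓘(ℝ, EG) (fun h' => 𝒢.mul h' k) (𝒢.sourceFiber (𝒢.trg k)) h

variable
  {F : Type*} [NormedAddCommGroup F] [NormedSpace ℝ F]
  {A : B → Type*} [∀ x, AddCommGroup (A x)] [∀ x, Module ℝ (A x)] [∀ x, TopologicalSpace (A x)]

/-- Given identifications `φ` of the fibres of `A` with the tangent spaces to the source fibres at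
the identities, the right-invariant vector field on `G` that extends the section `ζ`. -/
def rightInvariantField (φ : ∀ x, A x →L[ℝ] TangentSpace 𝓘(ℝ, EG) (𝒢.one x))
    (ζ : ∀ x, A x) (g : G) : TangentSpace 𝓘(ℝ, EG) g :=
  (𝒢.one_mul g) ▸ 𝒢.rightTranslate g (𝒢.one (𝒢.trg g)) (φ (𝒢.trg g) (ζ (𝒢.trg g)))

variable [∀ x, IsTopologicalAddGroup (A x)] [∀ x, ContinuousSMul ℝ (A x)]
  [TopologicalSpace (TotalSpace F A)] [FiberBundle F A] [VectorBundle ℝ F A]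

/-- The Lie algebroid `L` corresponds to the Lie groupoid: an identification of `L` with the
algebroid of the groupoid, whose fibre over `x` is the tangent space to the source fibre at
`id_x`, whose anchor is the differential of the target map, and whose bracket is the Lie bracket
of right-invariant vector fields. -/
structure AlgebroidIdentification (𝒢 : LieGroupoid EB B EG G) (L : LieAlgebroid EB F A) where
  toFun : ∀ x, A x →L[ℝ] TangentSpace 𝓘(ℝ, EG) (𝒢.one x)
  injective : ∀ x, Function.Injective (toFun x)
  range_eq : ∀ x, Set.range (toFun x) = (𝒢.sourceTangent (𝒢.one x) : Set _)
  contMDiff : ContMDiff (𝓘(ℝ, EB).prod 𝓘(ℝ, F)) 𝓘(ℝ, EG).tangent ∞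
    (fun v : TotalSpace F A =>
      (⟨𝒢.one v.proj, toFun v.proj v.2⟩ : TangentBundle 𝓘(ℝ, EG) G))
  anchor_eq : ∀ x (a : A x),
    mfderiv 𝓘(ℝ, EG) 𝓘(ℝ, EB) 𝒢.trg (𝒢.one x) (toFun x a) = (𝒢.trg_one x).symm ▸ L.anchor x a
  bracket_eq : ∀ (U : Set B), IsOpen U → ∀ ζ η, SmoothSectionOn EB F ζ U →
    SmoothSectionOn EB F η U → ∀ x ∈ U,
    VectorField.mlieBracket 𝓘(ℝ, EG) (𝒢.rightInvariantField toFun ζ)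
      (𝒢.rightInvariantField toFun η) (𝒢.one x) = toFun x (L.bracket ζ η x)

variable {𝒢} {L : LieAlgebroid EB F A} (Φ : AlgebroidIdentification 𝒢 L)

/-- The element of `A` over `trg g` that corresponds to a vector `v` tangent to a source fibre at
`g`: the right translate of `v` to the identity at `trg g`, read in `A`. -/
def AlgebroidIdentification.toAlgebroid (g : G) (v : TangentSpace 𝓘(ℝ, EG) g) : A (𝒢.trg g) :=
  Function.invFun (Φ.toFun (𝒢.trg g))
    ((𝒢.mul_inv g) ▸ 𝒢.rightTranslate (𝒢.inv g) g v)

variable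
  {FD : Type*} [NormedAddCommGroup FD] [NormedSpace ℝ FD]
  {D : B → Type*} [∀ x, AddCommGroup (D x)] [∀ x, Module ℝ (D x)]
  [∀ x, TopologicalSpace (D x)]
  [TopologicalSpace (TotalSpace FD D)] [FiberBundle FD D] [VectorBundle ℝ FD D]
  {S : SmoothDual EB F A FD D}

/-- The right-invariant source-wise metric on `G` that corresponds to the metric on `A`. -/
def AlgebroidIdentification.sourceMetric (I : InertiaOperator S) (g : G)
    (v w : TangentSpace 𝓘(ℝ, EG) g) : ℝ :=
  I.metric (Φ.toAlgebroid g v) (Φ.toAlgebroid g w)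

/-- The horizontal space at `g` of the target map on the source fibre through `g`: the vectors
tangent to the source fibre that are orthogonal to the kernel of the differential of the target
map. -/
def AlgebroidIdentification.horizontal (I : InertiaOperator S) (g : G) :
    Set (TangentSpace 𝓘(ℝ, EG) g) :=
  {v | v ∈ 𝒢.sourceTangent g ∧ ∀ k ∈ 𝒢.sourceTangent g,
    mfderiv 𝓘(ℝ, EG) 𝓘(ℝ, EB) 𝒢.trg g k = 0 → Φ.sourceMetric I g v k = 0}

/-- The target map from the source fibre `G_x`, with the source-wise metric, to `B`, with the
metric `gB`, is a Riemannian submersion: it is smooth, its differential is surjective, and it maps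
the horizontal spaces isometrically onto the tangent spaces of `B`. -/
structure AlgebroidIdentification.IsRiemannianSubmersionTrg (I : InertiaOperator S)
    (gB : RiemannMetric EB B) (x : B) : Prop where
  contMDiffOn : ContMDiffOn 𝓘(ℝ, EG) 𝓘(ℝ, EB) ∞ 𝒢.trg (𝒢.sourceFiber x)
  surjective : ∀ g ∈ 𝒢.sourceFiber x, ∀ ζ : TangentSpace 𝓘(ℝ, EB) (𝒢.trg g),
    ∃ v ∈ 𝒢.sourceTangent g, mfderiv 𝓘(ℝ, EG) 𝓘(ℝ, EB) 𝒢.trg g v = ζ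
  bijOn : ∀ g ∈ 𝒢.sourceFiber x,
    BijOn (mfderiv 𝓘(ℝ, EG) 𝓘(ℝ, EB) 𝒢.trg g) (Φ.horizontal I g) univ
  isometry : ∀ g ∈ 𝒢.sourceFiber x, ∀ v ∈ Φ.horizontal I g, ∀ w ∈ Φ.horizontal I g,
    gB.form (𝒢.trg g) (mfderiv 𝓘(ℝ, EG) 𝓘(ℝ, EB) 𝒢.trg g v)
      (mfderiv 𝓘(ℝ, EG) 𝓘(ℝ, EB) 𝒢.trg g w) = Φ.sourceMetric I g v w

end LieGroupoid

end Groupoid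

end EulerArnold

/-! Poisson bracket. Subtracting from a function the linear function with the same fibre
differential at `ξ` leaves a function whose differential at `ξ` kills vertical vectors
(`mfderiv_eq_zero_of_vertical`), so its base derivatives can be taken along any section through `ξ`.
Together with the tensoriality of the algebroid differential this gives the bracket in terms of
arbitrary extensions (`poissonBracket_eq`). It also reduces Hamilton's equations to the base
velocity and to enough linear functions (`hasDerivAt_poissonBracket_of_linear`).

The leaf. The Jacobi identity and the Leibniz rule make the anchor a morphism of brackets, so `Ker
#` is an ideal. By the orthogonal splitting, `#*(T*B)` consists of the `ξ` that vanish on `Ker #`.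
For a section `κ` of `Ker #` Hamilton's equation reads `d/dt ⟨ξ, κ⟩ = ⟨ξ, [ζ, κ]⟩` with `[ζ, κ]`
again in `Ker #`. This is a linear equation for the restriction of `ξ` to `Ker #`, and its solutions
vanish identically once they vanish somewhere (`exists_forall_forall` in spirit:
`exists_forall_eq_zero_of_hasDerivAt`, applied in `exists_forall_mem_dualAnchorImage`). Conversely,
Hamiltonians lifted from `B` translate the fibres of `#*(T*B)`, and linear Hamiltonians of lifted
chart fields move the zero section along `B`. Over a connected base these join any two points.

Geodesics. Let `ζ` and `η` be sections whose anchors are the constant chart fields `c` and `v`, with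
`ζ` horizontal, and let `s = I ζ` pass through `ξ` in `#*(T*B)`. The bracket `[ζ, η]` lies in `Ker
#`, hence is killed by `ξ`, and `H ∘ s - ⟨s, ζ⟩ = -½ g(c, c)`. Therefore `{H, η}(ξ) = ½ ∂_v g(c,
c)`, the right-hand side of the Euler-Lagrange equation
(`poissonBracket_hamiltonian_linearFunction`).

Groupoids. Right translation identifies the source tangent space at an arrow with a fibre of `A` and
turns the differential of the target map into the anchor (`anchor_toAlgebroid`), so the submersion
property is the fibrewise one for `#`. -/

set_option linter.unusedSectionVars false

/-! ### Pairings and vertical derivatives on vector bundles. -/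

section BundleCalculus

variable {EB : Type*} [NormedAddCommGroup EB] [NormedSpace ℝ EB]
  {B : Type*} [TopologicalSpace B] [ChartedSpace EB B] [IsManifold 𝓘(ℝ, EB) ∞ B]
  {F : Type*} [NormedAddCommGroup F] [NormedSpace ℝ F]
  {A : B → Type*} [∀ x, AddCommGroup (A x)] [∀ x, Module ℝ (A x)]
  [∀ x, TopologicalSpace (A x)] [∀ x, IsTopologicalAddGroup (A x)]
  [∀ x, ContinuousSMul ℝ (A x)]
  [TopologicalSpace (TotalSpace F A)] [FiberBundle F A] [VectorBundle ℝ F A]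
  [ContMDiffVectorBundle ∞ F A 𝓘(ℝ, EB)]
  {FD : Type*} [NormedAddCommGroup FD] [NormedSpace ℝ FD]
  {D : B → Type*} [∀ x, AddCommGroup (D x)] [∀ x, Module ℝ (D x)]
  [∀ x, TopologicalSpace (D x)]
  [TopologicalSpace (TotalSpace FD D)] [FiberBundle FD D] [VectorBundle ℝ FD D]
  [ContMDiffVectorBundle ∞ FD D 𝓘(ℝ, EB)]

/-- Evaluating the pairing along smooth maps into the two bundles gives a smooth function. -/
theorem SmoothDual.contMDiffWithinAt_pairing (S : SmoothDual EB F A FD D)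
    {EM : Type*} [NormedAddCommGroup EM] [NormedSpace ℝ EM] {HM : Type*} [TopologicalSpace HM]
    {IM : ModelWithCorners ℝ EM HM} {M : Type*} [TopologicalSpace M] [ChartedSpace HM M]
    {b : M → B} {ξ : ∀ m, D (b m)} {a : ∀ m, A (b m)} {s : Set M} {m₀ : M}
    (hξ : ContMDiffWithinAt IM (𝓘(ℝ, EB).prod 𝓘(ℝ, FD)) ∞ (fun m => TotalSpace.mk' FD (b m) (ξ m))
      s m₀)
    (ha : ContMDiffWithinAt IM (𝓘(ℝ, EB).prod 𝓘(ℝ, F)) ∞ (fun m => TotalSpace.mk' F (b m) (a m))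
      s m₀) :
    ContMDiffWithinAt IM 𝓘(ℝ, ℝ) ∞ (fun m => S.pairing (b m) (ξ m) (a m)) s m₀ := by
  have hb : ContMDiffWithinAt IM 𝓘(ℝ, EB) ∞ b s m₀ := (contMDiffWithinAt_totalSpace.1 ha).1
  have : ContMDiffWithinAt IM (𝓘(ℝ, EB).prod 𝓘(ℝ, ℝ)) ∞
      (fun m => TotalSpace.mk' ℝ (E := Bundle.Trivial B ℝ) (b m) (S.pairing (b m) (ξ m) (a m)))
      s m₀ := by
    apply ContMDiffWithinAt.clm_bundle_apply₂ (F₁ := FD) (F₂ := F)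
    · exact ContMDiffAt.comp_contMDiffWithinAt m₀ S.contMDiff_pairing.contMDiffAt hb
    · exact hξ
    · exact ha
  exact (contMDiffWithinAt_totalSpace.1 this).2

/-- A smooth section of the dual bundle acts on `A` by a smooth section of the bundle of
continuous functionals. -/
theorem SmoothDual.contMDiffOn_pairing_section (S : SmoothDual EB F A FD D)
    {s : ∀ x, D x} {U : Set B} (hs : SmoothSectionOn EB FD s U) :
    ContMDiffOn 𝓘(ℝ, EB) (𝓘(ℝ, EB).prod 𝓘(ℝ, F →L[ℝ] ℝ)) ∞
      (fun x => TotalSpace.mk' (F →L[ℝ] ℝ) (E := fun x => A x →L[ℝ] ℝ) x (S.pairing x (s x))) U :=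
  fun x hx => ContMDiffWithinAt.clm_bundle_apply (F₁ := FD) (F₂ := F →L[ℝ] ℝ)
    (E₂ := fun x => A x →L[ℝ] ℝ) (b := fun x => x)
    (S.contMDiff_pairing.contMDiffAt.contMDiffWithinAt) (hs x hx)

theorem MDifferentiableAt.hasDerivAt_comp_curve {EM : Type*} [NormedAddCommGroup EM] [NormedSpace
    ℝ EM]
    {HM : Type*} [TopologicalSpace HM]
    {IM : ModelWithCorners ℝ EM HM} {M : Type*} [TopologicalSpace M] [ChartedSpace HM M]
    {g : M → ℝ} {γ : ℝ → M} {t : ℝ} (hg : MDifferentiableAt IM 𝓘(ℝ, ℝ) g (γ t))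
    (hγ : MDifferentiableAt 𝓘(ℝ, ℝ) IM γ t) :
    HasDerivAt (fun s => g (γ s)) (mfderiv IM 𝓘(ℝ, ℝ) g (γ t) (mfderiv 𝓘(ℝ, ℝ) IM γ t (1 : ℝ))) t
        := by
  have h : HasFDerivAt (fun s => g (γ s)) (show ℝ →L[ℝ] ℝ from
      (mfderiv IM 𝓘(ℝ, ℝ) g (γ t)).comp (mfderiv 𝓘(ℝ, ℝ) IM γ t)) t :=
    (hg.hasMFDerivAt.comp t hγ.hasMFDerivAt).hasFDerivAt
  exact h.hasDerivAt

/-- A function on a vector bundle whose derivatives along the fibre vanish at `ξ` has a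
differential at `ξ` that vanishes on vertical vectors. -/
theorem mfderiv_eq_zero_of_vertical {g : TotalSpace FD D → ℝ} {ξ : TotalSpace FD D}
    (hg : MDifferentiableAt (𝓘(ℝ, EB).prod 𝓘(ℝ, FD)) 𝓘(ℝ, ℝ) g ξ)
    (hv : ∀ η : D ξ.proj, HasDerivAt (fun t : ℝ => g ⟨ξ.proj, ξ.2 + t • η⟩) 0 0)
    (u : TangentSpace (𝓘(ℝ, EB).prod 𝓘(ℝ, FD)) ξ)
    (hu : mfderiv (𝓘(ℝ, EB).prod 𝓘(ℝ, FD)) 𝓘(ℝ, EB) (π FD D) ξ u = 0) :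
    mfderiv (𝓘(ℝ, EB).prod 𝓘(ℝ, FD)) 𝓘(ℝ, ℝ) g ξ u = 0 := by
  set e := trivializationAt FD D ξ.proj
  have hξ : ξ ∈ e.source := e.mem_source.2 (FiberBundle.mem_baseSet_trivializationAt' ξ.proj)
  have heξ : e ξ ∈ e.target := e.map_source hξ
  have hsymm : e.toOpenPartialHomeomorph.symm (e ξ) = ξ := e.left_inv hξ
  have h1 : MDifferentiableAt (𝓘(ℝ, EB).prod 𝓘(ℝ, FD)) (𝓘(ℝ, EB).prod 𝓘(ℝ, FD)) e ξ :=
    ((e.contMDiffOn (IB := 𝓘(ℝ, EB)) (n := ∞)).contMDiffAt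
      (e.open_source.mem_nhds hξ)).mdifferentiableAt (by simp)
  have h2 : MDifferentiableAt (𝓘(ℝ, EB).prod 𝓘(ℝ, FD)) (𝓘(ℝ, EB).prod 𝓘(ℝ, FD))
      e.toOpenPartialHomeomorph.symm (e ξ) :=
    ((e.contMDiffOn_symm (IB := 𝓘(ℝ, EB)) (n := ∞)).contMDiffAt
      (e.open_target.mem_nhds heξ)).mdifferentiableAt (by simp)
  set G : B × FD → ℝ := fun q => g (e.toOpenPartialHomeomorph.symm q) with hG
  have hGd : MDifferentiableAt (𝓘(ℝ, EB).prod 𝓘(ℝ, FD)) 𝓘(ℝ, ℝ) G (e ξ) := by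
    have := hg
    rw [← hsymm] at this
    exact MDifferentiableAt.comp (e ξ) this h2
  have hgG : g =ᶠ[𝓝 ξ] fun ζ => G (e ζ) := by
    filter_upwards [e.open_source.mem_nhds hξ] with ζ hζ
    simp only [hG]
    exact congrArg g (e.left_inv hζ).symm
  have hcomp : mfderiv (𝓘(ℝ, EB).prod 𝓘(ℝ, FD)) 𝓘(ℝ, ℝ) g ξ u = mfderiv (𝓘(ℝ, EB).prod 𝓘(ℝ, FD))
      𝓘(ℝ, ℝ) G (e ξ) (mfderiv (𝓘(ℝ, EB).prod 𝓘(ℝ, FD)) (𝓘(ℝ, EB).prod 𝓘(ℝ, FD)) e ξ u) := by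
    have := (hGd.hasMFDerivAt.comp ξ h1.hasMFDerivAt).congr_of_eventuallyEq hgG
    rw [this.mfderiv]; rfl
  have hfst : (mfderiv (𝓘(ℝ, EB).prod 𝓘(ℝ, FD)) (𝓘(ℝ, EB).prod 𝓘(ℝ, FD)) e ξ u : EB × FD).1 = 0 :=
      by
    have h3 : HasMFDerivAt (𝓘(ℝ, EB).prod 𝓘(ℝ, FD)) 𝓘(ℝ, EB) (fun ζ => (e ζ).1) ξ
        ((ContinuousLinearMap.fst ℝ EB FD).comp (mfderiv (𝓘(ℝ, EB).prod 𝓘(ℝ, FD)) (𝓘(ℝ, EB).prod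
            𝓘(ℝ, FD)) e ξ)) :=
      (hasMFDerivAt_fst (I := 𝓘(ℝ, EB)) (I' := 𝓘(ℝ, FD)) (e ξ)).comp ξ h1.hasMFDerivAt
    have h4 : (fun ζ => (e ζ).1) =ᶠ[𝓝 ξ] π FD D := by
      filter_upwards [e.open_source.mem_nhds hξ] with ζ hζ
      exact e.coe_fst hζ
    have h5 := (h3.congr_of_eventuallyEq h4.symm).mfderiv
    rw [h5] at hu
    exact hu
  set w : FD := (mfderiv (𝓘(ℝ, EB).prod 𝓘(ℝ, FD)) (𝓘(ℝ, EB).prod 𝓘(ℝ, FD)) e ξ u : EB × FD).2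
  have hpair : (mfderiv (𝓘(ℝ, EB).prod 𝓘(ℝ, FD)) (𝓘(ℝ, EB).prod 𝓘(ℝ, FD)) e ξ u : EB × FD) = (0,
      w) := Prod.ext hfst rfl
  rw [hcomp]
  -- In the trivialization `u` becomes `(0, w)`, the velocity of this vertical line. Back in the
  -- bundle the line is the fibre line in the direction `e.symm ξ.proj w`, to which `hv` applies.
  let c : ℝ → B × FD := fun t => ((e ξ).1, (e ξ).2 + t • w)
  have hc0 : c 0 = e ξ := by simp [c]
  have hcd : HasMFDerivAt 𝓘(ℝ, ℝ) (𝓘(ℝ, EB).prod 𝓘(ℝ, FD)) c 0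
      ((0 : ℝ →L[ℝ] EB).prod (ContinuousLinearMap.toSpanSingleton ℝ w)) := by
    refine HasMFDerivAt.prodMk (hasMFDerivAt_const _ _) ?_
    have : HasDerivAt (fun t : ℝ => (e ξ).2 + t • w) w 0 := by
      simpa using ((hasDerivAt_id (0 : ℝ)).smul_const w).const_add (e ξ).2
    exact this.hasFDerivAt.hasMFDerivAt
  have hGc : HasMFDerivAt (𝓘(ℝ, EB).prod 𝓘(ℝ, FD)) 𝓘(ℝ, ℝ) G (c 0) (mfderiv (𝓘(ℝ, EB).prod 𝓘(ℝ,
      FD)) 𝓘(ℝ, ℝ) G (e ξ)) := by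
    rw [hc0]; exact hGd.hasMFDerivAt
  have hd' : HasFDerivAt (G ∘ c) (show ℝ →L[ℝ] ℝ from
      (mfderiv (𝓘(ℝ, EB).prod 𝓘(ℝ, FD)) 𝓘(ℝ, ℝ) G (e ξ)).comp
        ((0 : ℝ →L[ℝ] EB).prod (ContinuousLinearMap.toSpanSingleton ℝ w))) 0 :=
    (hGc.comp (0 : ℝ) hcd).hasFDerivAt
  have hd := hd'.hasDerivAt
  have hfun : (G ∘ c) = fun t : ℝ => g ⟨ξ.proj, ξ.2 + t • e.symm ξ.proj w⟩ := by
    funext t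
    have hb := FiberBundle.mem_baseSet_trivializationAt' (F := FD) (E := D) ξ.proj
    simp only [Function.comp, hG, c]
    congr 1
    have h6 : (e ξ).1 = ξ.proj := e.coe_fst hξ
    rw [h6, ← e.mk_symm hb]
    congr 1
    have h7 : ξ.2 = e.symmL ℝ ξ.proj (e ξ).2 := by
      rw [Bundle.Trivialization.symmL_apply _ hb]
      exact (e.symm_apply_apply_mk hb ξ.2).symm
    have h8 : ∀ z, e.symm ξ.proj z = e.symmL ℝ ξ.proj z := fun z =>
      (e.symmL_apply hb z).symm
    rw [h8, h8, map_add, map_smul, ← h7]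
  rw [hfun] at hd
  have := hd.unique (hv (e.symm ξ.proj w))
  have h9 : ((0 : ℝ →L[ℝ] EB).prod (ContinuousLinearMap.toSpanSingleton ℝ w)) 1 = (0, w) := by
    simp
  rw [hpair, ← h9]
  exact this

end BundleCalculus

/-! ### Differentiation along sections and curves. -/

section SectionCalculus

variable {EB : Type*} [NormedAddCommGroup EB] [NormedSpace ℝ EB]
  {B : Type*} [TopologicalSpace B] [ChartedSpace EB B] [IsManifold 𝓘(ℝ, EB) ∞ B]
  {F : Type*} [NormedAddCommGroup F] [NormedSpace ℝ F]
  {A : B → Type*} [∀ x, AddCommGroup (A x)] [∀ x, Module ℝ (A x)]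
  [∀ x, TopologicalSpace (A x)] [∀ x, IsTopologicalAddGroup (A x)]
  [∀ x, ContinuousSMul ℝ (A x)]
  [TopologicalSpace (TotalSpace F A)] [FiberBundle F A] [VectorBundle ℝ F A]
  [ContMDiffVectorBundle ∞ F A 𝓘(ℝ, EB)]
  {FD : Type*} [NormedAddCommGroup FD] [NormedSpace ℝ FD]
  {D : B → Type*} [∀ x, AddCommGroup (D x)] [∀ x, Module ℝ (D x)]
  [∀ x, TopologicalSpace (D x)]
  [TopologicalSpace (TotalSpace FD D)] [FiberBundle FD D] [VectorBundle ℝ FD D]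
  [ContMDiffVectorBundle ∞ FD D 𝓘(ℝ, EB)]

theorem mfderiv_proj_comp_section {s : ∀ x, D x} {x : B}
    (hs : MDifferentiableAt 𝓘(ℝ, EB) (𝓘(ℝ, EB).prod 𝓘(ℝ, FD))
      (fun x => TotalSpace.mk' FD x (s x)) x) (v : TangentSpace 𝓘(ℝ, EB) x) :
    mfderiv (𝓘(ℝ, EB).prod 𝓘(ℝ, FD)) 𝓘(ℝ, EB) (π FD D) (TotalSpace.mk' FD x (s x))
      (mfderiv 𝓘(ℝ, EB) (𝓘(ℝ, EB).prod 𝓘(ℝ, FD)) (fun x => TotalSpace.mk' FD x (s x)) x v) = v := by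
  have hπ : MDifferentiableAt (𝓘(ℝ, EB).prod 𝓘(ℝ, FD)) 𝓘(ℝ, EB) (π FD D)
      (TotalSpace.mk' FD x (s x)) :=
    (Bundle.contMDiff_proj (n := ∞) D).mdifferentiableAt (by simp)
  have h3 : (mfderiv (𝓘(ℝ, EB).prod 𝓘(ℝ, FD)) 𝓘(ℝ, EB) (π FD D) (TotalSpace.mk' FD x (s x))).comp
      (mfderiv 𝓘(ℝ, EB) (𝓘(ℝ, EB).prod 𝓘(ℝ, FD)) (fun x => TotalSpace.mk' FD x (s x)) x)
      = ContinuousLinearMap.id ℝ (TangentSpace 𝓘(ℝ, EB) x) :=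
    hasMFDerivAt_unique (hπ.hasMFDerivAt.comp x hs.hasMFDerivAt) (hasMFDerivAt_id x)
  exact DFunLike.congr_fun h3 v

/-- The vector `u` differs from the lift along `s` of its projection by a vertical vector, which the
differential of `g` kills. -/
theorem mfderiv_eq_dirDeriv_section {g : TotalSpace FD D → ℝ} {ξ : TotalSpace FD D}
    (hg : MDifferentiableAt (𝓘(ℝ, EB).prod 𝓘(ℝ, FD)) 𝓘(ℝ, ℝ) g ξ)
    (hv : ∀ η : D ξ.proj, HasDerivAt (fun t : ℝ => g ⟨ξ.proj, ξ.2 + t • η⟩) 0 0)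
    {s : ∀ x, D x}
    (hs : MDifferentiableAt 𝓘(ℝ, EB) (𝓘(ℝ, EB).prod 𝓘(ℝ, FD))
      (fun x => TotalSpace.mk' FD x (s x)) ξ.proj) (hsξ : s ξ.proj = ξ.2)
    (u : TangentSpace (𝓘(ℝ, EB).prod 𝓘(ℝ, FD)) ξ) :
    mfderiv (𝓘(ℝ, EB).prod 𝓘(ℝ, FD)) 𝓘(ℝ, ℝ) g ξ u =
      dirDeriv (mfderiv (𝓘(ℝ, EB).prod 𝓘(ℝ, FD)) 𝓘(ℝ, EB) (π FD D) ξ u)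
        (fun x => g ⟨x, s x⟩) := by
  obtain ⟨x, v⟩ := ξ
  dsimp only at hsξ hs
  subst hsξ
  have h1 := hg.hasMFDerivAt.comp x hs.hasMFDerivAt
  set w := mfderiv (𝓘(ℝ, EB).prod 𝓘(ℝ, FD)) 𝓘(ℝ, EB) (π FD D) (TotalSpace.mk' FD x (s x)) u
  have h4 : dirDeriv w (fun y => g ⟨y, s y⟩) =
      mfderiv (𝓘(ℝ, EB).prod 𝓘(ℝ, FD)) 𝓘(ℝ, ℝ) g (TotalSpace.mk' FD x (s x))
        (mfderiv 𝓘(ℝ, EB) (𝓘(ℝ, EB).prod 𝓘(ℝ, FD)) (fun x => TotalSpace.mk' FD x (s x)) x w) := by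
    rw [dirDeriv, show (fun y => g ⟨y, s y⟩) = g ∘ (fun x => TotalSpace.mk' FD x (s x)) from rfl,
      h1.mfderiv]
    rfl
  have h5 := mfderiv_eq_zero_of_vertical hg hv
    (u - mfderiv 𝓘(ℝ, EB) (𝓘(ℝ, EB).prod 𝓘(ℝ, FD)) (fun x => TotalSpace.mk' FD x (s x)) x w) (by
      rw [map_sub, sub_eq_zero]
      exact (mfderiv_proj_comp_section hs w).symm)
  rw [map_sub, sub_eq_zero] at h5
  exact h5.trans h4.symm

/-- Each base vector is the projection of some vector at `ξ`, and the differential of `g` on that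
vector computes both sides. This is what frees the Poisson bracket from the choice of the section
through `ξ`. -/
theorem dirDeriv_section_congr {g : TotalSpace FD D → ℝ} {ξ : TotalSpace FD D}
    (hg : MDifferentiableAt (𝓘(ℝ, EB).prod 𝓘(ℝ, FD)) 𝓘(ℝ, ℝ) g ξ)
    (hv : ∀ η : D ξ.proj, HasDerivAt (fun t : ℝ => g ⟨ξ.proj, ξ.2 + t • η⟩) 0 0)
    {s s' : ∀ x, D x}
    (hs : MDifferentiableAt 𝓘(ℝ, EB) (𝓘(ℝ, EB).prod 𝓘(ℝ, FD))
      (fun x => TotalSpace.mk' FD x (s x)) ξ.proj) (hsξ : s ξ.proj = ξ.2)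
    (hs' : MDifferentiableAt 𝓘(ℝ, EB) (𝓘(ℝ, EB).prod 𝓘(ℝ, FD))
      (fun x => TotalSpace.mk' FD x (s' x)) ξ.proj) (hsξ' : s' ξ.proj = ξ.2)
    (v : TangentSpace 𝓘(ℝ, EB) ξ.proj) :
    dirDeriv v (fun x => g ⟨x, s x⟩) = dirDeriv v (fun x => g ⟨x, s' x⟩) := by
  obtain ⟨u, rfl⟩ : ∃ u : TangentSpace (𝓘(ℝ, EB).prod 𝓘(ℝ, FD)) ξ,
      mfderiv (𝓘(ℝ, EB).prod 𝓘(ℝ, FD)) 𝓘(ℝ, EB) (π FD D) ξ u = v := by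
    clear hs' hsξ' hv hg
    obtain ⟨x, z⟩ := ξ
    dsimp only at hsξ hs
    subst hsξ
    exact ⟨_, mfderiv_proj_comp_section hs v⟩
  rw [← mfderiv_eq_dirDeriv_section hg hv hs hsξ, ← mfderiv_eq_dirDeriv_section hg hv hs' hsξ']

/-- Along a curve, a function with vanishing fibre derivatives varies like its restriction to any
section through the point, in the direction of the velocity of the base curve. -/
theorem hasDerivAt_comp_curve_of_vertical {g : TotalSpace FD D → ℝ} {γ : ℝ → TotalSpace FD D}
    {t : ℝ} (hg : MDifferentiableAt (𝓘(ℝ, EB).prod 𝓘(ℝ, FD)) 𝓘(ℝ, ℝ) g (γ t))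
    (hv : ∀ η : D (γ t).proj, HasDerivAt (fun r : ℝ => g ⟨(γ t).proj, (γ t).2 + r • η⟩) 0 0)
    {s : ∀ x, D x}
    (hs : MDifferentiableAt 𝓘(ℝ, EB) (𝓘(ℝ, EB).prod 𝓘(ℝ, FD))
      (fun x => TotalSpace.mk' FD x (s x)) (γ t).proj) (hsξ : s (γ t).proj = (γ t).2)
    (hγ : MDifferentiableAt 𝓘(ℝ, ℝ) (𝓘(ℝ, EB).prod 𝓘(ℝ, FD)) γ t) :
    HasDerivAt (fun r => g (γ r))
      (dirDeriv (curveVelocity EB (fun r => (γ r).proj) t) (fun x => g ⟨x, s x⟩)) t := by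
  have h := MDifferentiableAt.hasDerivAt_comp_curve hg hγ
  rw [mfderiv_eq_dirDeriv_section hg hv hs hsξ] at h
  have hπ : MDifferentiableAt (𝓘(ℝ, EB).prod 𝓘(ℝ, FD)) 𝓘(ℝ, EB) (π FD D) (γ t) :=
    (Bundle.contMDiff_proj (n := ∞) D).mdifferentiableAt (by simp)
  have h2 := (hπ.hasMFDerivAt.comp t hγ.hasMFDerivAt).mfderiv
  have h3 : curveVelocity EB (fun r => (γ r).proj) t =
      mfderiv (𝓘(ℝ, EB).prod 𝓘(ℝ, FD)) 𝓘(ℝ, EB) (π FD D) (γ t)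
        (mfderiv 𝓘(ℝ, ℝ) (𝓘(ℝ, EB).prod 𝓘(ℝ, FD)) γ t (1 : ℝ)) :=
    DFunLike.congr_fun h2 (1 : ℝ)
  rw [h3]
  exact h

theorem smoothSectionOn_extend {x : B} (v : D x) :
    SmoothSectionOn EB FD (FiberBundle.extend FD v) (trivializationAt FD D x).baseSet := by
  intro y hy
  have h : ContMDiffOn 𝓘(ℝ, EB) 𝓘(ℝ, FD) ∞ (fun y => (trivializationAt FD D x
      ⟨y, FiberBundle.extend FD v y⟩).2) (trivializationAt FD D x).baseSet :=
    (contMDiffOn_const (c := (trivializationAt FD D x ⟨x, v⟩).2)).congr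
      fun z hz => by simp [FiberBundle.extend, hz]
  exact ((trivializationAt FD D x).contMDiffOn_section_baseSet_iff.2 h) y hy

/-- The derivative of a smooth map along a smooth vector field is smooth. -/
theorem contMDiffOn_mfderiv_apply
    {EM : Type*} [NormedAddCommGroup EM] [NormedSpace ℝ EM] {HM : Type*} [TopologicalSpace HM]
    {IM : ModelWithCorners ℝ EM HM} {M : Type*} [TopologicalSpace M] [ChartedSpace HM M]
    {V : Type*} [NormedAddCommGroup V] [NormedSpace ℝ V]
    {f : B → V} {U : Set B} (hU : IsOpen U) (hf : ContMDiffOn 𝓘(ℝ, EB) 𝓘(ℝ, V) ∞ f U)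
    {b : M → B} {v : ∀ m, TangentSpace 𝓘(ℝ, EB) (b m)} {s : Set M} (hb : MapsTo b s U)
    (hv : ContMDiffOn IM (𝓘(ℝ, EB).prod 𝓘(ℝ, EB)) ∞
      (fun m => (⟨b m, v m⟩ : TangentBundle 𝓘(ℝ, EB) B)) s) :
    ContMDiffOn IM 𝓘(ℝ, V) ∞ (fun m => (mfderiv 𝓘(ℝ, EB) 𝓘(ℝ, V) f (b m) (v m) : V)) s := by
  -- Smoothness of the tangent map followed by the fibre projection of `TV` gives joint smoothness
  -- in the point and the vector, without a computation in trivializations.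
  have h1 := hf.contMDiffOn_tangentMapWithin (m := ∞) (by simp) hU.uniqueMDiffOn
  have h2 := h1.comp hv (fun m hm => by simpa using hb hm)
  have h3 := (contMDiff_snd_tangentBundle_modelSpace V 𝓘(ℝ, V) (n := ∞)).comp_contMDiffOn h2
  refine h3.congr fun m hm => ?_
  simp only [Function.comp, tangentMapWithin]
  rw [mfderivWithin_of_isOpen hU (hb hm)]

end SectionCalculus

/-! ### Rules for directional derivatives. -/

section DirDeriv

variable {EB : Type*} [NormedAddCommGroup EB] [NormedSpace ℝ EB]
  {B : Type*} [TopologicalSpace B] [ChartedSpace EB B]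

theorem dirDeriv_congr {x : B} (v : TangentSpace 𝓘(ℝ, EB) x) {f g : B → ℝ} (h : f =ᶠ[𝓝 x] g) :
    dirDeriv v f = dirDeriv v g := by
  rw [dirDeriv, dirDeriv, h.mfderiv_eq]; rfl

theorem dirDeriv_zero_left (x : B) (f : B → ℝ) :
    dirDeriv (0 : TangentSpace 𝓘(ℝ, EB) x) f = 0 := map_zero _

theorem dirDeriv_const {x : B} (v : TangentSpace 𝓘(ℝ, EB) x) (c : ℝ) :
    dirDeriv v (fun _ : B => c) = 0 := by
  rw [dirDeriv, mfderiv_const]; rfl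

theorem dirDeriv_sub {x : B} (v : TangentSpace 𝓘(ℝ, EB) x) {f g : B → ℝ}
    (hf : MDifferentiableAt 𝓘(ℝ, EB) 𝓘(ℝ, ℝ) f x) (hg : MDifferentiableAt 𝓘(ℝ, EB) 𝓘(ℝ, ℝ) g x) :
    dirDeriv v (fun y => f y - g y) = dirDeriv v f - dirDeriv v g := by
  have := (hf.hasMFDerivAt.sub hg.hasMFDerivAt).mfderiv
  exact DFunLike.congr_fun this v

theorem dirDeriv_const_mul {x : B} (v : TangentSpace 𝓘(ℝ, EB) x) {f : B → ℝ} (c : ℝ)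
    (hf : MDifferentiableAt 𝓘(ℝ, EB) 𝓘(ℝ, ℝ) f x) :
    dirDeriv v (fun y => c * f y) = c * dirDeriv v f := by
  have := (hf.hasMFDerivAt.const_smul c).mfderiv
  exact DFunLike.congr_fun this v

end DirDeriv

/-! ### Independence of the Poisson bracket of the chosen extensions. -/

section PoissonBracket

variable {EB : Type*} [NormedAddCommGroup EB] [NormedSpace ℝ EB]
  {B : Type*} [TopologicalSpace B] [ChartedSpace EB B] [IsManifold 𝓘(ℝ, EB) ∞ B]
  {F : Type*} [NormedAddCommGroup F] [NormedSpace ℝ F]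
  {A : B → Type*} [∀ x, AddCommGroup (A x)] [∀ x, Module ℝ (A x)]
  [∀ x, TopologicalSpace (A x)] [∀ x, IsTopologicalAddGroup (A x)]
  [∀ x, ContinuousSMul ℝ (A x)]
  [TopologicalSpace (TotalSpace F A)] [FiberBundle F A] [VectorBundle ℝ F A]
  [ContMDiffVectorBundle ∞ F A 𝓘(ℝ, EB)]
  {FD : Type*} [NormedAddCommGroup FD] [NormedSpace ℝ FD]
  {D : B → Type*} [∀ x, AddCommGroup (D x)] [∀ x, Module ℝ (D x)]
  [∀ x, TopologicalSpace (D x)]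
  [TopologicalSpace (TotalSpace FD D)] [FiberBundle FD D] [VectorBundle ℝ FD D]
  [ContMDiffVectorBundle ∞ FD D 𝓘(ℝ, EB)]

namespace SmoothDual

variable (S : SmoothDual EB F A FD D)

/-- `a` represents the differential at `ξ` of the restriction of `f` to the fibre. -/
def HasFiberDifferentialAt (f : TotalSpace FD D → ℝ) (ξ : TotalSpace FD D) (a : A ξ.proj) : Prop :=
  ∀ η : D ξ.proj, HasDerivAt (fun t : ℝ => f ⟨ξ.proj, ξ.2 + t • η⟩) (S.pairing ξ.proj η a) 0

variable {S}

theorem HasFiberDifferentialAt.fiberDifferential_eq {f : TotalSpace FD D → ℝ}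
    {ξ : TotalSpace FD D} {a : A ξ.proj} (h : S.HasFiberDifferentialAt f ξ a) :
    S.fiberDifferential f ξ = a := by
  -- Since `a` is a representative, the chosen element is one too; nondegeneracy of the pairing
  -- leaves room for only one.
  have h1 := Classical.epsilon_spec_aux ⟨a⟩ (fun a : A ξ.proj => ∀ η : D ξ.proj,
    HasDerivAt (fun t : ℝ => f ⟨ξ.proj, ξ.2 + t • η⟩) (S.pairing ξ.proj η a) 0) ⟨a, h⟩
  have h2 : S.fiberDifferential f ξ - a = 0 := by
    refine S.eq_zero_of_right _ _ fun η => ?_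
    rw [map_sub, sub_eq_zero]
    exact (h1 η).unique (h η)
  exact sub_eq_zero.1 h2

variable (S)

/-- The fibrewise linear function on the dual bundle defined by a section of `A`. -/
noncomputable def linearFunction (ζ : ∀ x, A x) (ξ : TotalSpace FD D) : ℝ :=
  S.pairing ξ.proj ξ.2 (ζ ξ.proj)

theorem hasFiberDifferentialAt_linearFunction (ζ : ∀ x, A x) (ξ : TotalSpace FD D) :
    S.HasFiberDifferentialAt (S.linearFunction ζ) ξ (ζ ξ.proj) := by
  intro η
  have h : (fun t : ℝ => S.linearFunction ζ ⟨ξ.proj, ξ.2 + t • η⟩) =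
      fun t : ℝ => S.pairing ξ.proj ξ.2 (ζ ξ.proj) + t * S.pairing ξ.proj η (ζ ξ.proj) := by
    funext t
    simp [linearFunction]
  rw [h]
  simpa using ((hasDerivAt_id (0 : ℝ)).mul_const (S.pairing ξ.proj η (ζ ξ.proj))).const_add
    (S.pairing ξ.proj ξ.2 (ζ ξ.proj))

theorem hasFiberDifferentialAt_comp_proj (f : B → ℝ) (ξ : TotalSpace FD D) :
    S.HasFiberDifferentialAt (fun ξ => f ξ.proj) ξ 0 := by
  intro η
  simpa using hasDerivAt_const (0 : ℝ) (f ξ.proj)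

variable {S}

theorem contMDiffOn_section_comp_proj {ζ : ∀ x, A x} {U : Set B} (hζ : SmoothSectionOn EB F ζ U) :
    ContMDiffOn (𝓘(ℝ, EB).prod 𝓘(ℝ, FD)) (𝓘(ℝ, EB).prod 𝓘(ℝ, F)) ∞
      (fun ξ : TotalSpace FD D => TotalSpace.mk' F ξ.proj (ζ ξ.proj)) (π FD D ⁻¹' U) :=
  ContMDiffOn.comp hζ (Bundle.contMDiff_proj D).contMDiffOn (fun _ h => h)

variable (S)

theorem isSmoothFunctionOn_linearFunction {ζ : ∀ x, A x} {U : Set B}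
    (hζ : SmoothSectionOn EB F ζ U) :
    S.IsSmoothFunctionOn (S.linearFunction ζ) (π FD D ⁻¹' U) := by
  refine ⟨fun ξ hξ => ?_, fun ξ => ζ ξ.proj, contMDiffOn_section_comp_proj hζ, fun ξ _ =>
    S.hasFiberDifferentialAt_linearFunction ζ ξ⟩
  exact S.contMDiffWithinAt_pairing (b := fun ξ : TotalSpace FD D => ξ.proj) (ξ := fun ξ => ξ.2)
    contMDiffWithinAt_id (contMDiffOn_section_comp_proj hζ ξ hξ)

theorem isSmoothFunctionOn_comp_proj {f : B → ℝ} {U : Set B}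
    (hf : ContMDiffOn 𝓘(ℝ, EB) 𝓘(ℝ, ℝ) ∞ f U) :
    S.IsSmoothFunctionOn (fun ξ => f ξ.proj) (π FD D ⁻¹' U) :=
  ⟨hf.comp (Bundle.contMDiff_proj D).contMDiffOn (fun _ h => h), fun _ => 0,
    ((Bundle.contMDiff_zeroSection ℝ A).comp (Bundle.contMDiff_proj D)).contMDiffOn,
    fun ξ _ => S.hasFiberDifferentialAt_comp_proj f ξ⟩

theorem isOpen_proj_preimage {U : Set B} (hU : IsOpen U) : IsOpen (π FD D ⁻¹' U) :=
  hU.preimage (FiberBundle.continuous_proj FD D)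

end SmoothDual

namespace LieAlgebroid

variable (L : LieAlgebroid EB F A) {S : SmoothDual EB F A FD D}

theorem contMDiffOn_anchor_section {ζ : ∀ x, A x} {U : Set B} (hζ : SmoothSectionOn EB F ζ U) :
    SmoothSectionOn EB EB (fun x => L.anchor x (ζ x)) U :=
  fun x hx => ContMDiffWithinAt.clm_bundle_apply (F₁ := F) (F₂ := EB)
    (E₂ := fun x : B => TangentSpace 𝓘(ℝ, EB) x) (b := fun x => x)
    (L.contMDiff_anchor.contMDiffAt.contMDiffWithinAt) (hζ x hx)

theorem contMDiffOn_dirDeriv_anchor {ζ : ∀ x, A x} {U : Set B} (hU : IsOpen U)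
    (hζ : SmoothSectionOn EB F ζ U) {f : B → ℝ} (hf : ContMDiffOn 𝓘(ℝ, EB) 𝓘(ℝ, ℝ) ∞ f U) :
    ContMDiffOn 𝓘(ℝ, EB) 𝓘(ℝ, ℝ) ∞ (fun x => dirDeriv (L.anchor x (ζ x)) f) U :=
  contMDiffOn_mfderiv_apply hU hf (b := fun x => x) (fun _ h => h) (L.contMDiffOn_anchor_section hζ)

/-- The algebroid differential depends only on the values of the sections at the point. -/
theorem algebroidDifferential_congr {U : Set B} (hU : IsOpen U) {s : ∀ x, D x}
    (hs : SmoothSectionOn EB FD s U) {ζ η ζ' η' : ∀ x, A x} (hζ : SmoothSectionOn EB F ζ U)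
    (hη : SmoothSectionOn EB F η U) (hζ' : SmoothSectionOn EB F ζ' U)
    (hη' : SmoothSectionOn EB F η' U) {x : B} (hx : x ∈ U) (h1 : ζ x = ζ' x) (h2 : η x = η' x) :
    algebroidDifferential L.anchor L.bracket (fun x => S.pairing x (s x)) ζ η x =
      algebroidDifferential L.anchor L.bracket (fun x => S.pairing x (s x)) ζ' η' x := by
  obtain ⟨Ω, -, hΩ⟩ := L.differential_smooth U hU _ (S.contMDiffOn_pairing_section hs)
  rw [hΩ U hU subset_rfl ζ η hζ hη x hx, hΩ U hU subset_rfl ζ' η' hζ' hη' x hx, h1, h2]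

theorem _root_.SmoothDual.mdifferentiableAt_pairing_sections {s : ∀ x, D x} {ζ : ∀ x, A x}
    {U : Set B} (hU : IsOpen U)
    (hs : SmoothSectionOn EB FD s U) (hζ : SmoothSectionOn EB F ζ U) {x : B} (hx : x ∈ U) :
    MDifferentiableAt 𝓘(ℝ, EB) 𝓘(ℝ, ℝ) (fun y => S.pairing y (s y) (ζ y)) x :=
  ((S.contMDiffWithinAt_pairing (b := fun y => y) (hs x hx) (hζ x hx)).contMDiffAt
    (hU.mem_nhds hx)).mdifferentiableAt (by simp)

theorem _root_.SmoothSectionOn.mdifferentiableAt {s : ∀ x, D x} {U : Set B} (hU : IsOpen U)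
    (hs : SmoothSectionOn EB FD s U) {x : B} (hx : x ∈ U) :
    MDifferentiableAt 𝓘(ℝ, EB) (𝓘(ℝ, EB).prod 𝓘(ℝ, FD)) (fun x => TotalSpace.mk' FD x (s x)) x :=
  ((hs x hx).contMDiffAt (hU.mem_nhds hx)).mdifferentiableAt (by simp)

/-- The Poisson bracket computed with arbitrary extensions to smooth sections. -/
theorem poissonBracket_eq {h f : TotalSpace FD D → ℝ} {ξ : TotalSpace FD D}
    (hh : MDifferentiableAt (𝓘(ℝ, EB).prod 𝓘(ℝ, FD)) 𝓘(ℝ, ℝ) h ξ)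
    (hf : MDifferentiableAt (𝓘(ℝ, EB).prod 𝓘(ℝ, FD)) 𝓘(ℝ, ℝ) f ξ)
    {U : Set B} (hU : IsOpen U) (hx : ξ.proj ∈ U) {ζ η : ∀ x, A x}
    (hζ : SmoothSectionOn EB F ζ U) (hη : SmoothSectionOn EB F η U)
    (ha : S.HasFiberDifferentialAt h ξ (ζ ξ.proj)) (hb : S.HasFiberDifferentialAt f ξ (η ξ.proj))
    {s : ∀ x, D x} (hs : SmoothSectionOn EB FD s U) (hsξ : s ξ.proj = ξ.2) :
    L.poissonBracket S h f ξ =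
      dirDeriv (L.anchor ξ.proj (ζ ξ.proj)) (fun x => f ⟨x, s x⟩ - S.pairing x (s x) (η x))
      - dirDeriv (L.anchor ξ.proj (η ξ.proj)) (fun x => h ⟨x, s x⟩ - S.pairing x (s x) (ζ x))
      + S.pairing ξ.proj ξ.2 (L.bracket ζ η ξ.proj) := by
  -- `s₀` is the extension built into the definition of the bracket; the aim is to trade it for `s`.
  set s₀ : ∀ x, D x := FiberBundle.extend FD ξ.2 with hs₀
  have hs₀ξ : s₀ ξ.proj = ξ.2 := FiberBundle.extend_apply_self FD ξ.2
  set V := U ∩ ((trivializationAt F A ξ.proj).baseSet ∩ (trivializationAt FD D ξ.proj).baseSet)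
  have hV : IsOpen V := hU.inter ((trivializationAt F A ξ.proj).open_baseSet.inter
    (trivializationAt FD D ξ.proj).open_baseSet)
  have hxV : ξ.proj ∈ V := ⟨hx, FiberBundle.mem_baseSet_trivializationAt' _,
    FiberBundle.mem_baseSet_trivializationAt' _⟩
  have hs₀V : SmoothSectionOn EB FD s₀ V := (smoothSectionOn_extend ξ.2).mono fun _ h => h.2.2
  have hζV : SmoothSectionOn EB F ζ V := hζ.mono fun _ h => h.1
  have hηV : SmoothSectionOn EB F η V := hη.mono fun _ h => h.1
  -- Tensoriality replaces the constant extensions of the fibre differentials by `ζ` and `η`.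
  have hd := L.algebroidDifferential_congr (S := S) hV hs₀V
    ((smoothSectionOn_extend (EB := EB) (FD := F) (ζ ξ.proj)).mono fun _ h => h.2.1)
    ((smoothSectionOn_extend (EB := EB) (FD := F) (η ξ.proj)).mono fun _ h => h.2.1)
    hζV hηV hxV (FiberBundle.extend_apply_self F _) (FiberBundle.extend_apply_self F _)
  -- A function minus the linear function with the same fibre differential has zero fibre
  -- derivatives at `ξ`. Only for such differences may `s₀` be replaced by `s`.
  have vert : ∀ {k : TotalSpace FD D → ℝ} {θ : ∀ x, A x}
      (_ : S.HasFiberDifferentialAt k ξ (θ ξ.proj)) (e : D ξ.proj),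
      HasDerivAt (fun t : ℝ => k ⟨ξ.proj, ξ.2 + t • e⟩ -
        S.linearFunction θ ⟨ξ.proj, ξ.2 + t • e⟩) 0 0 := by
    intro k θ hk e
    have := (hk e).sub (S.hasFiberDifferentialAt_linearFunction θ ξ e)
    rw [sub_self] at this
    exact this
  have lin : ∀ {θ : ∀ x, A x}, SmoothSectionOn EB F θ V →
      MDifferentiableAt (𝓘(ℝ, EB).prod 𝓘(ℝ, FD)) 𝓘(ℝ, ℝ) (S.linearFunction θ) ξ := by
    intro θ hθ
    exact ((S.isSmoothFunctionOn_linearFunction hθ).1.contMDiffAt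
      ((SmoothDual.isOpen_proj_preimage hV).mem_nhds hxV)).mdifferentiableAt (by simp)
  have comp : ∀ {k : TotalSpace FD D → ℝ},
      MDifferentiableAt (𝓘(ℝ, EB).prod 𝓘(ℝ, FD)) 𝓘(ℝ, ℝ) k ξ →
      MDifferentiableAt 𝓘(ℝ, EB) 𝓘(ℝ, ℝ) (fun x => k ⟨x, s₀ x⟩) ξ.proj := by
    intro k hk
    have h1 : MDifferentiableAt (𝓘(ℝ, EB).prod 𝓘(ℝ, FD)) 𝓘(ℝ, ℝ) k ⟨ξ.proj, s₀ ξ.proj⟩ := by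
      rw [hs₀ξ]; exact hk
    exact MDifferentiableAt.comp (g := k) (f := fun x => TotalSpace.mk' FD x (s₀ x)) ξ.proj h1
      (SmoothSectionOn.mdifferentiableAt (s := s₀) hV hs₀V hxV)
  have key : ∀ {k : TotalSpace FD D → ℝ} {θ : ∀ x, A x}
      (_ : MDifferentiableAt (𝓘(ℝ, EB).prod 𝓘(ℝ, FD)) 𝓘(ℝ, ℝ) k ξ)
      (_ : SmoothSectionOn EB F θ V) (_ : S.HasFiberDifferentialAt k ξ (θ ξ.proj))
      (v : TangentSpace 𝓘(ℝ, EB) ξ.proj),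
      dirDeriv v (fun x => k ⟨x, s x⟩ - S.pairing x (s x) (θ x)) =
        dirDeriv v (fun x => k ⟨x, s₀ x⟩) - dirDeriv v (fun x => S.pairing x (s₀ x) (θ x)) := by
    intro k θ hk hθ hkθ v
    rw [← dirDeriv_sub v (comp hk) (SmoothDual.mdifferentiableAt_pairing_sections hV hs₀V hθ hxV)]
    exact dirDeriv_section_congr (g := fun q => k q - S.linearFunction θ q)
      (MDifferentiableAt.sub hk (lin hθ)) (vert hkθ)
      (SmoothSectionOn.mdifferentiableAt (s := s) hU hs hx) hsξ
      (SmoothSectionOn.mdifferentiableAt (s := s₀) hV hs₀V hxV) hs₀ξ v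
  rw [key hf hηV hb, key hh hζV ha, poissonBracket]
  simp only [ha.fiberDifferential_eq, hb.fiberDifferential_eq]
  rw [← hs₀, hd, algebroidDifferential, hs₀ξ]
  ring

end LieAlgebroid

end PoissonBracket

/-! ### The anchor as a morphism of brackets. -/

section AnchorMorphism

variable {EB : Type*} [NormedAddCommGroup EB] [NormedSpace ℝ EB]
  {B : Type*} [TopologicalSpace B] [ChartedSpace EB B] [IsManifold 𝓘(ℝ, EB) ∞ B]
  {F : Type*} [NormedAddCommGroup F] [NormedSpace ℝ F]
  {A : B → Type*} [∀ x, AddCommGroup (A x)] [∀ x, Module ℝ (A x)]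
  [∀ x, TopologicalSpace (A x)] [∀ x, IsTopologicalAddGroup (A x)]
  [∀ x, ContinuousSMul ℝ (A x)]
  [TopologicalSpace (TotalSpace F A)] [FiberBundle F A] [VectorBundle ℝ F A]
  [ContMDiffVectorBundle ∞ F A 𝓘(ℝ, EB)]
  {FD : Type*} [NormedAddCommGroup FD] [NormedSpace ℝ FD]
  {D : B → Type*} [∀ x, AddCommGroup (D x)] [∀ x, Module ℝ (D x)]
  [∀ x, TopologicalSpace (D x)]
  [TopologicalSpace (TotalSpace FD D)] [FiberBundle FD D] [VectorBundle ℝ FD D]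
  [ContMDiffVectorBundle ∞ FD D 𝓘(ℝ, EB)]

theorem dirDeriv_neg {x : B} (v : TangentSpace 𝓘(ℝ, EB) x) (f : B → ℝ) :
    dirDeriv v (fun y => - f y) = - dirDeriv v f := by
  have : mfderiv 𝓘(ℝ, EB) 𝓘(ℝ, ℝ) (fun y => - f y) x = - mfderiv 𝓘(ℝ, EB) 𝓘(ℝ, ℝ) f x :=
    mfderiv_neg
  exact DFunLike.congr_fun this v

/-- Tangent vectors are determined by their action on smooth functions. -/
theorem eq_of_forall_dirDeriv_eq {x : B} {u v : TangentSpace 𝓘(ℝ, EB) x}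
    (h : ∀ (U : Set B) (f : B → ℝ), IsOpen U → x ∈ U → ContMDiffOn 𝓘(ℝ, EB) 𝓘(ℝ, ℝ) ∞ f U →
      dirDeriv u f = dirDeriv v f) : u = v := by
  have hc : ContMDiffOn 𝓘(ℝ, EB) 𝓘(ℝ, EB) ∞ (extChartAt 𝓘(ℝ, EB) x) (chartAt EB x).source :=
    contMDiffOn_extChartAt
  have hx := mem_chart_source EB x
  have hcd : MDifferentiableAt 𝓘(ℝ, EB) 𝓘(ℝ, EB) (extChartAt 𝓘(ℝ, EB) x) x :=
    mdifferentiableAt_extChartAt hx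
  refine (isInvertible_mfderiv_extChartAt (mem_extChartAt_source (I := 𝓘(ℝ, EB)) x)).injective ?_
  -- By Hahn-Banach on the model space, continuous functionals composed with the chart are enough
  -- test functions.
  refine (SeparatingDual.eq_iff_forall_dual_eq (R := ℝ) (V := EB)).2 fun ℓ => ?_
  have h1 := h _ (fun y => ℓ (extChartAt 𝓘(ℝ, EB) x y)) (chartAt EB x).open_source hx
    (ℓ.contMDiff.comp_contMDiffOn hc)
  have h2 : ∀ w : TangentSpace 𝓘(ℝ, EB) x, dirDeriv w (fun y => ℓ (extChartAt 𝓘(ℝ, EB) x y)) =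
      ℓ (mfderiv 𝓘(ℝ, EB) 𝓘(ℝ, EB) (extChartAt 𝓘(ℝ, EB) x) x w) := by
    intro w
    have := ((ℓ.hasMFDerivAt (x := extChartAt 𝓘(ℝ, EB) x x)).comp x hcd.hasMFDerivAt).mfderiv
    exact DFunLike.congr_fun this w
  rw [h2, h2] at h1
  exact h1

namespace LieAlgebroid

variable (L : LieAlgebroid EB F A)

theorem smoothSectionOn_zero (U : Set B) : SmoothSectionOn EB F (fun x => (0 : A x)) U :=
  (Bundle.contMDiff_zeroSection ℝ A).contMDiffOn

theorem bracket_zero_right {U : Set B} (hU : IsOpen U) {ζ : ∀ x, A x}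
    (hζ : SmoothSectionOn EB F ζ U) {x : B} (hx : x ∈ U) :
    L.bracket ζ (fun _ => 0) x = 0 := by
  have h := L.leibniz U hU ζ (fun _ => 0) (fun _ => 0) hζ (smoothSectionOn_zero U)
    contMDiffOn_const x hx
  simpa using h

theorem bracket_zero_left {U : Set B} (hU : IsOpen U) {ζ : ∀ x, A x}
    (hζ : SmoothSectionOn EB F ζ U) {x : B} (hx : x ∈ U) :
    L.bracket (fun _ => 0) ζ x = 0 := by
  rw [L.bracket_skew U hU _ _ (smoothSectionOn_zero U) hζ x hx, L.bracket_zero_right hU hζ hx,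
    neg_zero]

theorem bracket_smul_add_smul {U : Set B} (hU : IsOpen U) {ζ η θ : ∀ x, A x} {f g : B → ℝ}
    (hζ : SmoothSectionOn EB F ζ U) (hη : SmoothSectionOn EB F η U)
    (hθ : SmoothSectionOn EB F θ U) (hf : ContMDiffOn 𝓘(ℝ, EB) 𝓘(ℝ, ℝ) ∞ f U)
    (hg : ContMDiffOn 𝓘(ℝ, EB) 𝓘(ℝ, ℝ) ∞ g U) {x : B} (hx : x ∈ U) :
    L.bracket ζ (fun y => f y • η y + g y • θ y) x =
      (f x • L.bracket ζ η x + dirDeriv (L.anchor x (ζ x)) f • η x) +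
      (g x • L.bracket ζ θ x + dirDeriv (L.anchor x (ζ x)) g • θ x) := by
  rw [L.bracket_add U hU ζ (fun y => f y • η y) (fun y => g y • θ y) hζ (hf.smul_section hη)
    (hg.smul_section hθ) x hx, L.leibniz U hU ζ η f hζ hη hf x hx,
    L.leibniz U hU ζ θ g hζ hθ hg x hx]

/-- Compare the Jacobi identity for `ζ, η, f θ` with `f` times the one for `ζ, η, θ`. After
expansion by the Leibniz rule all terms with brackets of sections cancel, and the remaining
second-order derivatives of `f` multiply `θ`. -/
theorem dirDeriv_anchor_bracket_smul {U : Set B} (hU : IsOpen U) {ζ η θ : ∀ x, A x} {f : B → ℝ}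
    (hζ : SmoothSectionOn EB F ζ U) (hη : SmoothSectionOn EB F η U)
    (hθ : SmoothSectionOn EB F θ U) (hf : ContMDiffOn 𝓘(ℝ, EB) 𝓘(ℝ, ℝ) ∞ f U)
    {x : B} (hx : x ∈ U) :
    dirDeriv (L.anchor x (L.bracket ζ η x)) f • θ x =
      (dirDeriv (L.anchor x (ζ x)) (fun y => dirDeriv (L.anchor y (η y)) f)
        - dirDeriv (L.anchor x (η x)) (fun y => dirDeriv (L.anchor y (ζ y)) f)) • θ x := by
  have hfθ : SmoothSectionOn EB F (fun y => f y • θ y) U := hf.smul_section hθ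
  have hζη := L.smooth_bracket U hU ζ η hζ hη
  have hζθ := L.smooth_bracket U hU ζ θ hζ hθ
  have hηθ := L.smooth_bracket U hU η θ hη hθ
  have hζf := L.contMDiffOn_dirDeriv_anchor hU hζ hf
  have hηf := L.contMDiffOn_dirDeriv_anchor hU hη hf
  have J := L.jacobi U hU ζ η (fun y => f y • θ y) hζ hη hfθ x hx
  have J0 := L.jacobi U hU ζ η θ hζ hη hθ x hx
  -- The Leibniz rule holds only on `U`, so the inner bracket is rewritten there by locality of the
  -- outer one.
  have T1 : L.bracket ζ (L.bracket η (fun y => f y • θ y)) x = L.bracket ζ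
      (fun y => f y • L.bracket η θ y + dirDeriv (L.anchor y (η y)) f • θ y) x :=
    L.bracket_local U hU _ _ _ _ hζ (L.smooth_bracket U hU _ _ hη hfθ) (fun _ _ => rfl)
      (fun y hy => L.leibniz U hU η θ f hη hθ hf y hy) x hx
  rw [L.bracket_smul_add_smul hU hζ hηθ hθ hf hηf hx] at T1
  have T2 : L.bracket η (L.bracket (fun y => f y • θ y) ζ) x = L.bracket η
      (fun y => (- f y) • L.bracket ζ θ y + (- dirDeriv (L.anchor y (ζ y)) f) • θ y) x :=
    L.bracket_local U hU _ _ _ _ hη (L.smooth_bracket U hU _ _ hfθ hζ) (fun _ _ => rfl)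
      (fun y hy => by
        rw [L.bracket_skew U hU _ _ hfθ hζ y hy, L.leibniz U hU ζ θ f hζ hθ hf y hy]
        module) x hx
  rw [L.bracket_smul_add_smul hU hη hζθ hθ hf.neg hζf.neg hx, dirDeriv_neg, dirDeriv_neg] at T2
  have T3 := L.bracket_skew U hU _ _ hfθ hζη x hx
  rw [L.leibniz U hU _ θ f hζη hθ hf x hx] at T3
  -- The coefficients `-1` and `0` bring the skew-symmetric rewriting into the shape of
  -- `bracket_smul_add_smul`; their derivatives vanish.
  have J2 : L.bracket η (L.bracket θ ζ) x = L.bracket η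
      (fun y => (-1 : ℝ) • L.bracket ζ θ y + (0 : ℝ) • θ y) x :=
    L.bracket_local U hU _ _ _ _ hη (L.smooth_bracket U hU _ _ hθ hζ) (fun _ _ => rfl)
      (fun y hy => by
        rw [L.bracket_skew U hU _ _ hθ hζ y hy]
        module) x hx
  rw [L.bracket_smul_add_smul hU hη hζθ hθ contMDiffOn_const contMDiffOn_const hx, dirDeriv_const,
    dirDeriv_const] at J2
  have J3 := L.bracket_skew U hU _ _ hθ hζη x hx
  rw [T1, T2, T3] at J
  rw [J2, J3] at J0
  linear_combination (norm := module) (f x) • J0 - J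

/-- The anchor is a morphism of Lie algebras. -/
theorem dirDeriv_anchor_bracket (hL : L.IsTransitive) {U : Set B} (hU : IsOpen U)
    {ζ η : ∀ x, A x} {f : B → ℝ} (hζ : SmoothSectionOn EB F ζ U) (hη : SmoothSectionOn EB F η U)
    (hf : ContMDiffOn 𝓘(ℝ, EB) 𝓘(ℝ, ℝ) ∞ f U) {x : B} (hx : x ∈ U) :
    dirDeriv (L.anchor x (L.bracket ζ η x)) f =
      dirDeriv (L.anchor x (ζ x)) (fun y => dirDeriv (L.anchor y (η y)) f)
        - dirDeriv (L.anchor x (η x)) (fun y => dirDeriv (L.anchor y (ζ y)) f) := by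
  -- The preceding identity carries a factor from the fibre. If the fibre is zero, transitivity
  -- makes the tangent space zero as well; otherwise a nonzero `a` can be cancelled.
  by_cases h0 : ∀ a : A x, a = 0
  · have h1 : ∀ v : TangentSpace 𝓘(ℝ, EB) x, v = 0 := fun v => by
      obtain ⟨a, rfl⟩ := hL x v
      rw [h0 a, map_zero]
    rw [h1 (L.anchor x (ζ x)), h1 (L.anchor x (η x)), h1 (L.anchor x (L.bracket ζ η x))]
    simp [dirDeriv_zero_left]
  · push Not at h0
    obtain ⟨a, ha⟩ := h0
    set V := U ∩ (trivializationAt F A x).baseSet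
    have hV : IsOpen V := hU.inter (trivializationAt F A x).open_baseSet
    have h := L.dirDeriv_anchor_bracket_smul hV (hζ.mono inter_subset_left)
      (hη.mono inter_subset_left) ((smoothSectionOn_extend a).mono inter_subset_right)
      (hf.mono inter_subset_left) ⟨hx, FiberBundle.mem_baseSet_trivializationAt' x⟩
    rw [FiberBundle.extend_apply_self] at h
    exact smul_left_injective ℝ ha h

/-- `Ker #` is an ideal: both terms of the commutator contain the zero field `#η`. This closes the
evolution equation for the restriction of a point of the dual bundle to `Ker #`. -/
theorem anchor_bracket_eq_zero_of_anchor_eq_zero (hL : L.IsTransitive) {U : Set B} (hU : IsOpen U)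
    {ζ η : ∀ x, A x} (hζ : SmoothSectionOn EB F ζ U) (hη : SmoothSectionOn EB F η U)
    (h0 : ∀ x ∈ U, L.anchor x (η x) = 0) {x : B} (hx : x ∈ U) :
    L.anchor x (L.bracket ζ η x) = 0 := by
  refine eq_of_forall_dirDeriv_eq fun V f hV hxV hf => ?_
  have hUV : IsOpen (U ∩ V) := hU.inter hV
  rw [L.dirDeriv_anchor_bracket hL hUV (hζ.mono inter_subset_left) (hη.mono inter_subset_left)
    (hf.mono inter_subset_right) ⟨hx, hxV⟩, h0 x hx, dirDeriv_zero_left, dirDeriv_zero_left,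
    sub_zero, ← dirDeriv_const (L.anchor x (ζ x)) 0]
  refine dirDeriv_congr _ ?_
  filter_upwards [hU.mem_nhds hx] with y hy
  rw [h0 y hy, dirDeriv_zero_left]

end LieAlgebroid

end AnchorMorphism

/-! ### Hamilton's equations and the Euler-Arnold Hamiltonian. -/

section HamiltonianTrajectories

variable {EB : Type*} [NormedAddCommGroup EB] [NormedSpace ℝ EB]
  {B : Type*} [TopologicalSpace B] [ChartedSpace EB B] [IsManifold 𝓘(ℝ, EB) ∞ B]
  {F : Type*} [NormedAddCommGroup F] [NormedSpace ℝ F]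
  {A : B → Type*} [∀ x, AddCommGroup (A x)] [∀ x, Module ℝ (A x)]
  [∀ x, TopologicalSpace (A x)] [∀ x, IsTopologicalAddGroup (A x)]
  [∀ x, ContinuousSMul ℝ (A x)]
  [TopologicalSpace (TotalSpace F A)] [FiberBundle F A] [VectorBundle ℝ F A]
  [ContMDiffVectorBundle ∞ F A 𝓘(ℝ, EB)]
  {FD : Type*} [NormedAddCommGroup FD] [NormedSpace ℝ FD]
  {D : B → Type*} [∀ x, AddCommGroup (D x)] [∀ x, Module ℝ (D x)]
  [∀ x, TopologicalSpace (D x)]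
  [TopologicalSpace (TotalSpace FD D)] [FiberBundle FD D] [VectorBundle ℝ FD D]
  [ContMDiffVectorBundle ∞ FD D 𝓘(ℝ, EB)]

namespace LieAlgebroid

variable (L : LieAlgebroid EB F A) {S : SmoothDual EB F A FD D}

/-- The Poisson bracket of a function with a fibrewise linear function. -/
theorem poissonBracket_linearFunction {h : TotalSpace FD D → ℝ} {ξ : TotalSpace FD D}
    (hh : MDifferentiableAt (𝓘(ℝ, EB).prod 𝓘(ℝ, FD)) 𝓘(ℝ, ℝ) h ξ)
    {U : Set B} (hU : IsOpen U) (hx : ξ.proj ∈ U) {ζ η : ∀ x, A x}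
    (hζ : SmoothSectionOn EB F ζ U) (hη : SmoothSectionOn EB F η U)
    (ha : S.HasFiberDifferentialAt h ξ (ζ ξ.proj))
    {s : ∀ x, D x} (hs : SmoothSectionOn EB FD s U) (hsξ : s ξ.proj = ξ.2) :
    L.poissonBracket S h (S.linearFunction η) ξ =
      S.pairing ξ.proj ξ.2 (L.bracket ζ η ξ.proj)
      - dirDeriv (L.anchor ξ.proj (η ξ.proj)) (fun x => h ⟨x, s x⟩ - S.pairing x (s x) (ζ x)) := by
  have hl := ((S.isSmoothFunctionOn_linearFunction hη).1.contMDiffAt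
    ((SmoothDual.isOpen_proj_preimage hU).mem_nhds hx)).mdifferentiableAt (by simp)
  rw [L.poissonBracket_eq hh hl hU hx hζ hη ha (S.hasFiberDifferentialAt_linearFunction η ξ) hs hsξ]
  simp only [SmoothDual.linearFunction, sub_self, dirDeriv_const]
  ring

/-- The Poisson bracket of a function with a function on the base. -/
theorem poissonBracket_comp_proj {h : TotalSpace FD D → ℝ} {ξ : TotalSpace FD D}
    (hh : MDifferentiableAt (𝓘(ℝ, EB).prod 𝓘(ℝ, FD)) 𝓘(ℝ, ℝ) h ξ) {a : A ξ.proj}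
    (ha : S.HasFiberDifferentialAt h ξ a) {U : Set B} (hU : IsOpen U) (hx : ξ.proj ∈ U) {f : B → ℝ}
    (hf : ContMDiffOn 𝓘(ℝ, EB) 𝓘(ℝ, ℝ) ∞ f U) :
    L.poissonBracket S h (fun ξ => f ξ.proj) ξ = dirDeriv (L.anchor ξ.proj a) f := by
  have hl := ((S.isSmoothFunctionOn_comp_proj hf).1.contMDiffAt
    ((SmoothDual.isOpen_proj_preimage hU).mem_nhds hx)).mdifferentiableAt (by simp)
  have hV : IsOpen ((trivializationAt F A ξ.proj).baseSet ∩
    (trivializationAt FD D ξ.proj).baseSet) :=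
    (trivializationAt F A ξ.proj).open_baseSet.inter (trivializationAt FD D ξ.proj).open_baseSet
  have hxV : ξ.proj ∈ (trivializationAt F A ξ.proj).baseSet ∩
    (trivializationAt FD D ξ.proj).baseSet :=
    ⟨FiberBundle.mem_baseSet_trivializationAt' _, FiberBundle.mem_baseSet_trivializationAt' _⟩
  have hζ := (smoothSectionOn_extend (EB := EB) (FD := F) a).mono
    (inter_subset_left (t := (trivializationAt FD D ξ.proj).baseSet))
  rw [L.poissonBracket_eq (ζ := FiberBundle.extend F a) (η := fun _ => 0)
    hh hl hV hxV hζ (smoothSectionOn_zero _) (by rwa [FiberBundle.extend_apply_self])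
    (S.hasFiberDifferentialAt_comp_proj f ξ)
    ((smoothSectionOn_extend (EB := EB) ξ.2).mono inter_subset_right)
    (FiberBundle.extend_apply_self FD ξ.2), L.bracket_zero_right hV hζ hxV,
    FiberBundle.extend_apply_self]
  simp [dirDeriv_zero_left]

/-- A curve that satisfies the Hamiltonian equation for the functions lifted from the base covers
a curve with the velocity given by the anchor. -/
theorem curveVelocity_eq_anchor {h : TotalSpace FD D → ℝ} {γ : ℝ → TotalSpace FD D} {t : ℝ}
    (hh : MDifferentiableAt (𝓘(ℝ, EB).prod 𝓘(ℝ, FD)) 𝓘(ℝ, ℝ) h (γ t)) {a : A (γ t).proj}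
    (ha : S.HasFiberDifferentialAt h (γ t) a)
    (hγ : MDifferentiableAt 𝓘(ℝ, ℝ) (𝓘(ℝ, EB).prod 𝓘(ℝ, FD)) γ t)
    (hf : ∀ (W : Set (TotalSpace FD D)) (f : TotalSpace FD D → ℝ), IsOpen W → γ t ∈ W →
      S.IsSmoothFunctionOn f W → HasDerivAt (fun s => f (γ s)) (L.poissonBracket S h f (γ t)) t) :
    curveVelocity EB (fun s => (γ s).proj) t = L.anchor (γ t).proj a := by
  refine eq_of_forall_dirDeriv_eq fun U f hU hx hfU => ?_
  have h1 := hf (π FD D ⁻¹' U) (fun ξ => f ξ.proj) (SmoothDual.isOpen_proj_preimage hU) hx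
    (S.isSmoothFunctionOn_comp_proj hfU)
  rw [L.poissonBracket_comp_proj hh ha hU hx hfU] at h1
  have hx' : MDifferentiableAt 𝓘(ℝ, ℝ) 𝓘(ℝ, EB) (fun s => (γ s).proj) t :=
    MDifferentiableAt.comp t ((Bundle.contMDiff_proj (n := ∞) D).mdifferentiableAt (by simp)) hγ
  exact (MDifferentiableAt.hasDerivAt_comp_curve
    ((hfU.contMDiffAt (hU.mem_nhds hx)).mdifferentiableAt (by simp)) hx').unique h1

/-- The Hamiltonian equation needs to be checked only on fibrewise linear functions. -/
theorem hasDerivAt_poissonBracket_of_linear {h : TotalSpace FD D → ℝ} {γ : ℝ → TotalSpace FD D}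
    {t : ℝ} (hh : MDifferentiableAt (𝓘(ℝ, EB).prod 𝓘(ℝ, FD)) 𝓘(ℝ, ℝ) h (γ t))
    {a : A (γ t).proj} (ha : S.HasFiberDifferentialAt h (γ t) a)
    (hγ : MDifferentiableAt 𝓘(ℝ, ℝ) (𝓘(ℝ, EB).prod 𝓘(ℝ, FD)) γ t)
    (hvel : curveVelocity EB (fun s => (γ s).proj) t = L.anchor (γ t).proj a)
    (hlin : ∀ b : A (γ t).proj, ∃ (U : Set B) (η : ∀ x, A x), IsOpen U ∧ (γ t).proj ∈ U ∧
      SmoothSectionOn EB F η U ∧ η (γ t).proj = b ∧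
      HasDerivAt (fun s => S.linearFunction η (γ s))
        (L.poissonBracket S h (S.linearFunction η) (γ t)) t)
    {W : Set (TotalSpace FD D)} {f : TotalSpace FD D → ℝ} (hW : IsOpen W) (hγW : γ t ∈ W)
    (hf : S.IsSmoothFunctionOn f W) :
    HasDerivAt (fun s => f (γ s)) (L.poissonBracket S h f (γ t)) t := by
  obtain ⟨hfW, b, -, hb⟩ := hf
  obtain ⟨U, η, hU, hxU, hη, hηb, hd⟩ := hlin (b (γ t))
  have hbf : S.HasFiberDifferentialAt f (γ t) (η (γ t).proj) := by
    rw [hηb]; exact hb _ hγW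
  have hfd := (hfW.contMDiffAt (hW.mem_nhds hγW)).mdifferentiableAt (by simp)
  set V := U ∩ ((trivializationAt F A (γ t).proj).baseSet ∩ (trivializationAt FD D (γ
      t).proj).baseSet)
  have hV : IsOpen V := hU.inter ((trivializationAt F A (γ t).proj).open_baseSet.inter
    (trivializationAt FD D (γ t).proj).open_baseSet)
  have hxV : (γ t).proj ∈ V := ⟨hxU, FiberBundle.mem_baseSet_trivializationAt' _,
    FiberBundle.mem_baseSet_trivializationAt' _⟩
  have hηV : SmoothSectionOn EB F η V := hη.mono fun _ h => h.1
  have hζV : SmoothSectionOn EB F (FiberBundle.extend F a) V :=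
    (smoothSectionOn_extend (EB := EB) (FD := F) a).mono fun _ h => h.2.1
  have hsV : SmoothSectionOn EB FD (FiberBundle.extend FD (γ t).2) V :=
    (smoothSectionOn_extend (EB := EB) (γ t).2).mono fun _ h => h.2.2
  have hsξ := FiberBundle.extend_apply_self FD (γ t).2
  have ha' : S.HasFiberDifferentialAt h (γ t) ((FiberBundle.extend F a : ∀ x, A x) (γ t).proj) := by
    rwa [FiberBundle.extend_apply_self]
  have hlη := ((S.isSmoothFunctionOn_linearFunction hηV).1.contMDiffAt
    ((SmoothDual.isOpen_proj_preimage hV).mem_nhds hxV)).mdifferentiableAt (by simp)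
  -- The fibre derivatives of this difference vanish at `γ t`, so it varies only through the base
  -- velocity, which `hvel` gives. Adding the rate of the linear function from `hlin` gives the rate
  -- of `f`.
  have h1 := hasDerivAt_comp_curve_of_vertical (g := fun q => f q - S.linearFunction η q)
    (γ := γ) (t := t) (s := FiberBundle.extend FD (γ t).2) (MDifferentiableAt.sub hfd hlη)
    (fun e => by
      have := (hbf e).sub (S.hasFiberDifferentialAt_linearFunction η (γ t) e)
      rw [sub_self] at this
      exact this) (SmoothSectionOn.mdifferentiableAt hV hsV hxV) hsξ hγ
  rw [hvel] at h1
  have h2 : HasDerivAt (fun r => f (γ r) - S.linearFunction η (γ r) + S.linearFunction η (γ r)) _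
      t :=
    h1.add hd
  simp only [sub_add_cancel] at h2
  rw [L.poissonBracket_eq hh hfd hV hxV hζV hηV ha' hbf hsV hsξ]
  rw [L.poissonBracket_linearFunction hh hV hxV hζV hηV ha' hsV hsξ] at h2
  refine h2.congr_deriv ?_
  rw [FiberBundle.extend_apply_self]
  simp only [SmoothDual.linearFunction]
  ring

end LieAlgebroid

namespace InertiaOperator

variable {S : SmoothDual EB F A FD D} (I : InertiaOperator S)

theorem hamiltonian_eq (ξ : TotalSpace FD D) :
    I.hamiltonian ξ = 1 / 2 * S.pairing ξ.proj ξ.2 ((I.toEquiv ξ.proj).symm ξ.2) := by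
  simp [hamiltonian, metric]

theorem pairing_symm_comm {x : B} (ξ η : D x) :
    S.pairing x ξ ((I.toEquiv x).symm η) = S.pairing x η ((I.toEquiv x).symm ξ) := by
  simpa using I.symm x ((I.toEquiv x).symm ξ) ((I.toEquiv x).symm η)

/-- The energy is quadratic on fibres, and by symmetry of the inertia operator its two cross terms
coincide, which absorbs the factor `1 / 2`. -/
theorem hasFiberDifferentialAt_hamiltonian (ξ : TotalSpace FD D) :
    S.HasFiberDifferentialAt I.hamiltonian ξ ((I.toEquiv ξ.proj).symm ξ.2) := by
  intro η
  have h : (fun t : ℝ => I.hamiltonian ⟨ξ.proj, ξ.2 + t • η⟩) = fun t : ℝ =>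
      1 / 2 * S.pairing ξ.proj ξ.2 ((I.toEquiv ξ.proj).symm ξ.2) +
        t * S.pairing ξ.proj η ((I.toEquiv ξ.proj).symm ξ.2) +
        t ^ 2 * (1 / 2 * S.pairing ξ.proj η ((I.toEquiv ξ.proj).symm η)) := by
    funext t
    rw [hamiltonian_eq]
    simp only [map_add, map_smul, add_apply, smul_apply,
      smul_eq_mul, I.pairing_symm_comm ξ.2 η]
    ring
  rw [h]
  have h1 := ((hasDerivAt_id (0 : ℝ)).mul_const
    (S.pairing ξ.proj η ((I.toEquiv ξ.proj).symm ξ.2))).const_add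
    (1 / 2 * S.pairing ξ.proj ξ.2 ((I.toEquiv ξ.proj).symm ξ.2))
  have h2 := (hasDerivAt_pow 2 (0 : ℝ)).mul_const
    (1 / 2 * S.pairing ξ.proj η ((I.toEquiv ξ.proj).symm η))
  refine (h1.add h2).congr_deriv ?_
  simp

theorem isSmoothFunctionOn_hamiltonian : S.IsSmoothFunctionOn I.hamiltonian univ := by
  refine ⟨fun ξ _ => ?_, fun ξ => (I.toEquiv ξ.proj).symm ξ.2, I.contMDiff_symm.contMDiffOn,
    fun ξ _ => I.hasFiberDifferentialAt_hamiltonian ξ⟩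
  have h := S.contMDiffWithinAt_pairing (b := fun ξ : TotalSpace FD D => ξ.proj)
    (ξ := fun ξ => ξ.2) (s := univ) (m₀ := ξ) contMDiffWithinAt_id (I.contMDiff_symm ξ)
  have h2 : I.hamiltonian = fun ξ => 1 / 2 * S.pairing ξ.proj ξ.2 ((I.toEquiv ξ.proj).symm ξ.2) :=
    funext I.hamiltonian_eq
  rw [h2]
  exact contMDiffWithinAt_const.mul h

end InertiaOperator

end HamiltonianTrajectories

/-! ### From smooth maps of total spaces to smooth sections of Hom bundles. -/

section HomSections

variable {EB : Type*} [NormedAddCommGroup EB] [NormedSpace ℝ EB]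
  {B : Type*} [TopologicalSpace B] [ChartedSpace EB B]
  {F₁ : Type*} [NormedAddCommGroup F₁] [NormedSpace ℝ F₁]
  {E₁ : B → Type*} [∀ x, AddCommGroup (E₁ x)] [∀ x, Module ℝ (E₁ x)]
  [∀ x, TopologicalSpace (E₁ x)]
  [TopologicalSpace (TotalSpace F₁ E₁)] [FiberBundle F₁ E₁] [VectorBundle ℝ F₁ E₁]
  {F₂ : Type*} [NormedAddCommGroup F₂] [NormedSpace ℝ F₂]
  {E₂ : B → Type*} [∀ x, AddCommGroup (E₂ x)] [∀ x, Module ℝ (E₂ x)]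
  [∀ x, TopologicalSpace (E₂ x)] [∀ x, IsTopologicalAddGroup (E₂ x)]
  [∀ x, ContinuousSMul ℝ (E₂ x)]
  [TopologicalSpace (TotalSpace F₂ E₂)] [FiberBundle F₂ E₂] [VectorBundle ℝ F₂ E₂]

/-- A family of fibrewise linear maps that is smooth as a map of total spaces is smooth as a
section of the bundle of continuous linear maps. -/
theorem contMDiffAt_hom_of_uncurry
    {EM : Type*} [NormedAddCommGroup EM] [NormedSpace ℝ EM] {HM : Type*} [TopologicalSpace HM]
    {IM : ModelWithCorners ℝ EM HM} {M : Type*} [TopologicalSpace M] [ChartedSpace HM M]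
    [IsManifold IM ∞ M]
    {b : M → B} {m₀ : M} (hb : ContMDiffAt IM 𝓘(ℝ, EB) ∞ b m₀) {ψ : ∀ m, E₁ (b m) →L[ℝ] E₂ (b m)}
    (h : ContMDiffAt (IM.prod 𝓘(ℝ, F₁)) (𝓘(ℝ, EB).prod 𝓘(ℝ, F₂)) ∞
      (fun q : M × F₁ => TotalSpace.mk' F₂ (b q.1)
        (ψ q.1 ((trivializationAt F₁ E₁ (b m₀)).symm (b q.1) q.2))) (m₀, 0)) :
    ContMDiffAt IM (𝓘(ℝ, EB).prod 𝓘(ℝ, F₁ →L[ℝ] F₂)) ∞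
      (fun m => TotalSpace.mk' (F₁ →L[ℝ] F₂) (E := fun x => E₁ x →L[ℝ] E₂ x) (b m) (ψ m)) m₀ := by
  rw [contMDiffAt_hom_bundle]
  refine ⟨hb, ?_⟩
  have h1 := (contMDiffAt_totalSpace.1 h).2
  dsimp only at h1
  -- A linear map is its own derivative at `0`: differentiating in the fibre variable turns
  -- smoothness jointly in the point and the vector into smoothness in operator norm.
  have h2 := ContMDiffAt.mfderiv (m := ∞) (fun (m : M) (w : F₁) => (trivializationAt F₂ E₂ (b m₀)
    ⟨b m, ψ m ((trivializationAt F₁ E₁ (b m₀)).symm (b m) w)⟩).2) (fun _ => (0 : F₁)) h1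
    contMDiffAt_const (by simp)
  erw [inTangentCoordinates_model_space] at h2
  refine h2.congr_of_eventuallyEq ?_
  filter_upwards [hb.continuousAt ((trivializationAt F₁ E₁ (b m₀)).open_baseSet.mem_nhds
      (FiberBundle.mem_baseSet_trivializationAt' _)),
    hb.continuousAt ((trivializationAt F₂ E₂ (b m₀)).open_baseSet.mem_nhds
      (FiberBundle.mem_baseSet_trivializationAt' _))] with m hm1 hm2
  have h3 : (fun w : F₁ => (trivializationAt F₂ E₂ (b m₀)
      ⟨b m, ψ m ((trivializationAt F₁ E₁ (b m₀)).symm (b m) w)⟩).2) =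
      ContinuousLinearMap.inCoordinates F₁ E₁ F₂ E₂ (b m₀) (b m) (b m₀) (b m) (ψ m) := by
    funext w
    rw [ContinuousLinearMap.inCoordinates_eq hm1 hm2]
    simp
  rw [h3, mfderiv_eq_fderiv, ContinuousLinearMap.fderiv]

end HomSections

/-! ### Right inverses of surjective operators and their smooth dependence. -/

section RightInverse

variable {E F : Type*} [NormedAddCommGroup E] [NormedSpace ℝ E] [CompleteSpace E]
  [NormedAddCommGroup F] [NormedSpace ℝ F] [CompleteSpace F]

/-- A surjective operator with a continuous projection onto its kernel has a continuous right
inverse. -/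
theorem exists_continuous_rightInverse {T : F →L[ℝ] E} (hT : Function.Surjective T) {P : F →L[ℝ] F}
    (h1 : ∀ v, T (P v) = 0) (h2 : ∀ v, T v = 0 → P v = v) :
    ∃ R : E →L[ℝ] F, ∀ v, T (R v) = v := by
  -- `P` is a projection onto `Ker T`, so its kernel is a closed complement. There `T` is bijective,
  -- and the open mapping theorem makes the inverse continuous.
  let K : Submodule ℝ F := LinearMap.ker P.toLinearMap
  have hK : IsClosed (K : Set F) := P.isClosed_ker
  have : CompleteSpace K := hK.completeSpace_coe
  let T' : K →L[ℝ] E := T.comp K.subtypeL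
  have hinj : LinearMap.ker T'.toLinearMap = ⊥ := by
    rw [LinearMap.ker_eq_bot']
    intro v hv
    have h3 : P v = v := h2 v hv
    have h4 : P v = 0 := v.2
    exact Subtype.ext (h3.symm.trans h4)
  have hsurj : LinearMap.range T'.toLinearMap = ⊤ := by
    rw [LinearMap.range_eq_top]
    intro w
    obtain ⟨v, rfl⟩ := hT w
    refine ⟨⟨v - P v, ?_⟩, ?_⟩
    · change P (v - P v) = 0
      rw [map_sub, h2 (P v) (h1 v), sub_self]
    · change T (v - P v) = T v
      rw [map_sub, h1, sub_zero]
  let e := ContinuousLinearEquiv.ofBijective T' hinj hsurj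
  refine ⟨K.subtypeL.comp (e.symm : E →L[ℝ] K), fun v => ?_⟩
  exact e.apply_symm_apply v

/-- Smooth families of operators with a right inverse at a point have smooth right inverses near
the point. -/
theorem ContMDiffAt.exists_rightInverse
    {EM : Type*} [NormedAddCommGroup EM] [NormedSpace ℝ EM] {HM : Type*} [TopologicalSpace HM]
    {IM : ModelWithCorners ℝ EM HM} {M : Type*} [TopologicalSpace M] [ChartedSpace HM M]
    {T : M → F →L[ℝ] E} {m₀ : M} (hT : ContMDiffAt IM 𝓘(ℝ, F →L[ℝ] E) ∞ T m₀) {R : E →L[ℝ] F}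
    (hR : ∀ v, T m₀ (R v) = v) :
    ∃ τ : M → E →L[ℝ] F, ContMDiffAt IM 𝓘(ℝ, E →L[ℝ] F) ∞ τ m₀ ∧
      ∀ᶠ m in 𝓝 m₀, ∀ v, T m (τ m v) = v := by
  have hTR : ContMDiffAt IM 𝓘(ℝ, E →L[ℝ] E) ∞ (fun m => (T m).comp R) m₀ :=
    hT.clm_comp contMDiffAt_const
  have h0 : (T m₀).comp R = (ContinuousLinearEquiv.refl ℝ E : E →L[ℝ] E) := by
    ext v; exact hR v
  -- The composite `T m ∘ R` is the identity at `m₀`, hence invertible nearby, and inversion is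
  -- smooth there.
  refine ⟨fun m => R.comp (ContinuousLinearMap.inverse ((T m).comp R)),
    contMDiffAt_const.clm_comp ?_, ?_⟩
  · have h1 : ContDiffAt ℝ ∞ (ContinuousLinearMap.inverse : (E →L[ℝ] E) → E →L[ℝ] E)
        ((T m₀).comp R) := by
      rw [h0]; exact contDiffAt_map_inverse _
    exact ContMDiffAt.comp m₀ h1.contMDiffAt hTR
  · have h1 := ContinuousLinearEquiv.nhds (ContinuousLinearEquiv.refl ℝ E)
    rw [← h0] at h1
    filter_upwards [hTR.continuousAt h1] with m hm v
    obtain ⟨e, he⟩ := hm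
    change (e : E →L[ℝ] E) = (T m).comp R at he
    change ((T m).comp R) (ContinuousLinearMap.inverse ((T m).comp R) v) = v
    rw [← he, ContinuousLinearMap.inverse_equiv]
    exact e.apply_symm_apply v

end RightInverse

/-! ### The horizontal lift and the metric on the base. -/

section HorizontalLift

variable {EB : Type*} [NormedAddCommGroup EB] [NormedSpace ℝ EB]
  {B : Type*} [TopologicalSpace B] [ChartedSpace EB B] [IsManifold 𝓘(ℝ, EB) ∞ B]
  {F : Type*} [NormedAddCommGroup F] [NormedSpace ℝ F]
  {A : B → Type*} [∀ x, AddCommGroup (A x)] [∀ x, Module ℝ (A x)]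
  [∀ x, TopologicalSpace (A x)] [∀ x, IsTopologicalAddGroup (A x)]
  [∀ x, ContinuousSMul ℝ (A x)]
  [TopologicalSpace (TotalSpace F A)] [FiberBundle F A] [VectorBundle ℝ F A]
  [ContMDiffVectorBundle ∞ F A 𝓘(ℝ, EB)]
  {FD : Type*} [NormedAddCommGroup FD] [NormedSpace ℝ FD]
  {D : B → Type*} [∀ x, AddCommGroup (D x)] [∀ x, Module ℝ (D x)]
  [∀ x, TopologicalSpace (D x)]
  [TopologicalSpace (TotalSpace FD D)] [FiberBundle FD D] [VectorBundle ℝ FD D]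
  [ContMDiffVectorBundle ∞ FD D 𝓘(ℝ, EB)]

namespace InertiaOperator

variable {L : LieAlgebroid EB F A} {S : SmoothDual EB F A FD D} {I : InertiaOperator S}

theorem metric_sub_left {x : B} (a b k : A x) : I.metric (a - b) k = I.metric a k - I.metric b k
    := by
  simp [metric]

/-- The difference lies in `Ker #` and is orthogonal to it, so positivity forces it to be zero. -/
theorem eq_of_mem_horizontal (hI : I.IsPositive) {x : B} {a b : A x} (ha : a ∈ I.horizontal L x)
    (hb : b ∈ I.horizontal L x) (h : L.anchor x a = L.anchor x b) : a = b := by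
  by_contra hab
  have h1 : L.anchor x (a - b) = 0 := by rw [map_sub, h, sub_self]
  have h2 := hI x (a - b) (sub_ne_zero.2 hab)
  rw [metric_sub_left, ha _ h1, hb _ h1, sub_self] at h2
  exact lt_irrefl _ h2

theorem zero_mem_horizontal (x : B) : (0 : A x) ∈ I.horizontal L x := fun k _ => by simp [metric]

/-- The orthogonal projection to the kernel of the anchor fixes the kernel. -/
theorem projection_eq_self (hI : I.IsPositive) {x : B} {P : A x →L[ℝ] A x}
    (hP : ∀ a : A x, L.anchor x (P a) = 0 ∧ a - P a ∈ I.horizontal L x) {a : A x}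
    (ha : L.anchor x a = 0) : P a = a := by
  have h := eq_of_mem_horizontal hI (hP a).2 (zero_mem_horizontal x)
    (by rw [map_sub, (hP a).1, ha, map_zero, sub_zero])
  exact (sub_eq_zero.1 h).symm

theorem exists_mem_horizontal (hL : L.IsTransitive) (hdec : I.HasOrthogonalDecomposition L) {x : B}
    (v : TangentSpace 𝓘(ℝ, EB) x) : ∃ a ∈ I.horizontal L x, L.anchor x a = v := by
  obtain ⟨P, -, hP⟩ := hdec
  obtain ⟨a, rfl⟩ := hL x v
  exact ⟨a - P x a, (hP x a).2, by rw [map_sub, (hP x a).1, sub_zero]⟩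

theorem anchorInv_mem (hL : L.IsTransitive) (hdec : I.HasOrthogonalDecomposition L) {x : B}
    (v : TangentSpace 𝓘(ℝ, EB) x) : I.anchorInv L x v ∈ I.horizontal L x :=
  Function.invFunOn_mem (exists_mem_horizontal hL hdec v)

theorem anchor_anchorInv (hL : L.IsTransitive) (hdec : I.HasOrthogonalDecomposition L) {x : B}
    (v : TangentSpace 𝓘(ℝ, EB) x) : L.anchor x (I.anchorInv L x v) = v :=
  Function.invFunOn_eq (exists_mem_horizontal hL hdec v)

theorem anchorInv_eq (hL : L.IsTransitive) (hI : I.IsPositive)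
    (hdec : I.HasOrthogonalDecomposition L) {x : B} {v : TangentSpace 𝓘(ℝ, EB) x} {a : A x}
    (ha : a ∈ I.horizontal L x) (hav : L.anchor x a = v) : I.anchorInv L x v = a :=
  eq_of_mem_horizontal hI (anchorInv_mem hL hdec v) ha
    ((anchor_anchorInv hL hdec v).trans hav.symm)

/-- The horizontal lift is a smooth bundle map. -/
theorem exists_horizontalLift [CompleteSpace EB] [CompleteSpace F] (hL : L.IsTransitive)
    (hI : I.IsPositive) (hdec : I.HasOrthogonalDecomposition L) :
    ∃ σ : ∀ x, TangentSpace 𝓘(ℝ, EB) x →L[ℝ] A x,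
      ContMDiff 𝓘(ℝ, EB) (𝓘(ℝ, EB).prod 𝓘(ℝ, EB →L[ℝ] F)) ∞
        (fun x => TotalSpace.mk' (EB →L[ℝ] F)
          (E := fun x => TangentSpace 𝓘(ℝ, EB) x →L[ℝ] A x) x (σ x)) ∧
      ∀ x v, σ x v = I.anchorInv L x v := by
  obtain ⟨P, hPs, hP⟩ := id hdec
  -- `anchorInv` is a bare choice function. This local formula supplies its linearity and continuity
  -- as well as its smoothness.
  have main : ∀ x₀ : B, ∃ τ : B → EB →L[ℝ] F, ContMDiffAt 𝓘(ℝ, EB) 𝓘(ℝ, EB →L[ℝ] F) ∞ τ x₀ ∧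
      ∀ᶠ x in 𝓝 x₀, ∀ v, I.anchorInv L x v = (trivializationAt F A x₀).symmL ℝ x
        (τ x ((trivializationAt EB (TangentSpace 𝓘(ℝ, EB)) x₀).continuousLinearMapAt ℝ x v)) := by
    intro x₀
    set e := trivializationAt F A x₀
    set eT := trivializationAt EB (TangentSpace 𝓘(ℝ, EB) : B → Type _) x₀
    have hx₀ : x₀ ∈ e.baseSet := FiberBundle.mem_baseSet_trivializationAt' x₀
    have hx₀T : x₀ ∈ eT.baseSet := FiberBundle.mem_baseSet_trivializationAt' x₀
    have hρ := ((contMDiffAt_hom_bundle _).1 (L.contMDiff_anchor x₀)).2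
    have hPc := ((contMDiffAt_hom_bundle _).1 (hPs x₀)).2
    dsimp only at hρ hPc
    set ρ : B → F →L[ℝ] EB := fun x => ContinuousLinearMap.inCoordinates F A EB
      (TangentSpace 𝓘(ℝ, EB)) x₀ x x₀ x (L.anchor x)
    set Q : B → F →L[ℝ] F := fun x => ContinuousLinearMap.inCoordinates F A F A x₀ x x₀ x (P x)
    have hρe : ∀ {x}, x ∈ e.baseSet → x ∈ eT.baseSet → ∀ w, ρ x w =
        eT.continuousLinearMapAt ℝ x (L.anchor x (e.symmL ℝ x w)) := fun _ _ w => rfl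
    have hQe : ∀ {x}, x ∈ e.baseSet → ∀ w, Q x w =
        e.continuousLinearMapAt ℝ x (P x (e.symmL ℝ x w)) := fun _ w => rfl
    have hsurj : Function.Surjective (ρ x₀) := by
      intro w
      obtain ⟨a, ha⟩ := hL x₀ (eT.symmL ℝ x₀ w)
      refine ⟨e.continuousLinearMapAt ℝ x₀ a, ?_⟩
      rw [hρe hx₀ hx₀T, e.symmL_continuousLinearMapAt hx₀, ha,
        eT.continuousLinearMapAt_symmL hx₀T]
    obtain ⟨R, hR⟩ := exists_continuous_rightInverse (P := Q x₀) hsurj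
      (fun w => by
        rw [hQe hx₀, hρe hx₀ hx₀T, e.symmL_continuousLinearMapAt hx₀, (hP x₀ _).1, map_zero])
      (fun w hw => by
        rw [hρe hx₀ hx₀T] at hw
        have h1 : L.anchor x₀ (e.symmL ℝ x₀ w) = 0 := by
          have := congrArg (eT.symmL ℝ x₀) hw
          rwa [eT.symmL_continuousLinearMapAt hx₀T, map_zero] at this
        rw [hQe hx₀, projection_eq_self hI (hP x₀) h1, e.continuousLinearMapAt_symmL hx₀])
    obtain ⟨τ, hτ, hτe⟩ := ContMDiffAt.exists_rightInverse hρ hR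
    -- Any smooth right inverse of the anchor becomes the horizontal one after removal of its
    -- component in `Ker #`.
    refine ⟨fun x => (ContinuousLinearMap.id ℝ F - Q x).comp (τ x),
      (contMDiffAt_const.sub hPc).clm_comp hτ, ?_⟩
    filter_upwards [hτe, e.open_baseSet.mem_nhds hx₀, eT.open_baseSet.mem_nhds hx₀T]
      with x hx hxe hxT v
    set z := e.symmL ℝ x (τ x (eT.continuousLinearMapAt ℝ x v))
    have h1 : e.symmL ℝ x (((ContinuousLinearMap.id ℝ F - Q x).comp (τ x))
        (eT.continuousLinearMapAt ℝ x v)) = z - P x z := by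
      rw [ContinuousLinearMap.comp_apply, sub_apply, map_sub, hQe hxe,
        e.symmL_continuousLinearMapAt hxe]
      rfl
    rw [h1]
    refine anchorInv_eq hL hI hdec (hP x z).2 ?_
    rw [map_sub, (hP x z).1, sub_zero]
    have h2 := congrArg (eT.symmL ℝ x) (hx (eT.continuousLinearMapAt ℝ x v))
    rwa [hρe hxe hxT, eT.symmL_continuousLinearMapAt hxT, eT.symmL_continuousLinearMapAt hxT] at h2
  have hlin : ∀ x : B, ∃ σ : TangentSpace 𝓘(ℝ, EB) x →L[ℝ] A x, ∀ v, σ v = I.anchorInv L x v := by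
    intro x
    obtain ⟨τ, -, hτ⟩ := main x
    exact ⟨((trivializationAt F A x).symmL ℝ x).comp ((τ x).comp
      ((trivializationAt EB (TangentSpace 𝓘(ℝ, EB)) x).continuousLinearMapAt ℝ x)),
      fun v => (hτ.self_of_nhds v).symm⟩
  choose σ hσ using hlin
  refine ⟨σ, fun x₀ => ?_, hσ⟩
  rw [contMDiffAt_hom_bundle]
  refine ⟨contMDiffAt_id, ?_⟩
  obtain ⟨τ, hτ, hτe⟩ := main x₀
  refine hτ.congr_of_eventuallyEq ?_
  filter_upwards [hτe, (trivializationAt F A x₀).open_baseSet.mem_nhds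
    (FiberBundle.mem_baseSet_trivializationAt' x₀),
    (trivializationAt EB (TangentSpace 𝓘(ℝ, EB) : B → Type _) x₀).open_baseSet.mem_nhds
    (FiberBundle.mem_baseSet_trivializationAt' x₀)] with x hx hxe hxT
  ext w
  change (trivializationAt F A x₀).continuousLinearMapAt ℝ x (σ x
    ((trivializationAt EB (TangentSpace 𝓘(ℝ, EB)) x₀).symmL ℝ x w)) = τ x w
  rw [hσ, hx, (trivializationAt F A x₀).continuousLinearMapAt_symmL hxe,
    (trivializationAt EB (TangentSpace 𝓘(ℝ, EB)) x₀).continuousLinearMapAt_symmL hxT]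

/-- A curve of fibre elements that is smooth in a trivialization is smooth. -/
theorem _root_.contMDiffWithinAt_mk_trivializationAt_symm
    {EM : Type*} [NormedAddCommGroup EM] [NormedSpace ℝ EM] {HM : Type*} [TopologicalSpace HM]
    {IM : ModelWithCorners ℝ EM HM} {M : Type*} [TopologicalSpace M] [ChartedSpace HM M]
    {b : M → B} {w : M → FD} {s : Set M} {m₀ : M} {x₀ : B}
    (hb : ContMDiffWithinAt IM 𝓘(ℝ, EB) ∞ b s m₀) (hw : ContMDiffWithinAt IM 𝓘(ℝ, FD) ∞ w s m₀)
    (hm : b m₀ ∈ (trivializationAt FD D x₀).baseSet) :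
    ContMDiffWithinAt IM (𝓘(ℝ, EB).prod 𝓘(ℝ, FD)) ∞
      (fun m => TotalSpace.mk' FD (b m) ((trivializationAt FD D x₀).symm (b m) (w m))) s m₀ := by
  set e := trivializationAt FD D x₀
  have h1 : ContMDiffAt (𝓘(ℝ, EB).prod 𝓘(ℝ, FD)) (𝓘(ℝ, EB).prod 𝓘(ℝ, FD)) ∞
      e.toOpenPartialHomeomorph.symm (b m₀, w m₀) :=
    (e.contMDiffOn_symm (IB := 𝓘(ℝ, EB)) (n := ∞)).contMDiffAt
      (e.open_target.mem_nhds (e.mem_target.2 hm))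
  have h2 := h1.comp_contMDiffWithinAt m₀ (hb.prodMk hw)
  refine h2.congr_of_eventuallyEq ?_ (e.mk_symm hm (w m₀))
  filter_upwards [hb.continuousWithinAt.preimage_mem_nhdsWithin (e.open_baseSet.mem_nhds hm)]
    with m hm' using e.mk_symm hm' (w m)

/-- The metric on the base for which the anchor is a Riemannian submersion. -/
theorem exists_riemannMetric [CompleteSpace EB] [CompleteSpace F] (hL : L.IsTransitive)
    (hI : I.IsPositive) (hdec : I.HasOrthogonalDecomposition L) :
    ∃ gB : RiemannMetric EB B, ∀ x (ζ η : TangentSpace 𝓘(ℝ, EB) x),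
      gB.form x ζ η = I.metric (I.anchorInv L x ζ) (I.anchorInv L x η) := by
  obtain ⟨σ, hσs, hσ⟩ := exists_horizontalLift hL hI hdec
  let form : ∀ x : B, TangentSpace 𝓘(ℝ, EB) x →L[ℝ] TangentSpace 𝓘(ℝ, EB) x →L[ℝ] ℝ := fun x =>
    (ContinuousLinearMap.precomp ℝ (σ x)).comp ((S.pairing x).comp
      ((I.toEquiv x : A x →L[ℝ] D x).comp (σ x)))
  have hform : ∀ x ζ η, form x ζ η = I.metric (σ x ζ) (σ x η) := fun x ζ η => rfl
  refine ⟨⟨form, fun x v w => ?_, fun x v hv => ?_, fun x₀ => ?_⟩, fun x ζ η => ?_⟩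
  · rw [hform, hform]; exact I.symm x _ _
  · rw [hform]
    refine hI x _ fun h0 => hv ?_
    rw [← anchor_anchorInv (I := I) hL hdec v, ← hσ, h0, map_zero]
  · have hσv : ContMDiff 𝓘(ℝ, EB).tangent (𝓘(ℝ, EB).prod 𝓘(ℝ, F)) ∞
        (fun v : TangentBundle 𝓘(ℝ, EB) B => TotalSpace.mk' F v.1 (σ v.1 v.2)) := fun v =>
      ContMDiffAt.clm_bundle_apply (F₁ := EB) (F₂ := F) (E₁ := TangentSpace 𝓘(ℝ, EB)) (E₂ := A)
        (b := fun v : TangentBundle 𝓘(ℝ, EB) B => v.1) (ϕ := fun v => σ v.1) (v := fun v => v.2)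
        ((hσs v.1).comp v (Bundle.contMDiff_proj (n := ∞) _ v)) contMDiffAt_id
    -- The inertia operator is given as a smooth map of total spaces, so smoothness in the Hom
    -- bundle is recovered one argument at a time: here the first argument is a point of `TB`, and
    -- the second one is turned into a functional.
    have h1 : ContMDiff 𝓘(ℝ, EB).tangent (𝓘(ℝ, EB).prod 𝓘(ℝ, EB →L[ℝ] ℝ)) ∞
        (fun v : TangentBundle 𝓘(ℝ, EB) B => TotalSpace.mk' (EB →L[ℝ] ℝ)
          (E := fun x => TangentSpace 𝓘(ℝ, EB) x →L[ℝ] ℝ) v.1 (form v.1 v.2)) := by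
      intro v₀
      have hp := Bundle.contMDiff_proj (n := ∞) (TangentSpace 𝓘(ℝ, EB) : B → Type _) (IB := 𝓘(ℝ,
          EB)) (F := EB)
      apply contMDiffAt_hom_of_uncurry (F₂ := ℝ) (E₂ := Bundle.Trivial B ℝ) (hp v₀)
      have hq : ContMDiffAt (𝓘(ℝ, EB).tangent.prod 𝓘(ℝ, EB)) 𝓘(ℝ, EB) ∞
          (fun q : TangentBundle 𝓘(ℝ, EB) B × EB => q.1.1) (v₀, 0) :=
        (hp v₀).comp (v₀, (0 : EB)) contMDiffAt_fst
      refine contMDiffAt_totalSpace.2 ⟨hq, ?_⟩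
      have h2 : ContMDiffAt (𝓘(ℝ, EB).tangent.prod 𝓘(ℝ, EB)) 𝓘(ℝ, EB).tangent ∞
          (fun q : TangentBundle 𝓘(ℝ, EB) B × EB => TotalSpace.mk' EB q.1.1
            ((trivializationAt EB (TangentSpace 𝓘(ℝ, EB)) v₀.1).symm q.1.1 q.2)) (v₀, 0) :=
        contMDiffWithinAt_mk_trivializationAt_symm (x₀ := v₀.1) hq
          contMDiffAt_snd (FiberBundle.mem_baseSet_trivializationAt' v₀.1)
      exact S.contMDiffWithinAt_pairing
        (I.contMDiff.contMDiffAt.comp (v₀, (0 : EB)) (hσv.contMDiffAt.comp _ contMDiffAt_fst))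
        (hσv.contMDiffAt.comp (v₀, (0 : EB)) h2)
    apply contMDiffAt_hom_of_uncurry (F₁ := EB) (E₁ := TangentSpace 𝓘(ℝ, EB)) (F₂ := EB →L[ℝ] ℝ)
      (E₂ := fun x => TangentSpace 𝓘(ℝ, EB) x →L[ℝ] ℝ) (b := fun x : B => x) contMDiffAt_id
    have h2 : ContMDiffAt (𝓘(ℝ, EB).prod 𝓘(ℝ, EB)) 𝓘(ℝ, EB).tangent ∞
          (fun q : B × EB => TotalSpace.mk' EB q.1
            ((trivializationAt EB (TangentSpace 𝓘(ℝ, EB)) x₀).symm q.1 q.2)) (x₀, 0) :=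
        contMDiffWithinAt_mk_trivializationAt_symm contMDiffAt_fst
          contMDiffAt_snd (FiberBundle.mem_baseSet_trivializationAt' x₀)
    exact h1.contMDiffAt.comp (x₀, (0 : EB)) h2
  · exact (hform x ζ η).trans (by rw [hσ, hσ])

end InertiaOperator

end HorizontalLift

/-! ### Uniqueness of the zero solution of a linear equation for functionals. -/

section LinearEquation

/-- A curve of functionals that satisfies a linear equation with bounded coefficients and vanishes
at some time vanishes at all nearby times. -/
theorem exists_forall_eq_zero_of_hasDerivAt {F : Type*} [NormedAddCommGroup F] [NormedSpace ℝ F]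
    [CompleteSpace F] {Q : ℝ → F →L[ℝ] ℝ} {m : ℝ → F → F} {t₀ r : ℝ} (hr : 0 < r)
    (hQ : ∀ t ∈ Metric.closedBall t₀ r, ∀ k, HasDerivAt (fun s => Q s k) (Q t (m t k)) t)
    (hm : ∀ l : F →L[ℝ] ℝ, ∃ C, ∀ t ∈ Metric.closedBall t₀ r, ∀ k, ‖k‖ ≤ 1 → ‖l (m t k)‖ ≤ C) :
    ∃ N ∈ 𝓝 t₀, ∀ s ∈ N, Q s = 0 → ∀ t ∈ N, Q t = 0 := by
  -- Weakly bounded sets are bounded: the uniform boundedness principle is applied to the vectors `m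
  -- t k` in the bidual. Linearity and continuity of `m t` play no role.
  obtain ⟨C, hC⟩ : ∃ C, ∀ t ∈ Metric.closedBall t₀ r, ∀ k, ‖k‖ ≤ 1 → ‖m t k‖ ≤ C := by
    let g : (Metric.closedBall t₀ r × Metric.closedBall (0 : F) 1) → (F →L[ℝ] ℝ) →L[ℝ] ℝ :=
      fun i => NormedSpace.inclusionInDoubleDual ℝ F (m i.1 i.2)
    obtain ⟨C, hC⟩ := banach_steinhaus (g := g) (fun l => by
      obtain ⟨C, hC⟩ := hm l
      exact ⟨C, fun i => hC i.1 i.1.2 i.2 (mem_closedBall_zero_iff.1 i.2.2)⟩)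
    refine ⟨C, fun t ht k hk => ?_⟩
    have h1 := hC (⟨t, ht⟩, ⟨k, by simpa using hk⟩)
    have h2 : ‖NormedSpace.inclusionInDoubleDual ℝ F (m t k)‖ = ‖m t k‖ :=
      (NormedSpace.inclusionInDoubleDualLi ℝ (E := F)).norm_map (m t k)
    rwa [← h2]
  -- `Q` is only known to be pointwise continuous in `t`, so a bound on its norm also needs uniform
  -- boundedness.
  obtain ⟨M, hM⟩ : ∃ M, ∀ t ∈ Metric.closedBall t₀ r, ‖Q t‖ ≤ M := by
    obtain ⟨M, hM⟩ := banach_steinhaus (g := fun i : Metric.closedBall t₀ r => Q i) (fun k => by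
      obtain ⟨M, hM⟩ := (isCompact_closedBall t₀ r).exists_bound_of_continuousOn
        (f := fun s => Q s k) (fun t ht => (hQ t ht k).continuousAt.continuousWithinAt)
      exact ⟨M, fun i => hM i i.2⟩)
    exact ⟨M, fun t ht => hM ⟨t, ht⟩⟩
  have hC0 : 0 ≤ C := (norm_nonneg _).trans (hC t₀ (Metric.mem_closedBall_self hr.le) 0 (by simp))
  have hM0 : 0 ≤ M := (norm_nonneg _).trans (hM t₀ (Metric.mem_closedBall_self hr.le))
  -- Two times in the smaller ball differ by at most `2 δ`, and `C * (2 * δ) ≤ 1 / 2`; the `+ 1`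
  -- covers `C = 0`.
  set δ := min r (1 / (4 * (C + 1)))
  have hδ0 : 0 < δ := lt_min hr (by positivity)
  have hsub : Metric.closedBall t₀ δ ⊆ Metric.closedBall t₀ r :=
    Metric.closedBall_subset_closedBall (min_le_left _ _)
  have hCδ : C * (2 * δ) ≤ 1 / 2 := by
    have h1 : δ ≤ 1 / (4 * (C + 1)) := min_le_right _ _
    rw [le_div_iff₀ (by positivity)] at h1
    nlinarith
  have hN : Metric.closedBall t₀ δ ∈ 𝓝 t₀ := Metric.closedBall_mem_nhds _ hδ0
  refine ⟨_, hN, fun s hs hQs t ht => ?_⟩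
  -- By the mean value inequality, a bound on `Q` and its vanishing at `s` give half that bound;
  -- iteration drives the bound to zero. This replaces Gronwall's inequality, which would ask for a
  -- derivative in operator norm.
  have hhalf : ∀ M', 0 ≤ M' → (∀ t ∈ Metric.closedBall t₀ δ, ‖Q t‖ ≤ M') →
      ∀ t ∈ Metric.closedBall t₀ δ, ‖Q t‖ ≤ M' / 2 := by
    intro M' hM' h t ht
    refine ContinuousLinearMap.opNorm_le_of_unit_norm (by positivity) fun k hk => ?_
    have h1 := (convex_closedBall t₀ δ).norm_image_sub_le_of_norm_hasDerivWithin_le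
      (f := fun s => Q s k) (C := M' * C)
      (fun u hu => (hQ u (hsub hu) k).hasDerivWithinAt)
      (fun u hu => ((Q u).le_opNorm _).trans (mul_le_mul (h u hu) (hC u (hsub hu) k hk.le)
        (norm_nonneg _) hM')) hs ht
    have h2 : ‖t - s‖ ≤ 2 * δ := by
      rw [← dist_eq_norm]
      linarith [dist_triangle_right t s t₀, Metric.mem_closedBall.1 ht, Metric.mem_closedBall.1 hs]
    simp only [hQs, zero_apply, sub_zero] at h1
    calc ‖Q t k‖ ≤ M' * C * ‖t - s‖ := h1
      _ ≤ M' * C * (2 * δ) := by gcongr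
      _ = M' * (C * (2 * δ)) := by ring
      _ ≤ M' * (1 / 2) := by gcongr
      _ = M' / 2 := by ring
  have hpow : ∀ n : ℕ, ∀ t ∈ Metric.closedBall t₀ δ, ‖Q t‖ ≤ M * (1 / 2) ^ n := by
    intro n
    induction n with
    | zero => simpa using fun t ht => hM t (hsub ht)
    | succ n ih =>
      intro t ht
      have := hhalf _ (by positivity) ih t ht
      rw [pow_succ]
      linarith
  have hlim : Filter.Tendsto (fun n : ℕ => M * (1 / 2 : ℝ) ^ n) Filter.atTop (𝓝 (M * 0)) :=
    (tendsto_pow_atTop_nhds_zero_of_lt_one (by norm_num) (by norm_num)).const_mul M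
  rw [mul_zero] at hlim
  exact norm_le_zero_iff.1 (ge_of_tendsto' hlim fun n => hpow n t ht)

end LinearEquation

/-! ### Smoothness of operators and functionals in a fixed trivialization. -/

section InvariantImage

variable {EB : Type*} [NormedAddCommGroup EB] [NormedSpace ℝ EB]
  {B : Type*} [TopologicalSpace B] [ChartedSpace EB B] [IsManifold 𝓘(ℝ, EB) ∞ B]
  {F : Type*} [NormedAddCommGroup F] [NormedSpace ℝ F]
  {A : B → Type*} [∀ x, AddCommGroup (A x)] [∀ x, Module ℝ (A x)]
  [∀ x, TopologicalSpace (A x)] [∀ x, IsTopologicalAddGroup (A x)]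
  [∀ x, ContinuousSMul ℝ (A x)]
  [TopologicalSpace (TotalSpace F A)] [FiberBundle F A] [VectorBundle ℝ F A]
  [ContMDiffVectorBundle ∞ F A 𝓘(ℝ, EB)]
  {FD : Type*} [NormedAddCommGroup FD] [NormedSpace ℝ FD]
  {D : B → Type*} [∀ x, AddCommGroup (D x)] [∀ x, Module ℝ (D x)]
  [∀ x, TopologicalSpace (D x)]
  [TopologicalSpace (TotalSpace FD D)] [FiberBundle FD D] [VectorBundle ℝ FD D]
  [ContMDiffVectorBundle ∞ FD D 𝓘(ℝ, EB)]

theorem smoothSectionOn_trivializationAt_symm (x₀ : B) (w : FD) :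
    SmoothSectionOn EB FD (fun y => (trivializationAt FD D x₀).symm y w)
      (trivializationAt FD D x₀).baseSet := fun _ hy =>
  contMDiffWithinAt_mk_trivializationAt_symm contMDiffWithinAt_id contMDiffWithinAt_const hy

/-- These 1-forms read off the component along `l` of a bracket, so that the smoothness of their
algebroid differentials bounds that component. -/
theorem contMDiffOn_functional_comp_trivializationAt (x₀ : B) (l : F →L[ℝ] ℝ) :
    ContMDiffOn 𝓘(ℝ, EB) (𝓘(ℝ, EB).prod 𝓘(ℝ, F →L[ℝ] ℝ)) ∞
      (fun y => TotalSpace.mk' (F →L[ℝ] ℝ) (E := fun y => A y →L[ℝ] ℝ) y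
        (l.comp ((trivializationAt F A x₀).continuousLinearMapAt ℝ y)))
      (trivializationAt F A x₀).baseSet := by
  intro y₀ hy₀
  set e := trivializationAt F A x₀
  refine ContMDiffAt.contMDiffWithinAt ?_
  apply contMDiffAt_hom_of_uncurry (F₁ := F) (E₁ := A) (F₂ := ℝ)
      (E₂ := Bundle.Trivial B ℝ) (b := fun x : B => x) contMDiffAt_id
  refine contMDiffAt_totalSpace.2 ⟨contMDiffAt_fst, ?_⟩
  have h2 : ContMDiffAt (𝓘(ℝ, EB).prod 𝓘(ℝ, F)) (𝓘(ℝ, EB).prod 𝓘(ℝ, F)) ∞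
      (fun q : B × F => TotalSpace.mk' F q.1 ((trivializationAt F A y₀).symm q.1 q.2)) (y₀, 0) :=
    contMDiffWithinAt_mk_trivializationAt_symm contMDiffAt_fst
      contMDiffAt_snd (FiberBundle.mem_baseSet_trivializationAt' y₀)
  have h1 : ContMDiffAt (𝓘(ℝ, EB).prod 𝓘(ℝ, F)) (𝓘(ℝ, EB).prod 𝓘(ℝ, F)) ∞ e
      (TotalSpace.mk' F y₀ ((trivializationAt F A y₀).symm y₀ 0)) :=
    (e.contMDiffOn (IB := 𝓘(ℝ, EB)) (n := ∞)).contMDiffAt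
      (e.open_source.mem_nhds (e.mem_source.2 hy₀))
  have h3 := (contMDiffAt_snd.comp _ h1).comp (y₀, (0 : F)) h2
  refine (l.contMDiff.contMDiffAt.comp (y₀, (0 : F)) h3).congr_of_eventuallyEq ?_
  filter_upwards [continuousAt_fst.preimage_mem_nhds (e.open_baseSet.mem_nhds hy₀)] with q hq
  change l (e.continuousLinearMapAt ℝ q.1 _) = l (e _).2
  rw [e.continuousLinearMapAt_apply (R := ℝ), e.coe_linearMapAt_of_mem (R := ℝ) hq]

theorem contMDiffOn_inCoordinates {P : ∀ x, A x →L[ℝ] A x}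
    (hP : ContMDiff 𝓘(ℝ, EB) (𝓘(ℝ, EB).prod 𝓘(ℝ, F →L[ℝ] F)) ∞
      (fun x => TotalSpace.mk' (F →L[ℝ] F) (E := fun x => A x →L[ℝ] A x) x (P x))) (x₀ : B) :
    ContMDiffOn 𝓘(ℝ, EB) 𝓘(ℝ, F →L[ℝ] F) ∞
      (fun x => ((trivializationAt F A x₀).continuousLinearMapAt ℝ x).comp
        ((P x).comp ((trivializationAt F A x₀).symmL ℝ x))) (trivializationAt F A x₀).baseSet := by
  have h := (trivializationAt (F →L[ℝ] F) (fun x => A x →L[ℝ] A x)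
      x₀).contMDiffOn_section_baseSet_iff
    (IB := 𝓘(ℝ, EB)) (n := ∞) (s := P)
  rw [hom_trivializationAt_baseSet, inter_self] at h
  refine (h.1 hP.contMDiffOn).congr fun x hx => ?_
  rw [hom_trivializationAt_apply]
  rfl

end InvariantImage

/-! ### Hamiltonian trajectories preserve the image of the dual of the anchor. -/

section InvariantImage

variable {EB : Type*} [NormedAddCommGroup EB] [NormedSpace ℝ EB]
  {B : Type*} [TopologicalSpace B] [ChartedSpace EB B] [IsManifold 𝓘(ℝ, EB) ∞ B]
  {F : Type*} [NormedAddCommGroup F] [NormedSpace ℝ F]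
  {A : B → Type*} [∀ x, AddCommGroup (A x)] [∀ x, Module ℝ (A x)]
  [∀ x, TopologicalSpace (A x)] [∀ x, IsTopologicalAddGroup (A x)]
  [∀ x, ContinuousSMul ℝ (A x)]
  [TopologicalSpace (TotalSpace F A)] [FiberBundle F A] [VectorBundle ℝ F A]
  [ContMDiffVectorBundle ∞ F A 𝓘(ℝ, EB)]
  {FD : Type*} [NormedAddCommGroup FD] [NormedSpace ℝ FD]
  {D : B → Type*} [∀ x, AddCommGroup (D x)] [∀ x, Module ℝ (D x)]
  [∀ x, TopologicalSpace (D x)]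
  [TopologicalSpace (TotalSpace FD D)] [FiberBundle FD D] [VectorBundle ℝ FD D]
  [ContMDiffVectorBundle ∞ FD D 𝓘(ℝ, EB)]

theorem dirDeriv_clm_comp {V : Type*} [NormedAddCommGroup V] [NormedSpace ℝ V] {x : B}
    (v : TangentSpace 𝓘(ℝ, EB) x) {f : B → V} (hf : MDifferentiableAt 𝓘(ℝ, EB) 𝓘(ℝ, V) f x)
    (l : V →L[ℝ] ℝ) :
    dirDeriv v (fun y => l (f y)) = l (mfderiv 𝓘(ℝ, EB) 𝓘(ℝ, V) f x v) := by
  have h := (l.hasMFDerivAt (x := f x)).comp x hf.hasMFDerivAt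
  exact DFunLike.congr_fun h.mfderiv v

namespace InertiaOperator

variable {L : LieAlgebroid EB F A} {S : SmoothDual EB F A FD D} {I : InertiaOperator S}

/-- If `ξ` kills `Ker #`, then `p = ξ ∘ σ` works for the horizontal lift `σ`, because `a - σ (# a)`
lies in `Ker #`. Continuity of `σ` makes `p` continuous. -/
theorem mem_dualAnchorImage_iff [CompleteSpace EB] [CompleteSpace F] (hL : L.IsTransitive)
    (hI : I.IsPositive) (hdec : I.HasOrthogonalDecomposition L) {ξ : TotalSpace FD D} :
    ξ ∈ L.dualAnchorImage S ↔ ∀ k : A ξ.proj, L.anchor ξ.proj k = 0 → S.pairing ξ.proj ξ.2 k = 0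
        := by
  constructor
  · rintro ⟨p, hp⟩ k hk
    rw [hp, hk, map_zero]
  · intro h
    obtain ⟨σ, -, hσ⟩ := exists_horizontalLift hL hI hdec
    refine ⟨(S.pairing ξ.proj ξ.2).comp (σ ξ.proj), fun a => ?_⟩
    have h1 := h (a - σ ξ.proj (L.anchor ξ.proj a)) (by
      rw [map_sub, hσ, anchor_anchorInv hL hdec, sub_self])
    rw [map_sub, sub_eq_zero] at h1
    exact h1

/-- In a trivialization, the restriction of `γ t` to `Ker #` is a functional that solves a linear
equation. Its coefficients are brackets with sections of `Ker #`; their boundedness comes from the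
smoothness of algebroid differentials. -/
theorem exists_forall_mem_dualAnchorImage [CompleteSpace EB] [CompleteSpace F]
    (hL : L.IsTransitive) (hI : I.IsPositive) (hdec : I.HasOrthogonalDecomposition L)
    {h : TotalSpace FD D → ℝ} {W : Set (TotalSpace FD D)} (hW : IsOpen W)
    (hh : S.IsSmoothFunctionOn h W) {γ : ℝ → TotalSpace FD D} {J : Set ℝ} (hJ : IsOpen J)
    (hγW : ∀ t ∈ J, γ t ∈ W) (hγ : L.IsHamiltonianTrajectory S h γ J) {t₀ : ℝ} (ht₀ : t₀ ∈ J) :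
    ∃ N ∈ 𝓝 t₀, ∀ s ∈ N, γ s ∈ L.dualAnchorImage S → ∀ t ∈ N, γ t ∈ L.dualAnchorImage S := by
  obtain ⟨P, hPs, hP⟩ := id hdec
  obtain ⟨hhs, a, ha, had⟩ := hh
  set x₀ := (γ t₀).proj
  set e := trivializationAt F A x₀
  have hU : IsOpen e.baseSet := e.open_baseSet
  have hπW : IsOpen (W ∩ π FD D ⁻¹' e.baseSet) := hW.inter (SmoothDual.isOpen_proj_preimage hU)
  have hcont : ∀ t ∈ J, ContinuousAt γ t := fun t ht => (hγ t ht).1.continuousAt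
  have hmem : ∀ᶠ t in 𝓝 t₀, t ∈ J ∧ γ t ∈ W ∩ π FD D ⁻¹' e.baseSet := by
    filter_upwards [hJ.mem_nhds ht₀, (hcont t₀ ht₀).preimage_mem_nhds (hπW.mem_nhds
      ⟨hγW t₀ ht₀, FiberBundle.mem_baseSet_trivializationAt' x₀⟩)] with t h1 h2 using ⟨h1, h2⟩
  obtain ⟨r, hr, hball⟩ := Metric.nhds_basis_closedBall.mem_iff.1 hmem
  have hb : ∀ t ∈ Metric.closedBall t₀ r, (γ t).proj ∈ e.baseSet := fun t ht => (hball ht).2.2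
  have hcb : ContinuousOn γ (Metric.closedBall t₀ r) :=
    fun t ht => (hcont t (hball ht).1).continuousWithinAt
  -- the projections to the kernel of constant sections
  let κ : F → ∀ y, A y := fun k y => P y (e.symm y k)
  have hκ : ∀ k, SmoothSectionOn EB F (κ k) e.baseSet := fun k y hy =>
    ContMDiffWithinAt.clm_bundle_apply (F₁ := F) (F₂ := F) (E₁ := A) (E₂ := A) (b := fun x => x)
      hPs.contMDiffAt.contMDiffWithinAt (smoothSectionOn_trivializationAt_symm x₀ k y hy)
  have hκ0 : ∀ k y, L.anchor y (κ k y) = 0 := fun k y => (hP y _).1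
  -- The fibre differential of `h` at `γ t`, with `t` frozen, extended as a constant section of `e`.
  let ζ : ∀ t, ∀ y, A y := fun t y => e.symm y (e.continuousLinearMapAt ℝ (γ t).proj (a (γ t)))
  have hζ : ∀ t, SmoothSectionOn EB F (ζ t) e.baseSet := fun t =>
    smoothSectionOn_trivializationAt_symm x₀ _
  have hζt : ∀ t ∈ Metric.closedBall t₀ r, ζ t (γ t).proj = a (γ t) := fun t ht => by
    have := e.symmL_continuousLinearMapAt (R := ℝ) (hb t ht) (a (γ t))
    rwa [e.symmL_apply (hb t ht)] at this
  let m : ℝ → F → F := fun t k =>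
    e.continuousLinearMapAt ℝ (γ t).proj (L.bracket (ζ t) (κ k) (γ t).proj)
  -- Composition with `P` puts the restriction to `Ker #` on the fixed space `F`, so `Ker #` itself
  -- need not be trivialized.
  let Q : ℝ → F →L[ℝ] ℝ := fun t => (S.pairing (γ t).proj (γ t).2).comp
    ((P (γ t).proj).comp (e.symmL ℝ (γ t).proj))
  have himage : ∀ t ∈ Metric.closedBall t₀ r, γ t ∈ L.dualAnchorImage S ↔ Q t = 0 := by
    intro t ht
    rw [mem_dualAnchorImage_iff hL hI hdec]
    constructor
    · intro h1
      ext k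
      exact h1 _ (hP _ _).1
    · intro h1 k hk
      have h2 := DFunLike.congr_fun h1 (e.continuousLinearMapAt ℝ (γ t).proj k)
      change S.pairing _ _ (P _ (e.symmL ℝ _ (e.continuousLinearMapAt ℝ _ k))) = 0 at h2
      rwa [e.symmL_continuousLinearMapAt (hb t ht), projection_eq_self hI (hP _) hk] at h2
  have hder : ∀ t ∈ Metric.closedBall t₀ r, ∀ k, HasDerivAt (fun s => Q s k) (Q t (m t k)) t := by
    intro t ht k
    have h1 := (hγ t (hball ht).1).2 _ _ (SmoothDual.isOpen_proj_preimage hU) (hb t ht)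
      (S.isSmoothFunctionOn_linearFunction (hκ k))
    -- The anchor kills `κ k`, so only `⟨ξ, [ζ, κ k]⟩` survives. The bracket lies in `Ker #` and is
    -- fixed by `P`, so its pairing with `ξ` is a value of `Q t`.
    have h2 : L.poissonBracket S h (S.linearFunction (κ k)) (γ t) = Q t (m t k) := by
      rw [L.poissonBracket_linearFunction (s := FiberBundle.extend FD (γ t).2)
        (U := e.baseSet ∩ (trivializationAt FD D (γ t).proj).baseSet) (ζ := ζ t)
        ((hhs.contMDiffAt (hW.mem_nhds (hball ht).2.1)).mdifferentiableAt (by simp))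
        (hU.inter (trivializationAt FD D (γ t).proj).open_baseSet)
        ⟨hb t ht, FiberBundle.mem_baseSet_trivializationAt' _⟩
        ((hζ t).mono inter_subset_left) ((hκ k).mono inter_subset_left)
        (by rw [hζt t ht]; exact had _ (hball ht).2.1)
        ((smoothSectionOn_extend _).mono inter_subset_right) (by simp), hκ0, dirDeriv_zero_left,
        sub_zero]
      change _ = S.pairing _ _ (P _ (e.symmL ℝ _ (e.continuousLinearMapAt ℝ _ _)))
      rw [e.symmL_continuousLinearMapAt (hb t ht), projection_eq_self hI (hP _)
        (L.anchor_bracket_eq_zero_of_anchor_eq_zero hL hU (hζ t) (hκ k) (fun x _ => hκ0 k x)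
          (hb t ht))]
    rw [← h2]
    refine h1.congr_of_eventuallyEq ?_
    filter_upwards [(hcont t (hball ht).1).preimage_mem_nhds
      ((SmoothDual.isOpen_proj_preimage (FD := FD) (D := D) hU).mem_nhds (hb t ht))] with s hs
    change S.pairing _ _ (P _ (e.symmL ℝ _ k)) = _
    rw [e.symmL_apply hs]; rfl
  have hbound : ∀ l : F →L[ℝ] ℝ,
      ∃ C, ∀ t ∈ Metric.closedBall t₀ r, ∀ k, ‖k‖ ≤ 1 → ‖l (m t k)‖ ≤ C := by
    intro l
    have hPt := contMDiffOn_inCoordinates hPs x₀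
    set Pt : B → F →L[ℝ] F := fun x => (e.continuousLinearMapAt ℝ x).comp
        ((P x).comp (e.symmL ℝ x))
    obtain ⟨Ω, hΩ, hΩe⟩ := L.differential_smooth e.baseSet hU _
      (contMDiffOn_functional_comp_trivializationAt x₀ l)
    let dP : ℝ → F →L[ℝ] F := fun t =>
      mfderiv 𝓘(ℝ, EB) 𝓘(ℝ, F →L[ℝ] F) Pt (γ t).proj (L.anchor (γ t).proj (a (γ t)))
    -- Solving the formula for the differential of the 1-form of `l` for the bracket term gives `l
    -- (m t k)` as `l` of the derivative of `P k` minus `Ω (a, P k)`. In this form it is visibly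
    -- linear and continuous in `k`.
    let R : ℝ → F →L[ℝ] ℝ := fun t => l.comp (dP t)
        - (Ω (γ t).proj (a (γ t))).comp ((P (γ t).proj).comp (e.symmL ℝ (γ t).proj))
    have hR : ∀ t ∈ Metric.closedBall t₀ r, ∀ k, R t k = l (m t k) := by
      intro t ht k
      have h1 := hΩe e.baseSet hU subset_rfl (ζ t) (κ k) (hζ t) (hκ k) _ (hb t ht)
      rw [algebroidDifferential, hκ0, dirDeriv_zero_left, sub_zero, hζt t ht] at h1
      have h2 : dirDeriv (L.anchor (γ t).proj (a (γ t)))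
          (fun y => (l.comp (e.continuousLinearMapAt ℝ y)) (κ k y)) =
          l (dP t k) := by
        have h3 := dirDeriv_clm_comp (L.anchor (γ t).proj (a (γ t)))
          ((hPt.contMDiffAt (hU.mem_nhds (hb t ht))).mdifferentiableAt (by simp))
          (l.comp (ContinuousLinearMap.apply ℝ F k))
        refine Eq.trans (dirDeriv_congr _ ?_) h3
        filter_upwards [hU.mem_nhds (hb t ht)] with y hy
        change l (e.continuousLinearMapAt ℝ y (P y (e.symm y k))) =
          l (e.continuousLinearMapAt ℝ y (P y (e.symmL ℝ y k)))
        rw [e.symmL_apply hy]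
      rw [h2] at h1
      change l (dP t k) - Ω _ _ (P _ (e.symmL ℝ _ k)) = l (e.continuousLinearMapAt ℝ _ _)
      rw [e.symmL_apply (hb t ht)]
      change _ - Ω _ _ (κ k _) = _
      rw [← h1]
      change _ - (-l (e.continuousLinearMapAt ℝ _ _) + _) = _
      ring
    have hRc : ∀ k, ContinuousOn (fun t => R t k) (Metric.closedBall t₀ r) := by
      intro k
      have h1 := contMDiffOn_mfderiv_apply hU hPt (b := π FD D)
        (v := fun ξ => L.anchor ξ.proj (a ξ)) (s := W ∩ π FD D ⁻¹' e.baseSet)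
        (fun ξ hξ => hξ.2) (fun ξ hξ =>
          ContMDiffWithinAt.clm_bundle_apply (F₁ := F) (F₂ := EB) (E₁ := A)
            (E₂ := TangentSpace 𝓘(ℝ, EB)) (b := fun ξ : TotalSpace FD D => ξ.proj)
            (L.contMDiff_anchor.contMDiffAt.comp_contMDiffWithinAt ξ
              (Bundle.contMDiff_proj (n := ∞) D).contMDiffAt.contMDiffWithinAt)
            ((ha ξ hξ.1).mono inter_subset_left))
      have h2 : ContMDiffOn (𝓘(ℝ, EB).prod 𝓘(ℝ, FD)) 𝓘(ℝ, ℝ) ∞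
          (fun ξ : TotalSpace FD D => Ω ξ.proj (a ξ) (κ k ξ.proj))
          (W ∩ π FD D ⁻¹' e.baseSet) := by
        intro ξ hξ
        have : ContMDiffWithinAt (𝓘(ℝ, EB).prod 𝓘(ℝ, FD)) (𝓘(ℝ, EB).prod 𝓘(ℝ, ℝ)) ∞
            (fun ξ : TotalSpace FD D => TotalSpace.mk' ℝ (E := Bundle.Trivial B ℝ) ξ.proj
              (Ω ξ.proj (a ξ) (κ k ξ.proj))) (W ∩ π FD D ⁻¹' e.baseSet) ξ := by
          apply ContMDiffWithinAt.clm_bundle_apply₂ (F₁ := F) (F₂ := F)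
          · exact ((hΩ _ hξ.2).contMDiffAt (hU.mem_nhds hξ.2)).comp_contMDiffWithinAt ξ
              (Bundle.contMDiff_proj (n := ∞) D).contMDiffAt.contMDiffWithinAt
          · exact (ha ξ hξ.1).mono inter_subset_left
          · exact (SmoothDual.contMDiffOn_section_comp_proj (hκ k) ξ hξ.2).mono inter_subset_right
        exact (contMDiffWithinAt_totalSpace.1 this).2
      have h3 : ContinuousOn (fun t => l (dP t k)) (Metric.closedBall t₀ r) :=
        (l.comp (ContinuousLinearMap.apply ℝ F k)).continuous.comp_continuousOn
          (h1.continuousOn.comp hcb fun t ht => (hball ht).2)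
      refine (h3.sub (h2.continuousOn.comp hcb fun t ht => (hball ht).2)).congr fun t ht => ?_
      change l (dP t k) - Ω _ _ (P _ (e.symmL ℝ _ k)) = _
      rw [e.symmL_apply (hb t ht)]
      rfl
    obtain ⟨C, hC⟩ := banach_steinhaus (g := fun i : Metric.closedBall t₀ r => R i) (fun k => by
      obtain ⟨M, hM⟩ := (isCompact_closedBall t₀ r).exists_bound_of_continuousOn (hRc k)
      exact ⟨M, fun i => hM i i.2⟩)
    refine ⟨C, fun t ht k hk => ?_⟩
    rw [← hR t ht]
    have hC0 := (norm_nonneg _).trans (hC ⟨t, ht⟩)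
    calc ‖R t k‖ ≤ ‖R t‖ * ‖k‖ := (R t).le_opNorm k
      _ ≤ C * 1 := mul_le_mul (hC ⟨t, ht⟩) hk (norm_nonneg _) hC0
      _ = C := mul_one C
  obtain ⟨N, hN, hN'⟩ := exists_forall_eq_zero_of_hasDerivAt hr hder hbound
  refine ⟨N ∩ Metric.closedBall t₀ r, Filter.inter_mem hN (Metric.closedBall_mem_nhds _ hr),
    fun s hs hsi t ht => ?_⟩
  rw [himage t ht.2]
  exact hN' s hs.1 ((himage s hs.2).1 hsi) t ht.1

/-- A Hamiltonian trajectory that meets the image of the dual of the anchor stays in it. -/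
theorem mem_dualAnchorImage_of_isHamiltonianTrajectory [CompleteSpace EB] [CompleteSpace F]
    (hL : L.IsTransitive) (hI : I.IsPositive) (hdec : I.HasOrthogonalDecomposition L)
    {h : TotalSpace FD D → ℝ} {W : Set (TotalSpace FD D)} (hW : IsOpen W)
    (hh : S.IsSmoothFunctionOn h W) {γ : ℝ → TotalSpace FD D} {J : Set ℝ} (hJ : IsOpen J)
    (hγW : ∀ t ∈ J, γ t ∈ W) (hγ : L.IsHamiltonianTrajectory S h γ J) {T : Set ℝ} (hTJ : T ⊆ J)
    (hT : IsPreconnected T) {s t : ℝ} (hs : s ∈ T) (ht : t ∈ T)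
    (hsi : γ s ∈ L.dualAnchorImage S) : γ t ∈ L.dualAnchorImage S := by
  -- Membership at two times being equivalent is a locally valid equivalence relation, hence holds
  -- throughout a preconnected set.
  refine (hT.induction₂ (fun s t => γ s ∈ L.dualAnchorImage S ↔ γ t ∈ L.dualAnchorImage S)
    (fun x hx => ?_) (fun x y z _ _ _ h1 h2 => h1.trans h2) (fun x y _ _ h1 => h1.symm) hs ht).1 hsi
  obtain ⟨N, hN, hN'⟩ := exists_forall_mem_dualAnchorImage hL hI hdec hW hh hJ hγW hγ (hTJ hx)
  filter_upwards [mem_nhdsWithin_of_mem_nhds hN] with y hy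
  exact ⟨fun h => hN' x (mem_of_mem_nhds hN) h y hy,
    fun h => hN' y hy h x (mem_of_mem_nhds hN)⟩

end InertiaOperator

end InvariantImage

/-! ### Vector fields constant in a chart. -/

section ChartFields

variable {EB : Type*} [NormedAddCommGroup EB] [NormedSpace ℝ EB]
  {B : Type*} [TopologicalSpace B] [ChartedSpace EB B] [IsManifold 𝓘(ℝ, EB) ∞ B]

/-- The vector field that is constant in the chart at `x₀`. -/
noncomputable def chartField (x₀ : B) (v : EB) (y : B) : TangentSpace 𝓘(ℝ, EB) y :=
  (trivializationAt EB (TangentSpace 𝓘(ℝ, EB)) x₀).symm y v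

theorem smoothSectionOn_chartField (x₀ : B) (v : EB) :
    SmoothSectionOn EB EB (chartField x₀ v) (chartAt EB x₀).source :=
  smoothSectionOn_trivializationAt_symm x₀ v

theorem mfderiv_extChartAt_chartField {x₀ y : B} (hy : y ∈ (chartAt EB x₀).source) (v : EB) :
    mfderiv 𝓘(ℝ, EB) 𝓘(ℝ, EB) (extChartAt 𝓘(ℝ, EB) x₀) y (chartField x₀ v y) = v := by
  have h := (trivializationAt EB (TangentSpace 𝓘(ℝ, EB)) x₀).continuousLinearMapAt_symmL (R := ℝ)
      hy v
  rw [(trivializationAt EB (TangentSpace 𝓘(ℝ, EB)) x₀).symmL_apply hy] at h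
  exact (DFunLike.congr_fun (TangentBundle.continuousLinearMapAt_trivializationAt hy)
    (chartField x₀ v y)).symm.trans h

theorem chartField_mfderiv_extChartAt {x₀ y : B} (hy : y ∈ (chartAt EB x₀).source)
    (u : TangentSpace 𝓘(ℝ, EB) y) :
    chartField (EB := EB) x₀ (mfderiv 𝓘(ℝ, EB) 𝓘(ℝ, EB) (extChartAt 𝓘(ℝ, EB) x₀) y u) y = u := by
  have h := (trivializationAt EB (TangentSpace 𝓘(ℝ, EB)) x₀).symmL_continuousLinearMapAt (R := ℝ)
      hy u
  rw [(trivializationAt EB (TangentSpace 𝓘(ℝ, EB)) x₀).symmL_apply hy] at h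
  exact (congrArg (fun w : EB => chartField x₀ w y) (DFunLike.congr_fun
    (TangentBundle.continuousLinearMapAt_trivializationAt hy) u)).symm.trans h

theorem mfderiv_extChartAt_symm_apply {x₀ : B} {z : EB} (hz : z ∈ (extChartAt 𝓘(ℝ, EB) x₀).target)
    (v : EB) :
    mfderiv 𝓘(ℝ, EB) 𝓘(ℝ, EB) (extChartAt 𝓘(ℝ, EB) x₀).symm z v =
      chartField x₀ v ((extChartAt 𝓘(ℝ, EB) x₀).symm z) := by
  have hy := (extChartAt 𝓘(ℝ, EB) x₀).map_target hz
  rw [extChartAt_source] at hy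
  refine (isInvertible_mfderiv_extChartAt (I := 𝓘(ℝ, EB)) (x := x₀)
    ((extChartAt 𝓘(ℝ, EB) x₀).map_target hz)).injective ?_
  rw [mfderiv_extChartAt_chartField hy]
  have h := mfderiv_extChartAt_comp_mfderivWithin_extChartAt_symm (I := 𝓘(ℝ, EB)) (x := x₀) hz
  rw [ModelWithCorners.range_eq_univ, mfderivWithin_univ] at h
  exact DFunLike.congr_fun h v

end ChartFields

/-! ### Motion within a fibre generated by functions on the base. -/

section Leaf

variable {EB : Type*} [NormedAddCommGroup EB] [NormedSpace ℝ EB]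
  {B : Type*} [TopologicalSpace B] [ChartedSpace EB B] [IsManifold 𝓘(ℝ, EB) ∞ B]
  {F : Type*} [NormedAddCommGroup F] [NormedSpace ℝ F]
  {A : B → Type*} [∀ x, AddCommGroup (A x)] [∀ x, Module ℝ (A x)]
  [∀ x, TopologicalSpace (A x)] [∀ x, IsTopologicalAddGroup (A x)]
  [∀ x, ContinuousSMul ℝ (A x)]
  [TopologicalSpace (TotalSpace F A)] [FiberBundle F A] [VectorBundle ℝ F A]
  [ContMDiffVectorBundle ∞ F A 𝓘(ℝ, EB)]
  {FD : Type*} [NormedAddCommGroup FD] [NormedSpace ℝ FD]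
  {D : B → Type*} [∀ x, AddCommGroup (D x)] [∀ x, Module ℝ (D x)]
  [∀ x, TopologicalSpace (D x)]
  [TopologicalSpace (TotalSpace FD D)] [FiberBundle FD D] [VectorBundle ℝ FD D]
  [ContMDiffVectorBundle ∞ FD D 𝓘(ℝ, EB)]

theorem mdifferentiable_fiber_line (x : B) (ξ η : D x) :
    MDifferentiable 𝓘(ℝ, ℝ) (𝓘(ℝ, EB).prod 𝓘(ℝ, FD))
      (fun t : ℝ => TotalSpace.mk' FD x (ξ + t • η)) := by
  intro t
  set e := trivializationAt FD D x
  have hx : x ∈ e.baseSet := FiberBundle.mem_baseSet_trivializationAt' x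
  have h1 : ContMDiffAt 𝓘(ℝ, ℝ) 𝓘(ℝ, FD) ∞ (fun t : ℝ => e.continuousLinearMapAt ℝ x ξ +
      t • e.continuousLinearMapAt ℝ x η) t :=
    (contDiff_const.add (contDiff_id.smul contDiff_const)).contMDiff t
  have h2 := (contMDiffWithinAt_mk_trivializationAt_symm (EB := EB) (s := univ) (x₀ := x)
    (contMDiffWithinAt_const (c := x)) h1.contMDiffWithinAt hx).contMDiffAt Filter.univ_mem
  refine (h2.mdifferentiableAt (by simp)).congr_of_eventuallyEq (Filter.Eventually.of_forall fun s
      => ?_)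
  dsimp only
  rw [← e.symmL_apply (R := ℝ) hx, map_add, map_smul, e.symmL_continuousLinearMapAt hx,
    e.symmL_continuousLinearMapAt hx]

namespace LieAlgebroid

variable (L : LieAlgebroid EB F A) {S : SmoothDual EB F A FD D}

/-- The Hamiltonian flow of a function on the base translates the fibres by the pull-back of its
differential. -/
theorem hamiltonianStep_fiber {x : B} (ξ η : D x) {q : TangentSpace 𝓘(ℝ, EB) x →L[ℝ] ℝ}
    (hq : ∀ a, S.pairing x η a = q (L.anchor x a)) :
    L.HamiltonianStep S ⟨x, ξ⟩ ⟨x, ξ + η⟩ := by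
  have hx := mem_chart_source EB x
  -- A function linear in the chart with differential `-q` at `x`. The sign compensates `{f, b} =
  -- -(# b) · f`, so the fibre coordinate moves with velocity `η`; the fibre differential of the
  -- Hamiltonian is zero, so the base point stays put.
  let f : B → ℝ := fun y => -(q (chartField x (extChartAt 𝓘(ℝ, EB) x y) x))
  let qc : EB →L[ℝ] ℝ := -(q.comp ((trivializationAt EB (TangentSpace 𝓘(ℝ, EB)) x).symmL ℝ x))
  have hqc : ∀ w : EB, qc w = -(q (chartField x w x)) := fun w => by
    change -(q ((trivializationAt EB (TangentSpace 𝓘(ℝ, EB)) x).symmL ℝ x w)) = _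
    rw [(trivializationAt EB (TangentSpace 𝓘(ℝ, EB)) x).symmL_apply
      (FiberBundle.mem_baseSet_trivializationAt' x)]
    rfl
  have hfq : ∀ y, f y = qc (extChartAt 𝓘(ℝ, EB) x y) := fun y => (hqc _).symm
  have hf : ContMDiffOn 𝓘(ℝ, EB) 𝓘(ℝ, ℝ) ∞ f (chartAt EB x).source :=
    (qc.contMDiff.comp_contMDiffOn contMDiffOn_extChartAt).congr fun y _ => hfq y
  have hfd : ∀ v : TangentSpace 𝓘(ℝ, EB) x, dirDeriv v f = -(q v) := by
    intro v
    have h1 : dirDeriv v f = qc (mfderiv 𝓘(ℝ, EB) 𝓘(ℝ, EB) (extChartAt 𝓘(ℝ, EB) x) x v) :=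
      (dirDeriv_congr v (Filter.Eventually.of_forall hfq)).trans
        (dirDeriv_clm_comp v (mdifferentiableAt_extChartAt hx) qc)
    refine h1.trans ((hqc _).trans ?_)
    exact congrArg (fun w => -(q w)) (chartField_mfderiv_extChartAt hx v)
  have hfs := S.isSmoothFunctionOn_comp_proj hf
  refine ⟨_, _, univ, fun t => ⟨x, ξ + t • η⟩,
    SmoothDual.isOpen_proj_preimage (chartAt EB x).open_source, hfs, isOpen_univ, subset_univ _,
    fun t _ => hx, fun t _ => ⟨mdifferentiable_fiber_line x ξ η t, fun W g hW hgW hg => ?_⟩,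
    by simp, by simp⟩
  have hfd' : MDifferentiableAt (𝓘(ℝ, EB).prod 𝓘(ℝ, FD)) 𝓘(ℝ, ℝ)
      (fun ζ : TotalSpace FD D => f ζ.proj) ⟨x, ξ + t • η⟩ :=
    (hfs.1.contMDiffAt ((SmoothDual.isOpen_proj_preimage (chartAt EB x).open_source).mem_nhds
      hx)).mdifferentiableAt (by simp)
  refine L.hasDerivAt_poissonBracket_of_linear (γ := fun t => ⟨x, ξ + t • η⟩) hfd'
    (S.hasFiberDifferentialAt_comp_proj f _)
    (mdifferentiable_fiber_line x ξ η t) ?_ (fun b => ?_) hW hgW hg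
  · rw [map_zero, curveVelocity, mfderiv_const]; rfl
  · have hb := smoothSectionOn_extend (EB := EB) (FD := F) b
    have hs := smoothSectionOn_extend (EB := EB) (FD := FD) (ξ + t • η)
    refine ⟨_, FiberBundle.extend F b, (trivializationAt F A x).open_baseSet,
      FiberBundle.mem_baseSet_trivializationAt' x, hb, by simp, ?_⟩
    have h1 : L.poissonBracket S (fun ζ : TotalSpace FD D => f ζ.proj)
        (S.linearFunction (FiberBundle.extend F b)) ⟨x, ξ + t • η⟩ = S.pairing x η b := by
      rw [L.poissonBracket_linearFunction (s := FiberBundle.extend FD (ξ + t • η))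
        (U := (trivializationAt F A x).baseSet ∩ (trivializationAt FD D x).baseSet)
        (ζ := fun _ => 0) hfd'
        ((trivializationAt F A x).open_baseSet.inter (trivializationAt FD D x).open_baseSet)
        ⟨FiberBundle.mem_baseSet_trivializationAt' x, FiberBundle.mem_baseSet_trivializationAt' x⟩
        (smoothSectionOn_zero _) (hb.mono inter_subset_left)
        (S.hasFiberDifferentialAt_comp_proj f _) (hs.mono inter_subset_right) (by simp),
        L.bracket_zero_left (trivializationAt F A x).open_baseSet hb
          (FiberBundle.mem_baseSet_trivializationAt' x)]
      simp only [map_zero, sub_zero, zero_sub]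
      rw [hfd, neg_neg, hq]
      simp
    rw [h1]
    have h2 : HasDerivAt (fun s : ℝ => S.pairing x ξ b + s * S.pairing x η b)
        (S.pairing x η b) t := by
      simpa using ((hasDerivAt_id t).mul_const (S.pairing x η b)).const_add (S.pairing x ξ b)
    refine h2.congr_of_eventuallyEq (Filter.Eventually.of_forall fun s => ?_)
    simp [SmoothDual.linearFunction]

end LieAlgebroid

end Leaf

/-! ### Motion along the zero section, and the leaf. -/

section Leaf

variable {EB : Type*} [NormedAddCommGroup EB] [NormedSpace ℝ EB]
  {B : Type*} [TopologicalSpace B] [ChartedSpace EB B] [IsManifold 𝓘(ℝ, EB) ∞ B]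
  {F : Type*} [NormedAddCommGroup F] [NormedSpace ℝ F]
  {A : B → Type*} [∀ x, AddCommGroup (A x)] [∀ x, Module ℝ (A x)]
  [∀ x, TopologicalSpace (A x)] [∀ x, IsTopologicalAddGroup (A x)]
  [∀ x, ContinuousSMul ℝ (A x)]
  [TopologicalSpace (TotalSpace F A)] [FiberBundle F A] [VectorBundle ℝ F A]
  [ContMDiffVectorBundle ∞ F A 𝓘(ℝ, EB)]
  {FD : Type*} [NormedAddCommGroup FD] [NormedSpace ℝ FD]
  {D : B → Type*} [∀ x, AddCommGroup (D x)] [∀ x, Module ℝ (D x)]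
  [∀ x, TopologicalSpace (D x)]
  [TopologicalSpace (TotalSpace FD D)] [FiberBundle FD D] [VectorBundle ℝ FD D]
  [ContMDiffVectorBundle ∞ FD D 𝓘(ℝ, EB)]

theorem hasMFDerivAt_chartLine {x₀ : B} {c v : EB} {t : ℝ}
    (ht : c + t • v ∈ (extChartAt 𝓘(ℝ, EB) x₀).target) :
    HasMFDerivAt 𝓘(ℝ, ℝ) 𝓘(ℝ, EB) (fun s : ℝ => (extChartAt 𝓘(ℝ, EB) x₀).symm (c + s • v)) t
      ((mfderiv 𝓘(ℝ, EB) 𝓘(ℝ, EB) (extChartAt 𝓘(ℝ, EB) x₀).symm (c + t • v)).comp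
        (ContinuousLinearMap.toSpanSingleton ℝ v)) := by
  have h1 : HasDerivAt (fun s : ℝ => c + s • v) v t := by
    simpa using ((hasDerivAt_id t).smul_const v).const_add c
  have h2 : MDifferentiableAt 𝓘(ℝ, EB) 𝓘(ℝ, EB) (extChartAt 𝓘(ℝ, EB) x₀).symm (c + t • v) :=
    ((contMDiffOn_extChartAt_symm (n := ∞) x₀).contMDiffAt
      ((isOpen_extChartAt_target x₀).mem_nhds ht)).mdifferentiableAt (by simp)
  exact h2.hasMFDerivAt.comp t h1.hasFDerivAt.hasMFDerivAt

theorem curveVelocity_chartLine {x₀ : B} {c v : EB} {t : ℝ}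
    (ht : c + t • v ∈ (extChartAt 𝓘(ℝ, EB) x₀).target) :
    curveVelocity EB (fun s : ℝ => (extChartAt 𝓘(ℝ, EB) x₀).symm (c + s • v)) t =
      chartField x₀ v ((extChartAt 𝓘(ℝ, EB) x₀).symm (c + t • v)) := by
  rw [curveVelocity, (hasMFDerivAt_chartLine ht).mfderiv, ← mfderiv_extChartAt_symm_apply ht]
  change mfderiv 𝓘(ℝ, EB) 𝓘(ℝ, EB) (extChartAt 𝓘(ℝ, EB) x₀).symm (c + t • v) ((1 : ℝ) • v) = _
  rw [one_smul]

namespace LieAlgebroid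

variable (L : LieAlgebroid EB F A) {S : SmoothDual EB F A FD D}

/-- The Hamiltonian flow of the linear function of a section moves the zero section along the
image of the section under the anchor. -/
theorem hamiltonianStep_zeroSection {x₀ : B} {c v : EB} {ζ : ∀ x, A x}
    (hζ : SmoothSectionOn EB F ζ (chartAt EB x₀).source)
    (hζv : ∀ y ∈ (chartAt EB x₀).source, L.anchor y (ζ y) = chartField x₀ v y)
    (hc : ∀ t ∈ Icc (0 : ℝ) 1, c + t • v ∈ (extChartAt 𝓘(ℝ, EB) x₀).target) :
    L.HamiltonianStep S (FD := FD) (D := D) ⟨(extChartAt 𝓘(ℝ, EB) x₀).symm c, 0⟩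
      ⟨(extChartAt 𝓘(ℝ, EB) x₀).symm (c + v), 0⟩ := by
  have hsrc : ∀ {t : ℝ}, c + t • v ∈ (extChartAt 𝓘(ℝ, EB) x₀).target →
      (extChartAt 𝓘(ℝ, EB) x₀).symm (c + t • v) ∈ (chartAt EB x₀).source := fun ht => by
    have := (extChartAt 𝓘(ℝ, EB) x₀).map_target ht
    rwa [extChartAt_source] at this
  have hU := (chartAt EB x₀).open_source
  have hh := S.isSmoothFunctionOn_linearFunction hζ
  have hline : Continuous fun t : ℝ => c + t • v := by fun_prop
  refine ⟨_, _, {t : ℝ | c + t • v ∈ (extChartAt 𝓘(ℝ, EB) x₀).target},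
    fun t => ⟨(extChartAt 𝓘(ℝ, EB) x₀).symm (c + t • v), 0⟩, SmoothDual.isOpen_proj_preimage hU, hh,
    (isOpen_extChartAt_target x₀).preimage hline, hc, fun t ht => hsrc ht, fun t ht => ?_,
    congrArg (fun z => (⟨(extChartAt 𝓘(ℝ, EB) x₀).symm z, 0⟩ : TotalSpace FD D))
      (by rw [zero_smul, add_zero]),
    congrArg (fun z => (⟨(extChartAt 𝓘(ℝ, EB) x₀).symm z, 0⟩ : TotalSpace FD D))
      (by rw [one_smul])⟩
  have hγ : MDifferentiableAt 𝓘(ℝ, ℝ) (𝓘(ℝ, EB).prod 𝓘(ℝ, FD)) (fun t : ℝ =>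
      (⟨(extChartAt 𝓘(ℝ, EB) x₀).symm (c + t • v), 0⟩ : TotalSpace FD D)) t :=
    ((Bundle.contMDiff_zeroSection (n := ∞) ℝ D).mdifferentiable (by simp) _).comp t
      (hasMFDerivAt_chartLine ht).mdifferentiableAt
  refine ⟨hγ, fun W g hW hgW hg => ?_⟩
  set x := (extChartAt 𝓘(ℝ, EB) x₀).symm (c + t • v)
  have hhd : MDifferentiableAt (𝓘(ℝ, EB).prod 𝓘(ℝ, FD)) 𝓘(ℝ, ℝ) (S.linearFunction ζ) ⟨x, 0⟩ :=
    (hh.1.contMDiffAt ((SmoothDual.isOpen_proj_preimage hU).mem_nhds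
      (hsrc ht))).mdifferentiableAt (by simp)
  refine L.hasDerivAt_poissonBracket_of_linear
    (γ := fun t => ⟨(extChartAt 𝓘(ℝ, EB) x₀).symm (c + t • v), 0⟩) hhd
    (S.hasFiberDifferentialAt_linearFunction ζ _) hγ ?_ (fun b => ?_) hW hgW hg
  · exact (curveVelocity_chartLine ht).trans (hζv _ (hsrc ht)).symm
  · have hb := smoothSectionOn_extend (EB := EB) (FD := F) (D := A) (x := x) b
    have hbU := (trivializationAt F A x).open_baseSet
    have hbx := FiberBundle.mem_baseSet_trivializationAt' (F := F) (E := A) x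
    refine ⟨_, FiberBundle.extend F b, hbU, hbx, hb, FiberBundle.extend_apply_self F b, ?_⟩
    -- With the zero section as extension, the pairing with the bracket and the functions to be
    -- differentiated are all zero.
    have h1 : L.poissonBracket S (S.linearFunction ζ)
        (S.linearFunction (FiberBundle.extend F b)) (⟨x, 0⟩ : TotalSpace FD D) = 0 := by
      rw [L.poissonBracket_linearFunction (s := fun _ => 0)
        (U := (chartAt EB x₀).source ∩ (trivializationAt F A x).baseSet) (ζ := ζ) hhd
        (hU.inter hbU) ⟨hsrc ht, hbx⟩ (hζ.mono inter_subset_left) (hb.mono inter_subset_right)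
        (S.hasFiberDifferentialAt_linearFunction ζ _)
        ((Bundle.contMDiff_zeroSection ℝ D).contMDiffOn) rfl]
      simp [SmoothDual.linearFunction, dirDeriv_const]
    rw [h1]
    refine (hasDerivAt_const t (0 : ℝ)).congr_of_eventuallyEq (Filter.Eventually.of_forall fun s
        => ?_)
    change S.pairing _ (0 : D _) _ = 0
    rw [map_zero]
    rfl

/-- Over a connected base, the points of the zero section are joined by trajectories. -/
theorem reflTransGen_zeroSection [PreconnectedSpace B]
    (hlift : ∀ x₀ : B, ∀ v : EB, ∃ ζ : ∀ x, A x, SmoothSectionOn EB F ζ (chartAt EB x₀).source ∧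
      ∀ y ∈ (chartAt EB x₀).source, L.anchor y (ζ y) = chartField x₀ v y) (x y : B) :
    Relation.ReflTransGen (L.HamiltonianStep S) (⟨x, 0⟩ : TotalSpace FD D) ⟨y, 0⟩ := by
  let R : B → B → Prop := fun x y =>
    Relation.ReflTransGen (L.HamiltonianStep S) (⟨x, 0⟩ : TotalSpace FD D) ⟨y, 0⟩
  -- Reachability in both directions is used so that the relation is symmetric by form, without time
  -- reversal of trajectories.
  have key := isPreconnected_univ.induction₂ (fun x y => R x y ∧ R y x) (fun x₀ _ => ?_)
    (fun x y z _ _ _ h1 h2 => ⟨h1.1.trans h2.1, h2.2.trans h1.2⟩) (fun x y _ _ h => h.symm)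
    (mem_univ x) (mem_univ y)
  · exact key.1
  · obtain ⟨r, hr, hball⟩ := Metric.isOpen_iff.1
      (isOpen_extChartAt_target (I := 𝓘(ℝ, EB)) x₀) _ (mem_extChartAt_target x₀)
    -- The segment between two points of a ball in the chart is traversed in unit time by the
    -- constant field `c' - c`, whose lift to `A` gives the Hamiltonian.
    have hstep : ∀ c ∈ Metric.ball (extChartAt 𝓘(ℝ, EB) x₀ x₀) r,
        ∀ c' ∈ Metric.ball (extChartAt 𝓘(ℝ, EB) x₀ x₀) r,
        R ((extChartAt 𝓘(ℝ, EB) x₀).symm c) ((extChartAt 𝓘(ℝ, EB) x₀).symm c') := by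
      intro c hc c' hc'
      obtain ⟨ζ, hζ, hζv⟩ := hlift x₀ (c' - c)
      have h := L.hamiltonianStep_zeroSection (S := S) (c := c) hζ hζv (fun t ht =>
        hball ((convex_ball (extChartAt 𝓘(ℝ, EB) x₀ x₀) r).add_smul_sub_mem hc hc' ht))
      rw [add_sub_cancel] at h
      exact .single h
    rw [nhdsWithin_univ]
    filter_upwards [(continuousAt_extChartAt x₀).preimage_mem_nhds 
        (Metric.ball_mem_nhds (extChartAt 𝓘(ℝ, EB) x₀ x₀) hr),
      extChartAt_source_mem_nhds (I := 𝓘(ℝ, EB)) x₀] with y hy hys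
    have h1 := hstep _ (Metric.mem_ball_self hr) _ hy
    have h2 := hstep _ hy _ (Metric.mem_ball_self hr)
    rw [extChartAt_to_inv, (extChartAt 𝓘(ℝ, EB) x₀).left_inv hys] at h1 h2
    exact ⟨h1, h2⟩

end LieAlgebroid

namespace InertiaOperator

variable {L : LieAlgebroid EB F A} {S : SmoothDual EB F A FD D} {I : InertiaOperator S}

/-- The horizontal lift of the chart field. Such sections give the Hamiltonians that move the zero
section and the linear functions that test the geodesic equation. -/
theorem exists_section_anchor_eq_chartField [CompleteSpace EB] [CompleteSpace F]
    (hL : L.IsTransitive) (hI : I.IsPositive) (hdec : I.HasOrthogonalDecomposition L) (x₀ : B)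
    (v : EB) : ∃ ζ : ∀ x, A x, SmoothSectionOn EB F ζ (chartAt EB x₀).source ∧
      ∀ y ∈ (chartAt EB x₀).source, L.anchor y (ζ y) = chartField x₀ v y := by
  obtain ⟨σ, hσs, hσ⟩ := exists_horizontalLift hL hI hdec
  refine ⟨fun y => σ y (chartField x₀ v y), fun y hy => ?_, fun y _ => ?_⟩
  · exact ContMDiffWithinAt.clm_bundle_apply (F₁ := EB) (F₂ := F) (E₁ := TangentSpace 𝓘(ℝ, EB))
      (E₂ := A) (b := fun x => x) hσs.contMDiffAt.contMDiffWithinAt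
      (smoothSectionOn_chartField x₀ v y hy)
  · change L.anchor y (σ y _) = _
    rw [hσ, anchor_anchorInv hL hdec]

/-- Over a connected base, the image of the dual of the anchor is a symplectic leaf. -/
theorem symplecticLeaf_eq_dualAnchorImage [CompleteSpace EB] [CompleteSpace F]
    [PreconnectedSpace B] (hL : L.IsTransitive) (hI : I.IsPositive)
    (hdec : I.HasOrthogonalDecomposition L) {ξ : TotalSpace FD D}
    (hξ : ξ ∈ L.dualAnchorImage S) : L.symplecticLeaf S ξ = L.dualAnchorImage S := by
  refine Subset.antisymm (fun η hη => ?_) (fun η hη => ?_)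
  · change Relation.ReflTransGen _ _ _ at hη
    induction hη with
    | refl => exact hξ
    | tail _ h ih =>
      obtain ⟨W, h, J, γ, hW, hh, hJ, hIJ, hγW, hγ, rfl, rfl⟩ := h
      -- The open time set `J` may be disconnected; invariance is applied on the interval from `0`
      -- to `1`.
      exact mem_dualAnchorImage_of_isHamiltonianTrajectory hL hI hdec hW hh hJ hγW hγ hIJ
        isPreconnected_Icc (left_mem_Icc.2 zero_le_one) (right_mem_Icc.2 zero_le_one) ih
  -- The path goes down to the zero section in the fibre of `ξ`, along the zero section, and up in
  -- the fibre of `η`.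
  · have h1 : Relation.ReflTransGen (L.HamiltonianStep S) ξ ⟨ξ.proj, 0⟩ := by
      obtain ⟨p, hp⟩ := hξ
      have h := L.hamiltonianStep_fiber (S := S) ξ.2 (-ξ.2) (q := -p)
        (fun a => by rw [map_neg, neg_apply, hp]; rfl)
      rw [add_neg_cancel] at h
      exact .single h
    have h2 : Relation.ReflTransGen (L.HamiltonianStep S) ⟨η.proj, 0⟩ η := by
      obtain ⟨p, hp⟩ := hη
      have h := L.hamiltonianStep_fiber (S := S) 0 η.2 hp
      rw [zero_add] at h
      exact .single h
    exact (h1.trans (L.reflTransGen_zeroSection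
      (exists_section_anchor_eq_chartField hL hI hdec) _ _)).trans h2

end InertiaOperator

end Leaf

/-! ### The base metric and curves in a chart. -/

section ChartMetric

variable {EB : Type*} [NormedAddCommGroup EB] [NormedSpace ℝ EB]
  {B : Type*} [TopologicalSpace B] [ChartedSpace EB B] [IsManifold 𝓘(ℝ, EB) ∞ B]

namespace RiemannMetric

variable (g : RiemannMetric EB B)

theorem inChart_eq {x₀ : B} {z : EB} (hz : z ∈ (extChartAt 𝓘(ℝ, EB) x₀).target) (v w : EB) :
    g.inChart x₀ z v w = g.form ((extChartAt 𝓘(ℝ, EB) x₀).symm z)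
      (chartField x₀ v ((extChartAt 𝓘(ℝ, EB) x₀).symm z))
      (chartField x₀ w ((extChartAt 𝓘(ℝ, EB) x₀).symm z)) := by
  rw [inChart, mfderiv_extChartAt_symm_apply hz, mfderiv_extChartAt_symm_apply hz]

theorem inChart_extChartAt {x₀ y : B} (hy : y ∈ (chartAt EB x₀).source) (v w : EB) :
    g.inChart x₀ (extChartAt 𝓘(ℝ, EB) x₀ y) v w =
      g.form y (chartField x₀ v y) (chartField x₀ w y) := by
  rw [← extChartAt_source 𝓘(ℝ, EB)] at hy
  rw [inChart_eq g ((extChartAt 𝓘(ℝ, EB) x₀).map_source hy), (extChartAt 𝓘(ℝ, EB) x₀).left_inv hy]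

theorem contMDiffOn_form_chartField (x₀ : B) (v w : EB) :
    ContMDiffOn 𝓘(ℝ, EB) 𝓘(ℝ, ℝ) ∞
      (fun y => g.form y (chartField x₀ v y) (chartField x₀ w y)) (chartAt EB x₀).source := by
  intro y hy
  have : ContMDiffWithinAt 𝓘(ℝ, EB) (𝓘(ℝ, EB).prod 𝓘(ℝ, ℝ)) ∞
      (fun y : B => TotalSpace.mk' ℝ (E := Bundle.Trivial B ℝ) y
        (g.form y (chartField x₀ v y) (chartField x₀ w y))) (chartAt EB x₀).source y := by
    apply ContMDiffWithinAt.clm_bundle_apply₂ (F₁ := EB) (F₂ := EB)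
    · exact g.contMDiff.contMDiffAt.contMDiffWithinAt
    · exact smoothSectionOn_chartField x₀ v y hy
    · exact smoothSectionOn_chartField x₀ w y hy
  exact (contMDiffWithinAt_totalSpace.1 this).2

/-- Matches the derivative on `B` produced by the Poisson bracket with the coordinate derivative of
the metric in the Euler-Lagrange equation. -/
theorem dirDeriv_form_chartField {x₀ : B} (c v : EB) :
    dirDeriv (chartField x₀ v x₀) (fun y => g.form y (chartField x₀ c y) (chartField x₀ c y)) =
      fderiv ℝ (fun z => g.inChart x₀ z c c) (extChartAt 𝓘(ℝ, EB) x₀ x₀) v := by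
  have hx := mem_chart_source EB x₀
  have h1 : MDifferentiableAt 𝓘(ℝ, EB) 𝓘(ℝ, ℝ) (fun z => g.inChart x₀ z c c)
      (extChartAt 𝓘(ℝ, EB) x₀ x₀) := by
    have h2 : ContMDiffAt 𝓘(ℝ, EB) 𝓘(ℝ, ℝ) ∞
        (fun y => g.form y (chartField x₀ c y) (chartField x₀ c y))
        ((extChartAt 𝓘(ℝ, EB) x₀).symm (extChartAt 𝓘(ℝ, EB) x₀ x₀)) := by
      rw [extChartAt_to_inv]
      exact (g.contMDiffOn_form_chartField x₀ c c).contMDiffAt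
        ((chartAt EB x₀).open_source.mem_nhds hx)
    have h3 := h2.comp _ ((contMDiffOn_extChartAt_symm (n := ∞) x₀).contMDiffAt
      (extChartAt_target_mem_nhds (I := 𝓘(ℝ, EB)) x₀))
    refine (h3.mdifferentiableAt (by simp)).congr_of_eventuallyEq ?_
    filter_upwards [extChartAt_target_mem_nhds (I := 𝓘(ℝ, EB)) x₀] with z hz
    exact g.inChart_eq hz c c
  have h2 : dirDeriv (chartField x₀ v x₀)
      (fun y => g.form y (chartField x₀ c y) (chartField x₀ c y)) =
      dirDeriv (chartField x₀ v x₀)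
        ((fun z => g.inChart x₀ z c c) ∘ extChartAt 𝓘(ℝ, EB) x₀) := by
    refine dirDeriv_congr _ ?_
    filter_upwards [(chartAt EB x₀).open_source.mem_nhds hx] with y hy
    exact (g.inChart_extChartAt hy c c).symm
  rw [h2, dirDeriv, (h1.hasMFDerivAt.comp x₀ (mdifferentiableAt_extChartAt
      hx).hasMFDerivAt).mfderiv]
  change mfderiv 𝓘(ℝ, EB) 𝓘(ℝ, ℝ) (fun z => g.inChart x₀ z c c) (extChartAt 𝓘(ℝ, EB) x₀ x₀)
    (mfderiv 𝓘(ℝ, EB) 𝓘(ℝ, EB) (extChartAt 𝓘(ℝ, EB) x₀) x₀ (chartField x₀ v x₀)) = _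
  rw [mfderiv_extChartAt_chartField hx, mfderiv_eq_fderiv]
  rfl

end RiemannMetric

theorem hasDerivAt_extChartAt_comp_curve {x₀ : B} {x : ℝ → B} {t : ℝ}
    (hx : MDifferentiableAt 𝓘(ℝ, ℝ) 𝓘(ℝ, EB) x t) (ht : x t ∈ (chartAt EB x₀).source) :
    HasDerivAt (fun s => extChartAt 𝓘(ℝ, EB) x₀ (x s))
      (mfderiv 𝓘(ℝ, EB) 𝓘(ℝ, EB) (extChartAt 𝓘(ℝ, EB) x₀) (x t) (curveVelocity EB x t)) t := by
  have h : HasFDerivAt (fun s => extChartAt 𝓘(ℝ, EB) x₀ (x s)) (show ℝ →L[ℝ] EB from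
      (mfderiv 𝓘(ℝ, EB) 𝓘(ℝ, EB) (extChartAt 𝓘(ℝ, EB) x₀) (x t)).comp
        (mfderiv 𝓘(ℝ, ℝ) 𝓘(ℝ, EB) x t)) t :=
    ((mdifferentiableAt_extChartAt ht).hasMFDerivAt.comp t hx.hasMFDerivAt).hasFDerivAt
  exact h.hasDerivAt

theorem dirDeriv_chartField_functional {x₀ y : B} (hy : y ∈ (chartAt EB x₀).source) (v : EB)
    (l : EB →L[ℝ] ℝ) :
    dirDeriv (chartField x₀ v y) (fun y => l (extChartAt 𝓘(ℝ, EB) x₀ y)) = l v :=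
  (dirDeriv_clm_comp _ (mdifferentiableAt_extChartAt hy) l).trans
    (congrArg l (mfderiv_extChartAt_chartField hy v))

end ChartMetric

/-! ### The Euler-Arnold bracket as the geodesic right-hand side. -/

section Geodesic

variable {EB : Type*} [NormedAddCommGroup EB] [NormedSpace ℝ EB]
  {B : Type*} [TopologicalSpace B] [ChartedSpace EB B] [IsManifold 𝓘(ℝ, EB) ∞ B]
  {F : Type*} [NormedAddCommGroup F] [NormedSpace ℝ F]
  {A : B → Type*} [∀ x, AddCommGroup (A x)] [∀ x, Module ℝ (A x)]
  [∀ x, TopologicalSpace (A x)] [∀ x, IsTopologicalAddGroup (A x)]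
  [∀ x, ContinuousSMul ℝ (A x)]
  [TopologicalSpace (TotalSpace F A)] [FiberBundle F A] [VectorBundle ℝ F A]
  [ContMDiffVectorBundle ∞ F A 𝓘(ℝ, EB)]
  {FD : Type*} [NormedAddCommGroup FD] [NormedSpace ℝ FD]
  {D : B → Type*} [∀ x, AddCommGroup (D x)] [∀ x, Module ℝ (D x)]
  [∀ x, TopologicalSpace (D x)]
  [TopologicalSpace (TotalSpace FD D)] [FiberBundle FD D] [VectorBundle ℝ FD D]
  [ContMDiffVectorBundle ∞ FD D 𝓘(ℝ, EB)]

namespace LieAlgebroid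

/-- The bracket of sections whose images under the anchor are constant in a chart is in the
kernel of the anchor. -/
theorem anchor_bracket_eq_zero_of_chartField (L : LieAlgebroid EB F A) (hL : L.IsTransitive)
    {x₀ : B} {u v : EB} {ζ η : ∀ x, A x} {U : Set B} (hU : IsOpen U)
    (hUs : U ⊆ (chartAt EB x₀).source) (hζ : SmoothSectionOn EB F ζ U)
    (hη : SmoothSectionOn EB F η U) (hζu : ∀ y ∈ U, L.anchor y (ζ y) = chartField x₀ u y)
    (hηv : ∀ y ∈ U, L.anchor y (η y) = chartField x₀ v y) {x : B} (hx : x ∈ U) :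
    L.anchor x (L.bracket ζ η x) = 0 := by
  have hc : ∀ l : EB →L[ℝ] ℝ, ContMDiffOn 𝓘(ℝ, EB) 𝓘(ℝ, ℝ) ∞
      (fun y => l (extChartAt 𝓘(ℝ, EB) x₀ y)) U := fun l =>
    l.contMDiff.comp_contMDiffOn (contMDiffOn_extChartAt.mono hUs)
  -- Both fields differentiate a linear coordinate to a constant, so each term of the commutator
  -- vanishes on it.
  have hz : ∀ l : EB →L[ℝ] ℝ, dirDeriv (L.anchor x (L.bracket ζ η x))
      (fun y => l (extChartAt 𝓘(ℝ, EB) x₀ y)) = 0 := by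
    intro l
    rw [L.dirDeriv_anchor_bracket hL hU hζ hη (hc l) hx]
    have h1 : ∀ {w : EB} {θ : ∀ x, A x} (_ : ∀ y ∈ U, L.anchor y (θ y) = chartField x₀ w y),
        (fun y => dirDeriv (L.anchor y (θ y)) (fun y => l (extChartAt 𝓘(ℝ, EB) x₀ y))) =ᶠ[𝓝 x]
          fun _ => l w := fun h => by
      filter_upwards [hU.mem_nhds hx] with y hy
      rw [h y hy, dirDeriv_chartField_functional (hUs hy)]
    rw [dirDeriv_congr _ (h1 hηv), dirDeriv_congr _ (h1 hζu), dirDeriv_const, dirDeriv_const,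
      sub_zero]
  refine (isInvertible_mfderiv_extChartAt (I := 𝓘(ℝ, EB)) (x := x₀)
    ((extChartAt_source 𝓘(ℝ, EB) x₀).symm ▸ hUs hx)).injective ?_
  rw [map_zero]
  refine (SeparatingDual.eq_iff_forall_dual_eq (R := ℝ) (V := EB)).2 fun l => ?_
  exact ((dirDeriv_clm_comp _ (mdifferentiableAt_extChartAt (hUs hx)) l).symm.trans (hz l)).trans
    (map_zero l).symm

end LieAlgebroid

namespace InertiaOperator

variable {L : LieAlgebroid EB F A} {S : SmoothDual EB F A FD D} {I : InertiaOperator S}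

/-- The Poisson bracket of the Euler-Arnold Hamiltonian with a linear function, at a point of the
image of the dual of the anchor, is the right-hand side of the geodesic equation. -/
theorem poissonBracket_hamiltonian_linearFunction [CompleteSpace EB] [CompleteSpace F]
    (hL : L.IsTransitive) (hI : I.IsPositive) (hdec : I.HasOrthogonalDecomposition L)
    {g : RiemannMetric EB B} (hg : ∀ x (ζ η : TangentSpace 𝓘(ℝ, EB) x),
      g.form x ζ η = I.metric (I.anchorInv L x ζ) (I.anchorInv L x η))
    {ξ : TotalSpace FD D} (hξ : (I.toEquiv ξ.proj).symm ξ.2 ∈ I.horizontal L ξ.proj)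
    {U : Set B} (hU : IsOpen U) (hx : ξ.proj ∈ U) (hUs : U ⊆ (chartAt EB ξ.proj).source)
    {η : ∀ x, A x} (hη : SmoothSectionOn EB F η U) {v : EB}
    (hηv : ∀ y ∈ U, L.anchor y (η y) = chartField ξ.proj v y) {c : EB}
    (hc : chartField ξ.proj c ξ.proj = L.anchor ξ.proj ((I.toEquiv ξ.proj).symm ξ.2)) :
    L.poissonBracket S I.hamiltonian (S.linearFunction η) ξ =
      1 / 2 * fderiv ℝ (fun z => g.inChart ξ.proj z c c)
        (extChartAt 𝓘(ℝ, EB) ξ.proj ξ.proj) v := by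
  obtain ⟨x₀, ξ₀⟩ := ξ
  dsimp only at *
  obtain ⟨σ, hσs, hσ⟩ := exists_horizontalLift hL hI hdec
  -- The horizontal lift of `c` extends the fibre differential `I⁻¹ ξ`, and `s = I ζ` extends `ξ`.
  -- With these extensions both terms of the bracket simplify.
  let ζ : ∀ x, A x := fun y => σ y (chartField x₀ c y)
  have hζ : SmoothSectionOn EB F ζ U := fun y hy =>
    ContMDiffWithinAt.clm_bundle_apply (F₁ := EB) (F₂ := F) (E₁ := TangentSpace 𝓘(ℝ, EB))
      (E₂ := A) (b := fun x => x) hσs.contMDiffAt.contMDiffWithinAt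
      ((smoothSectionOn_chartField x₀ c y (hUs hy)).mono hUs)
  have hζx : ζ x₀ = (I.toEquiv x₀).symm ξ₀ := by
    change σ x₀ (chartField x₀ c x₀) = _
    rw [hσ]
    exact anchorInv_eq hL hI hdec hξ hc.symm
  have hζc : ∀ y ∈ U, L.anchor y (ζ y) = chartField x₀ c y := fun y _ => by
    change L.anchor y (σ y _) = _
    rw [hσ, anchor_anchorInv hL hdec]
  let s : ∀ x, D x := fun y => I.toEquiv y (ζ y)
  have hs : SmoothSectionOn EB FD s U := I.contMDiff.comp_contMDiffOn hζ
  have hsx : s x₀ = ξ₀ := by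
    change I.toEquiv x₀ (ζ x₀) = _
    rw [hζx, ContinuousLinearEquiv.apply_symm_apply]
  have hHd : MDifferentiableAt (𝓘(ℝ, EB).prod 𝓘(ℝ, FD)) 𝓘(ℝ, ℝ) I.hamiltonian ⟨x₀, ξ₀⟩ :=
    (I.isSmoothFunctionOn_hamiltonian.1.contMDiffAt Filter.univ_mem).mdifferentiableAt (by simp)
  have hHa : S.HasFiberDifferentialAt I.hamiltonian ⟨x₀, ξ₀⟩ (ζ x₀) := by
    have := I.hasFiberDifferentialAt_hamiltonian ⟨x₀, ξ₀⟩
    rwa [← hζx] at this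
  rw [L.poissonBracket_linearFunction hHd hU hx hζ hη hHa hs hsx]
  -- The bracket covers that of two constant chart fields, so it lies in `Ker #`, to which `I⁻¹ ξ`
  -- is orthogonal.
  have h0 : S.pairing x₀ ξ₀ (L.bracket ζ η x₀) = 0 := by
    have h1 := hξ _ (L.anchor_bracket_eq_zero_of_chartField hL hU hUs hζ hη hζc hηv hx)
    rwa [metric, ContinuousLinearEquiv.apply_symm_apply] at h1
  -- Along `s` the energy is half of `⟨s, ζ⟩ = g(c, c)`; subtracting the whole pairing leaves minus
  -- one half.
  have h2 : (fun y => I.hamiltonian ⟨y, s y⟩ - S.pairing y (s y) (ζ y)) =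
      fun y => (-(1 / 2) : ℝ) * g.form y (chartField x₀ c y) (chartField x₀ c y) := by
    funext y
    have h3 : g.form y (chartField x₀ c y) (chartField x₀ c y) = S.pairing y (s y) (ζ y) := by
      rw [hg, ← hσ]; rfl
    have h4 : (I.toEquiv y).symm (s y) = ζ y := (I.toEquiv y).symm_apply_apply _
    rw [hamiltonian_eq, h3]
    dsimp only
    rw [h4]
    ring
  rw [h0, h2, hηv _ hx, dirDeriv_const_mul, g.dirDeriv_form_chartField]
  · ring
  · exact ((g.contMDiffOn_form_chartField x₀ c c).contMDiffAt
      ((chartAt EB x₀).open_source.mem_nhds (hUs hx))).mdifferentiableAt (by simp)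

end InertiaOperator

end Geodesic

/-! ### Equivalence of Euler-Arnold and geodesic trajectories. -/

section GeodesicFlow

variable {EB : Type*} [NormedAddCommGroup EB] [NormedSpace ℝ EB]
  {B : Type*} [TopologicalSpace B] [ChartedSpace EB B] [IsManifold 𝓘(ℝ, EB) ∞ B]
  {F : Type*} [NormedAddCommGroup F] [NormedSpace ℝ F]
  {A : B → Type*} [∀ x, AddCommGroup (A x)] [∀ x, Module ℝ (A x)]
  [∀ x, TopologicalSpace (A x)] [∀ x, IsTopologicalAddGroup (A x)]
  [∀ x, ContinuousSMul ℝ (A x)]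
  [TopologicalSpace (TotalSpace F A)] [FiberBundle F A] [VectorBundle ℝ F A]
  [ContMDiffVectorBundle ∞ F A 𝓘(ℝ, EB)]
  {FD : Type*} [NormedAddCommGroup FD] [NormedSpace ℝ FD]
  {D : B → Type*} [∀ x, AddCommGroup (D x)] [∀ x, Module ℝ (D x)]
  [∀ x, TopologicalSpace (D x)]
  [TopologicalSpace (TotalSpace FD D)] [FiberBundle FD D] [VectorBundle ℝ FD D]
  [ContMDiffVectorBundle ∞ FD D 𝓘(ℝ, EB)]

namespace InertiaOperator

variable {L : LieAlgebroid EB F A} {S : SmoothDual EB F A FD D} {I : InertiaOperator S}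

theorem symm_mem_horizontal {x : B} {ξ : D x} {p : TangentSpace 𝓘(ℝ, EB) x →L[ℝ] ℝ}
    (hp : ∀ a, S.pairing x ξ a = p (L.anchor x a)) :
    (I.toEquiv x).symm ξ ∈ I.horizontal L x := fun k hk => by
  rw [metric, ContinuousLinearEquiv.apply_symm_apply, hp, hk, map_zero]

/-- Here `I⁻¹ ξ` is horizontal, hence is the lift of `u`; testing `p` on `w` amounts to pairing `ξ`
with the lift of `w`. -/
theorem eq_form_of_anchor_symm_eq (hL : L.IsTransitive) (hI : I.IsPositive)
    (hdec : I.HasOrthogonalDecomposition L)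
    {g : RiemannMetric EB B} (hg : ∀ x (ζ η : TangentSpace 𝓘(ℝ, EB) x),
      g.form x ζ η = I.metric (I.anchorInv L x ζ) (I.anchorInv L x η))
    {x : B} {ξ : D x} {p : TangentSpace 𝓘(ℝ, EB) x →L[ℝ] ℝ}
    (hp : ∀ a, S.pairing x ξ a = p (L.anchor x a)) {u : TangentSpace 𝓘(ℝ, EB) x}
    (hu : u = L.anchor x ((I.toEquiv x).symm ξ)) : p = g.form x u := by
  ext w
  rw [hg, anchorInv_eq hL hI hdec (symm_mem_horizontal hp) hu.symm, metric,
    ContinuousLinearEquiv.apply_symm_apply, hp, anchor_anchorInv hL hdec]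

/-- The lift of `u` is orthogonal to `a - #⁻¹ (# a)`, so `ξ` and the image of the lift under `I`
pair equally with every `a`. Nondegeneracy of the pairing does the rest. -/
theorem symm_eq_anchorInv_of_eq_form (hL : L.IsTransitive)
    (hdec : I.HasOrthogonalDecomposition L)
    {g : RiemannMetric EB B} (hg : ∀ x (ζ η : TangentSpace 𝓘(ℝ, EB) x),
      g.form x ζ η = I.metric (I.anchorInv L x ζ) (I.anchorInv L x η))
    {x : B} {ξ : D x} {u : TangentSpace 𝓘(ℝ, EB) x}
    (hp : ∀ a, S.pairing x ξ a = g.form x u (L.anchor x a)) :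
    (I.toEquiv x).symm ξ = I.anchorInv L x u := by
  rw [ContinuousLinearEquiv.symm_apply_eq, ← sub_eq_zero]
  refine S.eq_zero_of_left x _ fun a => ?_
  have h1 := anchorInv_mem (I := I) hL hdec u (a - I.anchorInv L x (L.anchor x a))
    (by rw [map_sub, anchor_anchorInv hL hdec, sub_self])
  rw [metric, map_sub, sub_eq_zero] at h1
  rw [map_sub, sub_apply, hp, hg, h1, metric, sub_self]

variable {g : RiemannMetric EB B} {x : ℝ → B} {p : ∀ t, TangentSpace 𝓘(ℝ, EB) (x t) →L[ℝ] ℝ}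
  {ξ : ∀ t, D (x t)} {J : Set ℝ}

/-- The momentum of a curve along a chart field is given by a linear function on the dual
bundle. -/
theorem linearFunction_eventuallyEq_inChart (hJ : IsOpen J)
    (hξ : ∀ t ∈ J, ∀ a : A (x t), S.pairing (x t) (ξ t) a = p t (L.anchor (x t) a))
    (hx : ∀ t ∈ J, MDifferentiableAt 𝓘(ℝ, ℝ) 𝓘(ℝ, EB) x t)
    (hpg : ∀ t ∈ J, p t = g.form (x t) (curveVelocity EB x t)) {t : ℝ} (ht : t ∈ J)
    {U : Set B} (hU : IsOpen U) (htU : x t ∈ U) (hUs : U ⊆ (chartAt EB (x t)).source)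
    {η : ∀ x, A x} {v : EB} (hηv : ∀ y ∈ U, L.anchor y (η y) = chartField (x t) v y) :
    (fun s => S.linearFunction η (⟨x s, ξ s⟩ : TotalSpace FD D)) =ᶠ[𝓝 t]
      fun s => g.inChart (x t) (extChartAt 𝓘(ℝ, EB) (x t) (x s))
        (deriv (fun s => extChartAt 𝓘(ℝ, EB) (x t) (x s)) s) v := by
  filter_upwards [hJ.mem_nhds ht, (hx t ht).continuousAt.preimage_mem_nhds (hU.mem_nhds htU)]
    with s hs hsU
  have h1 : chartField (x t) (deriv (fun s => extChartAt 𝓘(ℝ, EB) (x t) (x s)) s) (x s) =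
      curveVelocity EB x s := by
    rw [(hasDerivAt_extChartAt_comp_curve (hx s hs) (hUs hsU)).deriv]
    exact chartField_mfderiv_extChartAt (hUs hsU) (curveVelocity EB x s)
  rw [g.inChart_extChartAt (hUs hsU), h1]
  change S.pairing (x s) (ξ s) (η (x s)) = _
  rw [hξ s hs, hηv _ hsU, hpg s hs]

/-- Base functions in Hamilton's equation give `x' = # I⁻¹ ξ`, hence `p = g(x', ·)`; linear
functions of lifted chart fields give the Euler-Lagrange equation. -/
theorem isGeodesicFlowTrajectory_of_isEulerArnoldTrajectory [CompleteSpace EB] [CompleteSpace F]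
    (hL : L.IsTransitive) (hI : I.IsPositive) (hdec : I.HasOrthogonalDecomposition L)
    (hg : ∀ x (ζ η : TangentSpace 𝓘(ℝ, EB) x),
      g.form x ζ η = I.metric (I.anchorInv L x ζ) (I.anchorInv L x η)) (hJ : IsOpen J)
    (hξ : ∀ t ∈ J, ∀ a : A (x t), S.pairing (x t) (ξ t) a = p t (L.anchor (x t) a))
    (h : I.IsEulerArnoldTrajectory L (fun t => ⟨x t, ξ t⟩) J) :
    g.IsGeodesicFlowTrajectory x p J := by
  have hHd : ∀ ζ : TotalSpace FD D,
      MDifferentiableAt (𝓘(ℝ, EB).prod 𝓘(ℝ, FD)) 𝓘(ℝ, ℝ) I.hamiltonian ζ := fun ζ =>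
    (I.isSmoothFunctionOn_hamiltonian.1.contMDiffAt Filter.univ_mem).mdifferentiableAt (by simp)
  have hx : ∀ t ∈ J, MDifferentiableAt 𝓘(ℝ, ℝ) 𝓘(ℝ, EB) x t := fun t ht =>
    MDifferentiableAt.comp (g := π FD D) (f := fun t => (⟨x t, ξ t⟩ : TotalSpace FD D)) t
      ((Bundle.contMDiff_proj (n := ∞) (IB := 𝓘(ℝ, EB)) (F := FD) D).mdifferentiable (by simp) _)
      (h t ht).1
  have hv : ∀ t ∈ J, curveVelocity EB x t = L.anchor (x t) ((I.toEquiv (x t)).symm (ξ t)) :=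
    fun t ht => L.curveVelocity_eq_anchor (γ := fun t => (⟨x t, ξ t⟩ : TotalSpace FD D)) (hHd _)
      (I.hasFiberDifferentialAt_hamiltonian _) (h t ht).1 (h t ht).2
  have hpg : ∀ t ∈ J, p t = g.form (x t) (curveVelocity EB x t) := fun t ht =>
    eq_form_of_anchor_symm_eq hL hI hdec hg (hξ t ht) (hv t ht)
  refine ⟨⟨hx, fun t ht => ?_, fun t ht v => ?_⟩, hpg⟩
  -- The velocity is the image of the trajectory under the smooth map `# ∘ I⁻¹`, which yields the
  -- second derivative of `x`.
  · have h1 : ContMDiff (𝓘(ℝ, EB).prod 𝓘(ℝ, FD)) 𝓘(ℝ, EB).tangent ∞ (fun ζ : TotalSpace FD D =>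
        (⟨ζ.proj, L.anchor ζ.proj ((I.toEquiv ζ.proj).symm ζ.2)⟩ : TangentBundle 𝓘(ℝ, EB) B)) :=
      fun ζ => ContMDiffAt.clm_bundle_apply (F₁ := F) (F₂ := EB) (E₁ := A)
        (E₂ := TangentSpace 𝓘(ℝ, EB)) (b := fun ζ : TotalSpace FD D => ζ.proj)
        (L.contMDiff_anchor.contMDiffAt.comp ζ (Bundle.contMDiff_proj (n := ∞) D).contMDiffAt)
        I.contMDiff_symm.contMDiffAt
    refine ((h1.mdifferentiable (by simp) (⟨x t, ξ t⟩ : TotalSpace FD D)).comp t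
      (h t ht).1).congr_of_eventuallyEq ?_
    filter_upwards [hJ.mem_nhds ht] with s hs
    rw [hv s hs]
    rfl
  · intro c
    obtain ⟨η, hη, hηv⟩ := exists_section_anchor_eq_chartField hL hI hdec (x t) v
    have hU := (chartAt EB (x t)).open_source
    have hxt := mem_chart_source EB (x t)
    have h1 := (h t ht).2 _ _ (SmoothDual.isOpen_proj_preimage hU) hxt
      (S.isSmoothFunctionOn_linearFunction hη)
    have hc : deriv c t = mfderiv 𝓘(ℝ, EB) 𝓘(ℝ, EB) (extChartAt 𝓘(ℝ, EB) (x t)) (x t)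
        (curveVelocity EB x t) := (hasDerivAt_extChartAt_comp_curve (hx t ht) hxt).deriv
    rw [poissonBracket_hamiltonian_linearFunction hL hI hdec hg (ξ := ⟨x t, ξ t⟩)
      (symm_mem_horizontal (hξ t ht)) hU hxt subset_rfl hη hηv (c := deriv c t)
      (by
        rw [hc]
        exact (chartField_mfderiv_extChartAt hxt _).trans (hv t ht))] at h1
    exact h1.congr_of_eventuallyEq
      (linearFunction_eventuallyEq_inChart hJ hξ hx hpg ht hU hxt subset_rfl hηv).symm

/-- The covector relation forces `ξ` to be `I` of the horizontal lift of `x'`, so twice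
differentiability of `x` gives differentiability of `ξ`. Hamilton's equation then needs checking on
one linear function through each fibre element. -/
theorem isEulerArnoldTrajectory_of_isGeodesicFlowTrajectory [CompleteSpace EB] [CompleteSpace F]
    (hL : L.IsTransitive) (hI : I.IsPositive) (hdec : I.HasOrthogonalDecomposition L)
    (hg : ∀ x (ζ η : TangentSpace 𝓘(ℝ, EB) x),
      g.form x ζ η = I.metric (I.anchorInv L x ζ) (I.anchorInv L x η)) (hJ : IsOpen J)
    (hξ : ∀ t ∈ J, ∀ a : A (x t), S.pairing (x t) (ξ t) a = p t (L.anchor (x t) a))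
    (h : g.IsGeodesicFlowTrajectory x p J) :
    I.IsEulerArnoldTrajectory L (fun t => ⟨x t, ξ t⟩) J := by
  obtain ⟨⟨hx, hx', hel⟩, hpg⟩ := h
  obtain ⟨σ, hσs, hσ⟩ := exists_horizontalLift hL hI hdec
  have ha : ∀ t ∈ J, (I.toEquiv (x t)).symm (ξ t) = σ (x t) (curveVelocity EB x t) :=
    fun t ht => by
      rw [hσ]
      exact symm_eq_anchorInv_of_eq_form hL hdec hg (fun a => by rw [hξ t ht, hpg t ht])
  have hv : ∀ t ∈ J, curveVelocity EB x t = L.anchor (x t) ((I.toEquiv (x t)).symm (ξ t)) :=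
    fun t ht => by rw [ha t ht, hσ, anchor_anchorInv hL hdec]
  intro t ht
  have hγ : MDifferentiableAt 𝓘(ℝ, ℝ) (𝓘(ℝ, EB).prod 𝓘(ℝ, FD))
      (fun t => (⟨x t, ξ t⟩ : TotalSpace FD D)) t := by
    have h1 : ContMDiff 𝓘(ℝ, EB).tangent (𝓘(ℝ, EB).prod 𝓘(ℝ, FD)) ∞
        (fun v : TangentBundle 𝓘(ℝ, EB) B => TotalSpace.mk' FD v.1 (I.toEquiv v.1 (σ v.1 v.2))) :=
      I.contMDiff.comp (g := fun v : TotalSpace F A => TotalSpace.mk' FD v.1 (I.toEquiv v.1 v.2))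
        (f := fun v : TangentBundle 𝓘(ℝ, EB) B => TotalSpace.mk' F v.1 (σ v.1 v.2))
        fun v => ContMDiffAt.clm_bundle_apply (F₁ := EB) (F₂ := F)
          (E₁ := TangentSpace 𝓘(ℝ, EB)) (E₂ := A)
          (b := fun v : TangentBundle 𝓘(ℝ, EB) B => v.1) (ϕ := fun v => σ v.1) (v := fun v => v.2)
          ((hσs v.1).comp v (Bundle.contMDiff_proj (n := ∞) _ v)) contMDiffAt_id
    refine ((h1.mdifferentiable (by simp) _).comp t (hx' t ht)).congr_of_eventuallyEq ?_
    filter_upwards [hJ.mem_nhds ht] with s hs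
    change (⟨x s, ξ s⟩ : TotalSpace FD D) =
      ⟨x s, I.toEquiv (x s) (σ (x s) (curveVelocity EB x s))⟩
    rw [← ha s hs, ContinuousLinearEquiv.apply_symm_apply]
  refine ⟨hγ, fun W f hW hγW hf => ?_⟩
  refine L.hasDerivAt_poissonBracket_of_linear (γ := fun t => (⟨x t, ξ t⟩ : TotalSpace FD D))
    ((I.isSmoothFunctionOn_hamiltonian.1.contMDiffAt Filter.univ_mem).mdifferentiableAt (by simp))
    (I.hasFiberDifferentialAt_hamiltonian _) hγ (hv t ht) (fun b => ?_) hW hγW hf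
  obtain ⟨P, hPs, hP⟩ := id hdec
  change A (x t) at b
  set e := trivializationAt F A (x t)
  have hxt := mem_chart_source EB (x t)
  have hxe : x t ∈ e.baseSet := FiberBundle.mem_baseSet_trivializationAt' (x t)
  have hU : IsOpen ((chartAt EB (x t)).source ∩ e.baseSet) :=
    (chartAt EB (x t)).open_source.inter e.open_baseSet
  set v : EB := mfderiv 𝓘(ℝ, EB) 𝓘(ℝ, EB) (extChartAt 𝓘(ℝ, EB) (x t)) (x t) (L.anchor (x t) b)
  have hvb : chartField (x t) v (x t) = L.anchor (x t) b := chartField_mfderiv_extChartAt hxt _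
  -- A section through an arbitrary `b` whose anchor is constant in the chart: an extension of the
  -- component in `Ker #` plus the lift of the chart field with value `# b`.
  let η₁ : ∀ y, A y := fun y => P y (FiberBundle.extend F b y)
  let η₂ : ∀ y, A y := fun y => σ y (chartField (x t) v y)
  have hη₁ : SmoothSectionOn EB F η₁ ((chartAt EB (x t)).source ∩ e.baseSet) := fun y hy =>
    ContMDiffWithinAt.clm_bundle_apply (F₁ := F) (F₂ := F) (E₁ := A) (E₂ := A) (b := fun x => x)
      hPs.contMDiffAt.contMDiffWithinAt ((smoothSectionOn_extend b y hy.2).mono inter_subset_right)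
  have hη₂ : SmoothSectionOn EB F η₂ ((chartAt EB (x t)).source ∩ e.baseSet) := fun y hy =>
    ContMDiffWithinAt.clm_bundle_apply (F₁ := EB) (F₂ := F) (E₁ := TangentSpace 𝓘(ℝ, EB))
      (E₂ := A) (b := fun x => x) hσs.contMDiffAt.contMDiffWithinAt
      ((smoothSectionOn_chartField (x t) v y hy.1).mono inter_subset_left)
  have hη : SmoothSectionOn EB F (fun y => η₁ y + η₂ y)
      ((chartAt EB (x t)).source ∩ e.baseSet) := fun y hy =>
    ContMDiffWithinAt.add_section (hη₁ y hy) (hη₂ y hy)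
  have hηv : ∀ y, L.anchor y (η₁ y + η₂ y) = chartField (x t) v y := fun y => by
    change L.anchor y (P y _ + σ y _) = _
    rw [map_add, (hP y _).1, hσ, anchor_anchorInv hL hdec, zero_add]
  have hηb : η₁ (x t) + η₂ (x t) = b := by
    change P (x t) (FiberBundle.extend F b (x t)) + σ (x t) (chartField (x t) v (x t)) = b
    rw [FiberBundle.extend_apply_self, hvb, hσ, anchorInv_eq hL hI hdec (hP _ b).2
      (by rw [map_sub, (hP _ b).1, sub_zero]), add_sub_cancel]
  refine ⟨_, _, hU, ⟨hxt, hxe⟩, hη, hηb, ?_⟩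
  have hc := (hasDerivAt_extChartAt_comp_curve (hx t ht) hxt).deriv
  rw [poissonBracket_hamiltonian_linearFunction hL hI hdec hg (ξ := ⟨x t, ξ t⟩)
    (symm_mem_horizontal (hξ t ht)) hU ⟨hxt, hxe⟩ inter_subset_left hη (fun y _ => hηv y)
    (c := deriv (fun s => extChartAt 𝓘(ℝ, EB) (x t) (x s)) t)
    (by
      rw [hc]
      exact (chartField_mfderiv_extChartAt hxt _).trans (hv t ht))]
  exact (hel t ht v).congr_of_eventuallyEq
    (linearFunction_eventuallyEq_inChart hJ hξ hx hpg ht hU ⟨hxt, hxe⟩ inter_subset_left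
      (fun y _ => hηv y))

end InertiaOperator

end GeodesicFlow

/-! ### Velocities of curves and fibres of submersions. -/

section Velocity

variable {E : Type*} [NormedAddCommGroup E] [NormedSpace ℝ E]
  {M : Type*} [TopologicalSpace M] [ChartedSpace E M]
  {E' : Type*} [NormedAddCommGroup E'] [NormedSpace ℝ E']
  {M' : Type*} [TopologicalSpace M'] [ChartedSpace E' M']

/-- The curve `c` passes through `g` at time `0` with velocity `v`. -/
def HasVelocity (c : ℝ → M) (g : M) (v : TangentSpace 𝓘(ℝ, E) g) : Prop :=
  c 0 = g ∧ ∃ d : ℝ →L[ℝ] E, HasMFDerivAt 𝓘(ℝ, ℝ) 𝓘(ℝ, E) c 0 d ∧ d 1 = v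

namespace HasVelocity

variable {c c' : ℝ → M} {g : M} {v w : TangentSpace 𝓘(ℝ, E) g}

theorem congr (h : HasVelocity c g v) (hc : c' =ᶠ[𝓝 0] c) : HasVelocity c' g v := by
  obtain ⟨h0, d, hd, hv⟩ := h
  exact ⟨hc.self_of_nhds.trans h0, d, hd.congr_of_eventuallyEq hc, hv⟩

theorem unique (h : HasVelocity c g v) (h' : HasVelocity c g w) : v = w := by
  obtain ⟨-, d, hd, rfl⟩ := h
  obtain ⟨-, d', hd', rfl⟩ := h'
  exact DFunLike.congr_fun (hasMFDerivAt_unique hd hd') (1 : ℝ)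

theorem const (x : M) : HasVelocity (fun _ : ℝ => x) x (0 : TangentSpace 𝓘(ℝ, E) x) :=
  ⟨rfl, 0, hasMFDerivAt_const x (0 : ℝ), rfl⟩

theorem cast (h : HasVelocity c g v) {g' : M} (hg : g = g') : HasVelocity c g' (hg ▸ v) := by
  subst hg
  exact h

/-- For a vector tangent to a curve inside `s`, the value of `mfderivWithin` is pinned down by the
image curve; unique differentiability of `s`, which fails for source fibres in general, is not
needed. -/
theorem comp_within {f : M → M'} {s : Set M} (h : HasVelocity c g v)
    (hf : MDifferentiableWithinAt 𝓘(ℝ, E) 𝓘(ℝ, E') f s g) (hs : ∀ᶠ t in 𝓝 0, c t ∈ s) :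
    HasVelocity (fun t => f (c t)) (f g) (mfderivWithin 𝓘(ℝ, E) 𝓘(ℝ, E') f s g v) := by
  obtain ⟨rfl, d, hd, rfl⟩ := h
  have h1 := hf.hasMFDerivWithinAt.comp (0 : ℝ) (hd.hasMFDerivWithinAt (s := c ⁻¹' s)) subset_rfl
  exact ⟨rfl, _, h1.hasMFDerivAt hs, rfl⟩

theorem comp {f : M → M'} (h : HasVelocity c g v) (hf : MDifferentiableAt 𝓘(ℝ, E) 𝓘(ℝ, E') f g) :
    HasVelocity (fun t => f (c t)) (f g) (mfderiv 𝓘(ℝ, E) 𝓘(ℝ, E') f g v) := by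
  have := h.comp_within (s := univ) (mdifferentiableWithinAt_univ.2 hf) (by simp)
  rwa [mfderivWithin_univ] at this

end HasVelocity

theorem hasVelocity_line (z w : E) : HasVelocity (fun t : ℝ => z + t • w) z w := by
  refine ⟨by simp, ContinuousLinearMap.toSpanSingleton ℝ w, ?_, one_smul ℝ w⟩
  have h : HasDerivAt (fun t : ℝ => z + t • w) w 0 := by
    simpa using ((hasDerivAt_id (0 : ℝ)).smul_const w).const_add z
  exact h.hasFDerivAt.hasMFDerivAt

/-- A vector in the kernel of the differential of a submersion is the velocity of a curve in the
fibre. -/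
theorem Manifold.IsSubmersionAt.exists_hasVelocity [IsManifold 𝓘(ℝ, E) ∞ M]
    [IsManifold 𝓘(ℝ, E') ∞ M'] {f : M → M'} {g : M}
    (hf : Manifold.IsSubmersionAt 𝓘(ℝ, E) 𝓘(ℝ, E') ∞ f g) {v : TangentSpace 𝓘(ℝ, E) g}
    (hv : mfderiv 𝓘(ℝ, E) 𝓘(ℝ, E') f g v = 0) :
    ∃ c : ℝ → M, HasVelocity c g v ∧ ∀ᶠ t in 𝓝 0, f (c t) = f g := by
  set φ := hf.domChart
  set ψ := hf.codChart
  have hg : g ∈ φ.source := hf.mem_domChart_source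
  have hfg : f g ∈ ψ.source := hf.mem_codChart_source
  have hφ : MDifferentiableAt 𝓘(ℝ, E) 𝓘(ℝ, E) φ g :=
    ((contMDiffOn_of_mem_maximalAtlas hf.domChart_mem_maximalAtlas).contMDiffAt
      (φ.open_source.mem_nhds hg)).mdifferentiableAt (by simp)
  have hψ : MDifferentiableAt 𝓘(ℝ, E') 𝓘(ℝ, E') ψ (f g) :=
    ((contMDiffOn_of_mem_maximalAtlas hf.codChart_mem_maximalAtlas).contMDiffAt
      (ψ.open_source.mem_nhds hfg)).mdifferentiableAt (by simp)
  have hφs : MDifferentiableAt 𝓘(ℝ, E) 𝓘(ℝ, E) φ.symm (φ g) :=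
    ((contMDiffOn_symm_of_mem_maximalAtlas hf.domChart_mem_maximalAtlas).contMDiffAt
      (φ.open_target.mem_nhds (φ.map_source hg))).mdifferentiableAt (by simp)
  have hfd : MDifferentiableAt 𝓘(ℝ, E) 𝓘(ℝ, E') f g := hf.contMDiffAt.mdifferentiableAt (by simp)
  -- In adapted charts the submersion is a linear projection. A kernel vector has zero projection,
  -- so the straight line in its direction stays in the fibre.
  have heq : ∀ z ∈ φ.target, ψ (f (φ.symm z)) = (hf.equiv z).1 := fun z hz =>
    hf.writtenInCharts (by simpa using hz)
  set w : E := mfderiv 𝓘(ℝ, E) 𝓘(ℝ, E) φ g v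
  have hwv : mfderiv 𝓘(ℝ, E) 𝓘(ℝ, E) φ.symm (φ g) w = v := by
    have h1 := hφs.hasMFDerivAt.comp g hφ.hasMFDerivAt
    have h2 : HasMFDerivAt 𝓘(ℝ, E) 𝓘(ℝ, E) (φ.symm ∘ φ) g
        (ContinuousLinearMap.id ℝ (TangentSpace 𝓘(ℝ, E) g)) := by
      refine (hasMFDerivAt_id g).congr_of_eventuallyEq ?_
      filter_upwards [φ.open_source.mem_nhds hg] with y hy using φ.left_inv hy
    exact DFunLike.congr_fun (hasMFDerivAt_unique h1 h2) v
  have hw0 : (hf.equiv w).1 = 0 := by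
    have h1 := hψ.hasMFDerivAt.comp g hfd.hasMFDerivAt
    let l : E →L[ℝ] E' := (ContinuousLinearMap.fst ℝ E' hf.complement).comp
      (hf.equiv : E →L[ℝ] E' × hf.complement)
    have h2 := ((l.hasMFDerivAt (x := φ g)).comp g hφ.hasMFDerivAt).congr_of_eventuallyEq
      (f₁ := ψ ∘ f) (by
        filter_upwards [φ.open_source.mem_nhds hg] with y hy
        have := heq (φ y) (φ.map_source hy)
        rwa [φ.left_inv hy] at this)
    have h3 := DFunLike.congr_fun (hasMFDerivAt_unique h1 h2) v
    change mfderiv 𝓘(ℝ, E') 𝓘(ℝ, E') ψ (f g) (mfderiv 𝓘(ℝ, E) 𝓘(ℝ, E') f g v) = l w at h3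
    rw [hv, map_zero] at h3
    exact h3.symm
  refine ⟨fun t => φ.symm (φ g + t • w), ?_, ?_⟩
  · have h1 := (hasVelocity_line (φ g) w).comp hφs
    rw [hwv] at h1
    exact ⟨h1.1.trans (φ.left_inv hg), h1.2⟩
  · have hline : ContinuousAt (fun t : ℝ => φ g + t • w) 0 := by fun_prop
    have h0 : φ g + (0 : ℝ) • w ∈ φ.target := by simpa using φ.map_source hg
    filter_upwards [hline.preimage_mem_nhds (φ.open_target.mem_nhds h0)] with t ht
    refine ψ.injOn (hf.source_subset_preimage_source (φ.map_target ht)) hfg ?_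
    have h1 := heq _ (φ.map_source hg)
    rw [φ.left_inv hg] at h1
    rw [heq _ ht, h1, map_add, map_smul, Prod.fst_add, Prod.smul_fst, hw0, smul_zero, add_zero]

end Velocity

/-! ### The target map of a Lie groupoid as a Riemannian submersion. -/

section GroupoidSubmersion

variable {EB : Type*} [NormedAddCommGroup EB] [NormedSpace ℝ EB]
  {B : Type*} [TopologicalSpace B] [ChartedSpace EB B] [IsManifold 𝓘(ℝ, EB) ∞ B]
  {F : Type*} [NormedAddCommGroup F] [NormedSpace ℝ F]
  {A : B → Type*} [∀ x, AddCommGroup (A x)] [∀ x, Module ℝ (A x)]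
  [∀ x, TopologicalSpace (A x)] [∀ x, IsTopologicalAddGroup (A x)]
  [∀ x, ContinuousSMul ℝ (A x)]
  [TopologicalSpace (TotalSpace F A)] [FiberBundle F A] [VectorBundle ℝ F A]
  [ContMDiffVectorBundle ∞ F A 𝓘(ℝ, EB)]
  {FD : Type*} [NormedAddCommGroup FD] [NormedSpace ℝ FD]
  {D : B → Type*} [∀ x, AddCommGroup (D x)] [∀ x, Module ℝ (D x)]
  [∀ x, TopologicalSpace (D x)]
  [TopologicalSpace (TotalSpace FD D)] [FiberBundle FD D] [VectorBundle ℝ FD D]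
  [ContMDiffVectorBundle ∞ FD D 𝓘(ℝ, EB)]
  {EG : Type*} [NormedAddCommGroup EG] [NormedSpace ℝ EG]
  {G : Type*} [TopologicalSpace G] [ChartedSpace EG G] [IsManifold 𝓘(ℝ, EG) ∞ G]

namespace LieGroupoid

variable {𝒢 : LieGroupoid EB B EG G}

/-- Together with `mem_sourceTangent`, this describes source tangent vectors as velocities of curves
with constant source. Facts about translated vectors then reduce to groupoid identities along
curves. -/
theorem exists_hasVelocity {g : G} {v : TangentSpace 𝓘(ℝ, EG) g} (hv : v ∈ 𝒢.sourceTangent g) :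
    ∃ c : ℝ → G, HasVelocity c g v ∧ ∀ᶠ t in 𝓝 0, 𝒢.src (c t) = 𝒢.src g :=
  (𝒢.submersion_src g).exists_hasVelocity hv

theorem mem_sourceTangent {g : G} {v : TangentSpace 𝓘(ℝ, EG) g} {c : ℝ → G}
    (hc : HasVelocity c g v) (hs : ∀ᶠ t in 𝓝 0, 𝒢.src (c t) = 𝒢.src g) :
    v ∈ 𝒢.sourceTangent g :=
  (hc.comp ((𝒢.submersion_src g).contMDiffAt.mdifferentiableAt (by simp))).unique
    ((HasVelocity.const _).congr hs)

theorem mfderiv_trg_eq {g : G} {v : TangentSpace 𝓘(ℝ, EG) g} {c : ℝ → G}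
    (hc : HasVelocity c g v) :
    HasVelocity (fun t => 𝒢.trg (c t)) (𝒢.trg g) (mfderiv 𝓘(ℝ, EG) 𝓘(ℝ, EB) 𝒢.trg g v) :=
  hc.comp ((𝒢.submersion_trg g).contMDiffAt.mdifferentiableAt (by simp))

theorem hasVelocity_rightTranslate {k h : G} (hk : 𝒢.src h = 𝒢.trg k)
    {v : TangentSpace 𝓘(ℝ, EG) h} {c : ℝ → G} (hc : HasVelocity c h v)
    (hs : ∀ᶠ t in 𝓝 0, 𝒢.src (c t) = 𝒢.src h) :
    HasVelocity (fun t => 𝒢.mul (c t) k) (𝒢.mul h k) (𝒢.rightTranslate k h v) := by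
  refine hc.comp_within (f := fun h' => 𝒢.mul h' k) (s := 𝒢.sourceFiber (𝒢.trg k)) ?_
    (hs.mono fun t ht => ht.trans hk)
  have h1 := (𝒢.contMDiff_mul (h, k) hk).comp (t := {q : G × G | 𝒢.src q.1 = 𝒢.trg q.2})
    (s := 𝒢.sourceFiber (𝒢.trg k)) (f := fun h' => (h', k)) h
    ((contMDiffAt_id.prodMk contMDiffAt_const).contMDiffWithinAt) (fun h' hh' => hh')
  exact h1.mdifferentiableWithinAt (by simp)

namespace AlgebroidIdentification

variable {L : LieAlgebroid EB F A} (Φ : AlgebroidIdentification 𝒢 L)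

/-- A curve in a source fibre, translated to the identity, has the velocity that corresponds to
its velocity under the identification of the algebroid. -/
theorem hasVelocity_toAlgebroid {g : G} {v : TangentSpace 𝓘(ℝ, EG) g} {c : ℝ → G}
    (hc : HasVelocity c g v) (hs : ∀ᶠ t in 𝓝 0, 𝒢.src (c t) = 𝒢.src g) :
    HasVelocity (fun t => 𝒢.mul (c t) (𝒢.inv g)) (𝒢.one (𝒢.trg g))
      (Φ.toFun (𝒢.trg g) (Φ.toAlgebroid g v)) := by
  have h1 := (hasVelocity_rightTranslate (𝒢.trg_inv g).symm hc hs).cast (𝒢.mul_inv g)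
  have h2 : 𝒢.mul_inv g ▸ 𝒢.rightTranslate (𝒢.inv g) g v ∈ 𝒢.sourceTangent (𝒢.one (𝒢.trg g)) := by
    refine mem_sourceTangent (𝒢 := 𝒢) h1 ?_
    filter_upwards [hs] with t ht
    rw [𝒢.src_mul _ _ (ht.trans (𝒢.trg_inv g).symm), 𝒢.src_inv, 𝒢.src_one]
  have h3 : (𝒢.mul_inv g ▸ 𝒢.rightTranslate (𝒢.inv g) g v) ∈ Set.range (Φ.toFun (𝒢.trg g)) := by
    rw [Φ.range_eq]
    exact h2
  rw [toAlgebroid, Function.invFun_eq h3]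
  exact h1

/-- Right translation does not change targets, so a curve and its translate to the identity have the
same image in `B`. -/
theorem anchor_toAlgebroid {g : G} {v : TangentSpace 𝓘(ℝ, EG) g} (hv : v ∈ 𝒢.sourceTangent g) :
    L.anchor (𝒢.trg g) (Φ.toAlgebroid g v) = mfderiv 𝓘(ℝ, EG) 𝓘(ℝ, EB) 𝒢.trg g v := by
  obtain ⟨c, hc, hs⟩ := exists_hasVelocity (𝒢 := 𝒢) hv
  have h1 := mfderiv_trg_eq (𝒢 := 𝒢) (Φ.hasVelocity_toAlgebroid hc hs)
  rw [Φ.anchor_eq] at h1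
  have h2 := h1.cast (𝒢.trg_one _)
  -- The transport along `trg_one` in `anchor_eq` is undone by the one introduced by
  -- `HasVelocity.cast`.
  rw [eqRec_eq_cast, eqRec_eq_cast, cast_cast, cast_eq] at h2
  refine h2.unique ((mfderiv_trg_eq (𝒢 := 𝒢) hc).congr ?_)
  filter_upwards [hs] with t ht
  rw [𝒢.trg_mul _ _ (ht.trans (𝒢.trg_inv g).symm)]

/-- Translation back by `g` recovers the vector, since `(c g⁻¹) g = c` along curves with constant
source. -/
theorem toAlgebroid_injOn (g : G) : InjOn (Φ.toAlgebroid g) (𝒢.sourceTangent g) := by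
  have key : ∀ {v : TangentSpace 𝓘(ℝ, EG) g} (_ : v ∈ 𝒢.sourceTangent g),
      v = 𝒢.one_mul g ▸ 𝒢.rightTranslate g (𝒢.one (𝒢.trg g))
        (Φ.toFun (𝒢.trg g) (Φ.toAlgebroid g v)) := by
    intro v hv
    obtain ⟨c, hc, hs⟩ := exists_hasVelocity (𝒢 := 𝒢) hv
    have h1 := (hasVelocity_rightTranslate (𝒢 := 𝒢) (k := g) (𝒢.src_one _)
      (Φ.hasVelocity_toAlgebroid hc hs) (by
        filter_upwards [hs] with t ht
        rw [𝒢.src_mul _ _ (ht.trans (𝒢.trg_inv g).symm), 𝒢.src_inv, 𝒢.src_one])).cast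
      (𝒢.one_mul g)
    refine (hc.congr ?_).unique h1
    filter_upwards [hs] with t ht
    rw [← 𝒢.mul_assoc _ _ _ (ht.trans (𝒢.trg_inv g).symm) (𝒢.src_inv g), 𝒢.inv_mul, ← ht,
      𝒢.mul_one]
  intro v hv w hw hvw
  rw [key hv, hvw, ← key hw]

/-- The preimage is the right translate by `g` of the vector at the identity that corresponds to
`a`; the check is `(c g) g⁻¹ = c`. -/
theorem exists_toAlgebroid_eq (g : G) (a : A (𝒢.trg g)) :
    ∃ v ∈ 𝒢.sourceTangent g, Φ.toAlgebroid g v = a := by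
  have hw : Φ.toFun (𝒢.trg g) a ∈ 𝒢.sourceTangent (𝒢.one (𝒢.trg g)) := by
    have : Φ.toFun (𝒢.trg g) a ∈ Set.range (Φ.toFun (𝒢.trg g)) := ⟨a, rfl⟩
    rwa [Φ.range_eq] at this
  obtain ⟨c, hc, hs⟩ := exists_hasVelocity (𝒢 := 𝒢) hw
  rw [𝒢.src_one] at hs
  have h1 := (hasVelocity_rightTranslate (𝒢 := 𝒢) (k := g) (𝒢.src_one _) hc
    (by simpa only [𝒢.src_one] using hs)).cast (𝒢.one_mul g)
  have hs1 : ∀ᶠ t in 𝓝 0, 𝒢.src (𝒢.mul (c t) g) = 𝒢.src g := by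
    filter_upwards [hs] with t ht using 𝒢.src_mul _ _ ht
  refine ⟨_, mem_sourceTangent h1 hs1, Φ.injective _ ?_⟩
  refine (Φ.hasVelocity_toAlgebroid h1 hs1).unique (hc.congr ?_)
  filter_upwards [hs] with t ht
  rw [← 𝒢.mul_assoc _ _ _ ht (𝒢.trg_inv g).symm, 𝒢.mul_inv, ← ht, 𝒢.mul_one]

variable {S : SmoothDual EB F A FD D} {I : InertiaOperator S}

/-- Every element of `Ker #` comes from a source tangent vector that the differential of the target
kills, so orthogonality on the groupoid gives orthogonality in `A`. -/
theorem toAlgebroid_mem_horizontal {g : G} {v : TangentSpace 𝓘(ℝ, EG) g}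
    (hv : v ∈ Φ.horizontal I g) : Φ.toAlgebroid g v ∈ I.horizontal L (𝒢.trg g) := by
  intro k hk
  obtain ⟨w, hw, rfl⟩ := Φ.exists_toAlgebroid_eq g k
  exact hv.2 w hw (by rw [← Φ.anchor_toAlgebroid hw, hk])

/-- The target map of a Lie groupoid is a Riemannian submersion from the source fibres. -/
theorem isRiemannianSubmersionTrg (hL : L.IsTransitive) (hI : I.IsPositive)
    (hdec : I.HasOrthogonalDecomposition L)
    {gB : RiemannMetric EB B} (hgB : ∀ x (ζ η : TangentSpace 𝓘(ℝ, EB) x),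
      gB.form x ζ η = I.metric (I.anchorInv L x ζ) (I.anchorInv L x η)) (x : B) :
    Φ.IsRiemannianSubmersionTrg I gB x := by
  have hlift : ∀ g : G, ∀ ζ : TangentSpace 𝓘(ℝ, EB) (𝒢.trg g), ∃ v ∈ Φ.horizontal I g,
      mfderiv 𝓘(ℝ, EG) 𝓘(ℝ, EB) 𝒢.trg g v = ζ := by
    intro g ζ
    obtain ⟨v, hv, hva⟩ := Φ.exists_toAlgebroid_eq g (I.anchorInv L (𝒢.trg g) ζ)
    refine ⟨v, ⟨hv, fun k hk hk0 => ?_⟩, ?_⟩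
    · rw [sourceMetric, hva]
      exact InertiaOperator.anchorInv_mem hL hdec ζ _ (by rw [Φ.anchor_toAlgebroid hk, hk0])
    · rw [← Φ.anchor_toAlgebroid hv, hva, InertiaOperator.anchor_anchorInv hL hdec]
  refine ⟨fun g _ => (𝒢.submersion_trg g).contMDiffAt.contMDiffWithinAt, fun g _ ζ => ?_,
    fun g _ => ⟨mapsTo_univ _ _, fun v hv w hw hvw => ?_, fun ζ _ => hlift g ζ⟩,
    fun g _ v hv w hw => ?_⟩
  · obtain ⟨v, hv, h⟩ := hlift g ζ
    exact ⟨v, hv.1, h⟩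
  · refine Φ.toAlgebroid_injOn g hv.1 hw.1 (InertiaOperator.eq_of_mem_horizontal hI
      (Φ.toAlgebroid_mem_horizontal hv) (Φ.toAlgebroid_mem_horizontal hw) ?_)
    rw [Φ.anchor_toAlgebroid hv.1, Φ.anchor_toAlgebroid hw.1, hvw]
  · rw [hgB, InertiaOperator.anchorInv_eq hL hI hdec (Φ.toAlgebroid_mem_horizontal hv)
      (Φ.anchor_toAlgebroid hv.1), InertiaOperator.anchorInv_eq hL hI hdec
      (Φ.toAlgebroid_mem_horizontal hw) (Φ.anchor_toAlgebroid hw.1)]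
    rfl

end AlgebroidIdentification

end LieGroupoid

end GroupoidSubmersion

/-! ### The proposition. -/

theorem mainTheorem11
    {EB : Type*} [NormedAddCommGroup EB] [NormedSpace ℝ EB] [CompleteSpace EB]
    {B : Type*} [TopologicalSpace B] [ChartedSpace EB B] [IsManifold 𝓘(ℝ, EB) ∞ B]
    {F : Type*} [NormedAddCommGroup F] [NormedSpace ℝ F] [CompleteSpace F]
    {A : B → Type*} [∀ x, AddCommGroup (A x)] [∀ x, Module ℝ (A x)]
    [∀ x, TopologicalSpace (A x)] [∀ x, IsTopologicalAddGroup (A x)]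
    [∀ x, ContinuousSMul ℝ (A x)]
    [TopologicalSpace (TotalSpace F A)] [FiberBundle F A] [VectorBundle ℝ F A]
    [ContMDiffVectorBundle ∞ F A 𝓘(ℝ, EB)]
    {FD : Type*} [NormedAddCommGroup FD] [NormedSpace ℝ FD] [CompleteSpace FD]
    {D : B → Type*} [∀ x, AddCommGroup (D x)] [∀ x, Module ℝ (D x)]
    [∀ x, TopologicalSpace (D x)]
    [TopologicalSpace (TotalSpace FD D)] [FiberBundle FD D] [VectorBundle ℝ FD D]
    [ContMDiffVectorBundle ∞ FD D 𝓘(ℝ, EB)]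
    (L : LieAlgebroid EB F A) (hL : L.IsTransitive)
    (S : SmoothDual EB F A FD D)
    (I : InertiaOperator S) (hI : I.IsPositive) (hdec : I.HasOrthogonalDecomposition L) :
    ∃ gB : RiemannMetric EB B,
      (∀ x (ζ η : TangentSpace 𝓘(ℝ, EB) x),
        gB.form x ζ η = I.metric (I.anchorInv L x ζ) (I.anchorInv L x η)) ∧
      (PreconnectedSpace B → ∀ ξ ∈ L.dualAnchorImage S,
        L.symplecticLeaf S ξ = L.dualAnchorImage S) ∧
      (∀ (J : Set ℝ) (γ : ℝ → TotalSpace FD D), IsOpen J → IsPreconnected J →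
        I.IsEulerArnoldTrajectory L γ J → (∃ t ∈ J, γ t ∈ L.dualAnchorImage S) →
        ∀ t ∈ J, γ t ∈ L.dualAnchorImage S) ∧
      (∀ (J : Set ℝ) (x : ℝ → B) (p : ∀ t, TangentSpace 𝓘(ℝ, EB) (x t) →L[ℝ] ℝ)
        (ξ : ∀ t, D (x t)), IsOpen J →
        (∀ t ∈ J, ∀ a : A (x t), S.pairing (x t) (ξ t) a = p t (L.anchor (x t) a)) →
        (I.IsEulerArnoldTrajectory L (fun t => ⟨x t, ξ t⟩) J ↔
          gB.IsGeodesicFlowTrajectory x p J)) ∧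
      (∀ x, BijOn (L.anchor x) (I.horizontal L x) univ ∧
        ∀ a ∈ I.horizontal L x, ∀ b ∈ I.horizontal L x,
          gB.form x (L.anchor x a) (L.anchor x b) = I.metric a b) ∧
      (∀ {EG : Type*} [NormedAddCommGroup EG] [NormedSpace ℝ EG] [CompleteSpace EG]
        {G : Type*} [TopologicalSpace G] [ChartedSpace EG G] [IsManifold 𝓘(ℝ, EG) ∞ G]
        (𝒢 : LieGroupoid EB B EG G), 𝒢.IsTransitive →
        ∀ (Φ : LieGroupoid.AlgebroidIdentification 𝒢 L) (x : B),
          Φ.IsRiemannianSubmersionTrg I gB x) := by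
  obtain ⟨gB, hgB⟩ := InertiaOperator.exists_riemannMetric hL hI hdec
  refine ⟨gB, hgB, fun _ ξ hξ => InertiaOperator.symplecticLeaf_eq_dualAnchorImage hL hI hdec hξ,
    fun J γ hJ hJc hγ hmeet t ht => ?_, fun J x p ξ hJ hξ =>
      ⟨InertiaOperator.isGeodesicFlowTrajectory_of_isEulerArnoldTrajectory hL hI hdec hgB hJ hξ,
        InertiaOperator.isEulerArnoldTrajectory_of_isGeodesicFlowTrajectory hL hI hdec hgB hJ hξ⟩,
    fun x => ⟨⟨mapsTo_univ _ _, fun a ha b hb h => InertiaOperator.eq_of_mem_horizontal hI ha hb h,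
      fun v _ => InertiaOperator.exists_mem_horizontal hL hdec v⟩, fun a ha b hb => ?_⟩, ?_⟩
  · obtain ⟨s, hs, hsi⟩ := hmeet
    exact InertiaOperator.mem_dualAnchorImage_of_isHamiltonianTrajectory hL hI hdec isOpen_univ
      I.isSmoothFunctionOn_hamiltonian hJ (fun _ _ => mem_univ _) hγ subset_rfl hJc hs ht hsi
  · rw [hgB, InertiaOperator.anchorInv_eq hL hI hdec ha rfl,
      InertiaOperator.anchorInv_eq hL hI hdec hb rfl]
  · intro EG _ _ _ G _ _ _ 𝒢 _ Φ x
    exact Φ.isRiemannianSubmersionTrg hL hI hdec hgB x
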